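/- Let $G_{5,2}$ be the Grassmannian of complex $2$-planes in $\mathbb{C}^5$, with the coordinatewise actions of $T^5\subset(\mathbb{C}^*)^5$, Plücker coordinates $P^I$ ($I\subset\{1,\dots,5\}$, $|I|=2$), charts $M_I=\{P^I\neq 0\}$, and strata $W_\sigma=\{L : P^I(L)\ne 0\Leftrightarrow I\in\sigma\}$; $\sigma$ is admissible if $W_\sigma\neq\emptyset$. Let $W$ be the main stratum (all $P^I\neq0$), $F=W/(\mathbb{C}^*)^5$ its space of parameters, $\mathring\Delta_{5,2}=\{x\in\mathbb{R}^5: 0<x_i<1,\ \sum x_i=2\}$, and $h=(\hat\mu,p):W/T^5\to\mathring\Delta_{5,2}\times F$ the canonical trivialization, where $\hat\mu$ is induced by the moment map $\mu(L)=\sum_I|P^I|^2\Lambda_I/\sum_I|P^I|^2$ and $p$ is the projection. For $I=\{k<l\}$ with complement $\{p<q<r\}$, represent $L\in M_I$ by the $5\times2$ matrix with identity rows $k,l$ and with rows $p,q,r$ equal to $(z_1,z_4),(z_2,z_5),(z_3,z_6)$. The equations $c_1'z_1z_5=c_1z_2z_4$, $c_2'z_1z_6=c_2z_3z_4$, $c_3'z_2z_6=c_3z_3z_5$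 identify $F$ with $$F_I=\{((c_i:c_i'))_{i=1}^3\in\mathcal F:\ c_i,c_i'\ne0,\ c_i\neq c_i'\},\qquad \mathcal F=\{c_1c_2'c_3=c_1'c_2c_3'\}\subset(\mathbb{C}P^1)^3 .$$ Write $f_I:F_I\to F$ for this identification and $f_{I,J}=f_J^{-1}\circ f_I:F_I\to F_J$ for the transition maps. If $X$ is a topological space into which the sets $F_I$ (the same subset of $\mathcal F$ for all $I$) are embedded, the virtual space of parameters $\tilde F_{\sigma,I}\subset X$ of $W_\sigma$ in the chart $M_I$ is the set of all $c\in X$ for which there are $x_n\in\mathring\Delta_{5,2}$ and $c_n\in F_I$ such that $c_n\to c$ in $X$ and $h^{-1}(x_n,f_I(c_n))$ converges in $G_{5,2}/T^5$ to a point of $W_\sigma/T^5$. A universal space of parameters for $G_{5,2}$ is a compact Hausdorff space $X$ containing $F_I$ as a dense subspace such that, for each admissible $\sigma$, the spaces $\tilde F_{\sigma,I}$ and $\tilde F_{\sigma,J}$ are homeomorphic for any two charts $M_I$, $M_J$. **Theorem.** Let $\tilde{\mathcal F}$ be the blowup of the cubic surface $\mathcal F$ at the point $((1:1),(1:1),(1:1))$,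 with the natural inclusion $F_I\subset\tilde{\mathcal F}$. 1. $\tilde{\mathcal F}$ is a universal space of parameters for $G_{5,2}$. 2. For any two charts $M_I,M_J$ there is a homeomorphism $\tilde f_{I,J}:\tilde{\mathcal F}\to\tilde{\mathcal F}$ which equals $f_{I,J}$ on $F_I$ and satisfies $\tilde f_{I,J}(\tilde F_{\sigma,I})=\tilde F_{\sigma,J}$ for every admissible $\sigma$. 3. $\tilde{\mathcal F}$ is homeomorphic to the blowup of $\mathbb{C}P^1\times\mathbb{C}P^1$ at the points $((1:0),(1:0))$, $((0:1),(0:1))$, $((1:1),(1:1))$. 4. $\tilde{\mathcal F}$ is homeomorphic to the blowup of $\mathbb{C}P^2$ at the points $(1:0:0)$, $(0:1:0)$, $(0:0:1)$, $(1:1:1)$. -/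

import Mathlib

open Filter Topology
open scoped LinearAlgebra.Projectivization

noncomputable section

/-! ## Projective spaces with their quotient topology, the Segre map, blowups at points -/

/-- The quotient topology on a complex projective space. -/
instance projTopology {V : Type*} [AddCommGroup V] [Module ℂ V] [TopologicalSpace V] :
    TopologicalSpace (ℙ ℂ V) :=
  TopologicalSpace.coinduced (Projectivization.mk' ℂ) inferInstance

/-- The complex projective space with homogeneous coordinates indexed by `ι`. -/
abbrev CProj (ι : Type) : Type := ℙ ℂ (ι → ℂ)

/-- The complex projective line. -/
abbrev CP1 : Type := CProj (Fin 2)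

/-- The point with homogeneous coordinates `(a : b)`. -/
def CP1.pt (a b : ℂ) (h : (![a, b] : Fin 2 → ℂ) ≠ 0) : CP1 := Projectivization.mk ℂ ![a, b] h

/-- The decomposable tensor `v₁ ⊗ ⋯ ⊗ vₘ` in coordinates. -/
def tensorVec {m : ℕ} (v : Fin m → Fin 2 → ℂ) : (Fin m → Fin 2) → ℂ := fun e => ∏ i, v i (e i)

theorem tensorVec_ne_zero {m : ℕ} (v : Fin m → Fin 2 → ℂ) (hv : ∀ i, v i ≠ 0) :
    tensorVec v ≠ 0 := by
  have h : ∀ i, ∃ k, v i k ≠ 0 := fun i => Function.ne_iff.1 (hv i)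
  choose e he using h
  intro h0
  have := congrFun h0 e
  exact (Finset.prod_ne_zero_iff.2 fun i _ => he i) this

/-- The Segre embedding of `(CP¹)ᵐ` into the projective space of dimension `2ᵐ - 1`. -/
def segre {m : ℕ} (c : Fin m → CP1) : CProj (Fin m → Fin 2) :=
  Projectivization.mk ℂ (tensorVec fun i => (c i).rep)
    (tensorVec_ne_zero _ fun i => (c i).rep_nonzero)

theorem segre_injective {m : ℕ} :
    Function.Injective (segre : (Fin m → CP1) → CProj (Fin m → Fin 2)) := by
  intro c d h
  obtain ⟨a, ha⟩ := (Projectivization.mk_eq_mk_iff' ℂ _ _ _ _).1 h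
  have key : ∀ e, a * tensorVec (fun i => (d i).rep) e = tensorVec (fun i => (c i).rep) e :=
    fun e => congrFun ha e
  have hc : ∀ i, ∃ k, (c i).rep k ≠ 0 := fun i => Function.ne_iff.1 (c i).rep_nonzero
  choose e he using hc
  funext i
  rw [← (c i).mk_rep, ← (d i).mk_rep, Projectivization.mk_eq_mk_iff']
  have split : ∀ (v : Fin m → Fin 2 → ℂ) (k : Fin 2),
      tensorVec v (Function.update e i k) = v i k * ∏ j ∈ Finset.univ.erase i, v j (e j) := by
    intro v k
    rw [tensorVec, ← Finset.mul_prod_erase _ _ (Finset.mem_univ i)]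
    simp only [Function.update_self]
    congr 1
    refine Finset.prod_congr rfl fun j hj => ?_
    rw [Function.update_of_ne (Finset.ne_of_mem_erase hj)]
  set Pc := ∏ j ∈ Finset.univ.erase i, (c j).rep (e j) with hPc
  set Pd := ∏ j ∈ Finset.univ.erase i, (d j).rep (e j) with hPd
  have hPc0 : Pc ≠ 0 := Finset.prod_ne_zero_iff.2 fun j _ => he j
  refine ⟨a * Pd / Pc, ?_⟩
  funext k
  have := key (Function.update e i k)
  rw [split, split] at this
  simp only [Pi.smul_apply, smul_eq_mul]
  field_simp
  linear_combination this

/-- The vector `v ∧ p`, that is the values at `v` of the linear forms `xᵢ pⱼ - xⱼ pᵢ`. These forms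
span the linear forms vanishing at `p`, so `[v] ↦ [v ∧ p]` is the linear projection from the
point `[p]`. -/
def wedgeVec {ι : Type} (p v : ι → ℂ) : ι × ι → ℂ := fun ij => v ij.1 * p ij.2 - v ij.2 * p ij.1

theorem wedgeVec_ne_zero {ι : Type} {p v : CProj ι} (h : v ≠ p) : wedgeVec p.rep v.rep ≠ 0 := by
  intro h0
  apply h
  obtain ⟨j, hj⟩ := Function.ne_iff.1 p.rep_nonzero
  rw [← v.mk_rep, ← p.mk_rep, Projectivization.mk_eq_mk_iff']
  refine ⟨v.rep j / p.rep j, ?_⟩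
  funext i
  have h1 : v.rep i * p.rep j - v.rep j * p.rep i = 0 := congrFun h0 (i, j)
  simp only [Pi.smul_apply, smul_eq_mul]
  have hj' : p.rep j ≠ 0 := hj
  field_simp
  linear_combination -h1

/-- The blowup at the points `s 0, …, s (k-1)` of a projective variety `X`, given with a projective
embedding `j`: the closure of the graph of the simultaneous linear projections from these points,
which are defined on `X` outside the centres. -/
def blowupSet {X ι : Type} [TopologicalSpace X] (j : X → CProj ι) {k : ℕ} (s : Fin k → X) :
    Set (X × (Fin k → CProj (ι × ι))) :=
  closure {z | ∀ a, ∃ h : j z.1 ≠ j (s a),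
    z.2 a = Projectivization.mk ℂ (wedgeVec (j (s a)).rep (j z.1).rep) (wedgeVec_ne_zero h)}

/-- The blowup as a topological space. -/
abbrev Blowup {X ι : Type} [TopologicalSpace X] (j : X → CProj ι) {k : ℕ} (s : Fin k → X) : Type :=
  blowupSet j s

/-- The point of the blowup over a point different from the centres. -/
def Blowup.lift {X ι : Type} [TopologicalSpace X] (j : X → CProj ι) {k : ℕ} (s : Fin k → X)
    (x : X) (h : ∀ a, j x ≠ j (s a)) : Blowup j s :=
  ⟨(x, fun a => Projectivization.mk ℂ (wedgeVec (j (s a)).rep (j x).rep) (wedgeVec_ne_zero (h a))),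
    subset_closure fun a => ⟨h a, rfl⟩⟩

/-! ## The Grassmannian `G_{5,2}`, its strata, the torus actions and the moment map -/

/-- The Grassmannian of complex two-dimensional subspaces of `ℂ⁵`. -/
def Gr : Type := {L : Submodule ℂ (Fin 5 → ℂ) // Module.finrank ℂ L = 2}

/-- The `5 × 2` matrices of rank two. -/
abbrev Frame : Type := {A : Matrix (Fin 5) (Fin 2) ℂ // LinearIndependent ℂ A.col}

/-- The column space of a matrix of rank two. -/
def Frame.span (A : Frame) : Gr :=
  ⟨Submodule.span ℂ (Set.range A.1.col), by simpa using finrank_span_eq_card A.2⟩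

/-- The usual topology on the Grassmannian, the quotient topology from matrices of rank two. -/
instance : TopologicalSpace Gr := TopologicalSpace.coinduced Frame.span inferInstance

theorem Frame.span_surjective : Function.Surjective Frame.span := by
  intro L
  have : FiniteDimensional ℂ L.1 := inferInstance
  let b := Module.finBasisOfFinrankEq ℂ L.1 L.2
  have hcol : (Matrix.of fun i k => (b k : Fin 5 → ℂ) i).col = fun k => (b k : Fin 5 → ℂ) := rfl
  refine ⟨⟨Matrix.of fun i k => (b k : Fin 5 → ℂ) i, ?_⟩, ?_⟩
  · rw [hcol]
    exact b.linearIndependent.map' L.1.subtype (Submodule.ker_subtype _)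
  · apply Subtype.ext
    change Submodule.span ℂ (Set.range (Matrix.of fun i k => (b k : Fin 5 → ℂ) i).col) = L.1
    rw [hcol]
    have h2 : (Set.range fun k => (b k : Fin 5 → ℂ)) = L.1.subtype '' Set.range b := by
      rw [← Set.range_comp]; rfl
    rw [h2, Submodule.span_image, b.span_eq, Submodule.map_top, Submodule.range_subtype]

/-- A matrix `A_L` representing `L`. -/
def Gr.matrix (L : Gr) : Matrix (Fin 5) (Fin 2) ℂ := (Function.surjInv Frame.span_surjective L).1

/-- The two-element subsets of the five indices; they label Plücker coordinates and charts. -/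
abbrev Pair : Type := {I : Finset (Fin 5) // I.card = 2}

/-- The two elements `k < l` of `I`. -/
def Pair.row (I : Pair) : Fin 2 → Fin 5 := I.1.orderEmbOfFin I.2

theorem Pair.card_compl (I : Pair) : (I.1ᶜ).card = 3 := by
  rw [Finset.card_compl, I.2]; rfl

/-- The three elements `p < q < r` of the complement of `I`. -/
def Pair.co (I : Pair) : Fin 3 → Fin 5 := (I.1ᶜ).orderEmbOfFin I.card_compl

/-- The minor `P^I(A)` on the rows indexed by `I`. -/
def plucker (A : Matrix (Fin 5) (Fin 2) ℂ) (I : Pair) : ℂ := (A.submatrix I.row id).det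

/-- The stratum `W_σ`. -/
def stratum (σ : Set Pair) : Set Gr := {L | ∀ I, plucker L.matrix I ≠ 0 ↔ I ∈ σ}

/-- `σ` is admissible if its stratum is non-empty. -/
def Admissible (σ : Set Pair) : Prop := (stratum σ).Nonempty

/-- The main stratum `W`: all Plücker coordinates are non-zero. -/
abbrev MainStratum : Type := stratum Set.univ

/-- The algebraic torus `(ℂ*)⁵`. -/
abbrev AlgTorus : Type := Fin 5 → ℂˣ

/-- The coordinatewise action of the algebraic torus on `ℂ⁵`. -/
def scaleEquiv (t : AlgTorus) : (Fin 5 → ℂ) ≃ₗ[ℂ] (Fin 5 → ℂ) :=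
  LinearEquiv.piCongrRight fun i => LinearEquiv.smulOfUnit (t i)

theorem scaleEquiv_apply (t : AlgTorus) (v : Fin 5 → ℂ) (i : Fin 5) :
    scaleEquiv t v i = t i * v i := rfl

/-- The induced action on the Grassmannian. -/
instance : MulAction AlgTorus Gr where
  smul t L := ⟨L.1.map (scaleEquiv t).toLinearMap, by
    rw [LinearEquiv.finrank_map_eq]; exact L.2⟩
  one_smul L := by
    apply Subtype.ext
    change L.1.map (scaleEquiv 1).toLinearMap = L.1
    have : (scaleEquiv 1).toLinearMap = LinearMap.id := by
      apply LinearMap.ext; intro v; funext i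
      simp [scaleEquiv_apply]
    rw [this, Submodule.map_id]
  mul_smul s t L := by
    apply Subtype.ext
    change L.1.map (scaleEquiv (s * t)).toLinearMap =
      (L.1.map (scaleEquiv t).toLinearMap).map (scaleEquiv s).toLinearMap
    rw [← Submodule.map_comp]
    congr 1
    apply LinearMap.ext; intro v; funext i
    simp [scaleEquiv_apply, mul_assoc]

theorem smul_val (t : AlgTorus) (L : Gr) : (t • L).1 = L.1.map (scaleEquiv t).toLinearMap := rfl

/-- The compact torus `T⁵`. -/
def compactTorus : Subgroup AlgTorus where
  carrier := {t | ∀ i, ‖(t i : ℂ)‖ = 1}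
  one_mem' := by intro i; simp
  mul_mem' := by
    intro s t hs ht i
    simp [hs i, ht i]
  inv_mem' := by
    intro s hs i
    simp [hs i]

/-- The orbit space `G_{5,2} / T⁵`. -/
abbrev OrbitSpace : Type := MulAction.orbitRel.Quotient compactTorus Gr

/-- The subset `W_σ / T⁵` of `G_{5,2} / T⁵`. -/
def orbitStratum (σ : Set Pair) : Set OrbitSpace :=
  (fun L : Gr => (Quotient.mk _ L : OrbitSpace)) '' stratum σ

/-- The orbit space `W / T⁵` of the main stratum. -/
abbrev MainOrbitSpace : Type :=
  Quotient ((MulAction.orbitRel compactTorus Gr).comap (Subtype.val : MainStratum → Gr))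

/-- The space of parameters `F = W / (ℂ*)⁵` of the main stratum. -/
abbrev MainParam : Type :=
  Quotient ((MulAction.orbitRel AlgTorus Gr).comap (Subtype.val : MainStratum → Gr))

/-- The inclusion of `W / T⁵` into `G_{5,2} / T⁵`. -/
def MainOrbitSpace.incl : MainOrbitSpace → OrbitSpace :=
  Quotient.map Subtype.val fun _ _ h => h

/-- The vertex `Λ_I` of the hypersimplex. -/
def vertexVec (I : Pair) : Fin 5 → ℝ := fun i => if i ∈ I.1 then 1 else 0

/-- The moment map. -/
def momentMap (L : Gr) : Fin 5 → ℝ :=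
  (∑ I, ‖plucker L.matrix I‖ ^ 2)⁻¹ • ∑ I, ‖plucker L.matrix I‖ ^ 2 • vertexVec I

/-- The interior of the hypersimplex `Δ_{5,2}` (in the hyperplane it spans). -/
def openHypersimplex : Set (Fin 5 → ℝ) := {x | (∀ i, 0 < x i ∧ x i < 1) ∧ ∑ i, x i = 2}

theorem Gr.matrix_span (L : Gr) : Submodule.span ℂ (Set.range L.matrix.col) = L.1 :=
  congrArg Subtype.val (Function.surjInv_eq Frame.span_surjective L)

theorem Gr.matrix_linearIndependent (L : Gr) : LinearIndependent ℂ L.matrix.col :=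
  (Function.surjInv Frame.span_surjective L).2

/-- Two matrices of the same subspace differ by an invertible change of basis. -/
theorem exists_change {A B : Matrix (Fin 5) (Fin 2) ℂ} (hA : LinearIndependent ℂ A.col)
    (h : Submodule.span ℂ (Set.range A.col) = Submodule.span ℂ (Set.range B.col)) :
    ∃ g : Matrix (Fin 2) (Fin 2) ℂ, g.det ≠ 0 ∧ B = A * g := by
  have aux : ∀ {A B : Matrix (Fin 5) (Fin 2) ℂ},
      Submodule.span ℂ (Set.range A.col) = Submodule.span ℂ (Set.range B.col) →
      ∃ g : Matrix (Fin 2) (Fin 2) ℂ, B = A * g := by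
    intro A B h
    have hm : ∀ k, ∃ c : Fin 2 → ℂ, ∑ i, c i • A.col i = B.col k := by
      intro k
      have : B.col k ∈ Submodule.span ℂ (Set.range A.col) := by
        rw [h]; exact Submodule.subset_span ⟨k, rfl⟩
      exact (Submodule.mem_span_range_iff_exists_fun ℂ).1 this
    choose c hc using hm
    refine ⟨Matrix.of fun i k => c k i, ?_⟩
    ext x k
    have := congrFun (hc k) x
    simp only [Fin.sum_univ_two, Pi.add_apply, Pi.smul_apply, smul_eq_mul, Matrix.col_apply]
      at this
    rw [← this, Matrix.mul_apply, Fin.sum_univ_two]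
    simp [mul_comm]
  obtain ⟨g, hg⟩ := aux h
  obtain ⟨g', hg'⟩ := aux h.symm
  refine ⟨g, ?_, hg⟩
  have hinj : Function.Injective A.mulVec := Matrix.mulVec_injective_iff.2 hA
  have h1 : A * (g * g') = A * (1 : Matrix (Fin 2) (Fin 2) ℂ) := by
    rw [← Matrix.mul_assoc, ← hg, ← hg', Matrix.mul_one]
  have h2 : g * g' = 1 := by
    have h3 : ∀ v, (g * g').mulVec v = (1 : Matrix (Fin 2) (Fin 2) ℂ).mulVec v := by
      intro v
      apply hinj
      rw [Matrix.mulVec_mulVec, Matrix.mulVec_mulVec, h1]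
    exact Matrix.toLin'.injective (LinearMap.ext h3)
  intro h0
  have := congrArg Matrix.det h2
  rw [Matrix.det_mul, h0] at this
  simp at this

theorem col_scale (t : AlgTorus) (A : Matrix (Fin 5) (Fin 2) ℂ) (k : Fin 2) :
    (Matrix.of fun x y => (t x : ℂ) * A x y).col k = scaleEquiv t (A.col k) := rfl

/-- The matrix of `t • L` is the scaled matrix of `L` up to a change of basis. -/
theorem exists_change_smul (t : AlgTorus) {L : Gr} {A B : Matrix (Fin 5) (Fin 2) ℂ}
    (hA : LinearIndependent ℂ A.col) (hAL : Submodule.span ℂ (Set.range A.col) = L.1)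
    (hBL : Submodule.span ℂ (Set.range B.col) = (t • L).1) :
    ∃ g : Matrix (Fin 2) (Fin 2) ℂ, g.det ≠ 0 ∧
      B = (Matrix.of fun x y => (t x : ℂ) * A x y) * g := by
  have hcol : (Matrix.of fun x y => (t x : ℂ) * A x y).col =
      (scaleEquiv t).toLinearMap ∘ A.col := rfl
  apply exists_change
  · rw [hcol]
    exact hA.map' _ (LinearEquiv.ker _)
  · rw [hBL, smul_val, ← hAL, hcol, Set.range_comp, Submodule.span_image]

theorem plucker_mul (A : Matrix (Fin 5) (Fin 2) ℂ) (g : Matrix (Fin 2) (Fin 2) ℂ) (I : Pair) :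
    plucker (A * g) I = plucker A I * g.det := by
  rw [plucker, plucker, ← Matrix.det_mul]
  rfl

theorem plucker_scale (t : AlgTorus) (A : Matrix (Fin 5) (Fin 2) ℂ) (I : Pair) :
    plucker (Matrix.of fun x y => (t x : ℂ) * A x y) I =
      t (I.row 0) * t (I.row 1) * plucker A I := by
  simp only [plucker, Matrix.det_fin_two, Matrix.submatrix_apply, Matrix.of_apply, id]
  ring

theorem momentMap_smul (t : compactTorus) (L : Gr) : momentMap (t • L) = momentMap L := by
  obtain ⟨g, hg, h⟩ := exists_change_smul t.1 L.matrix_linearIndependent L.matrix_span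
    (t • L).matrix_span
  have hP : ∀ I, ‖plucker (t • L).matrix I‖ ^ 2 = ‖g.det‖ ^ 2 * ‖plucker L.matrix I‖ ^ 2 := by
    intro I
    rw [h, plucker_mul, plucker_scale]
    simp only [norm_mul]
    rw [t.2 (I.row 0), t.2 (I.row 1)]
    ring
  have hg' : ‖g.det‖ ^ 2 ≠ 0 := by simpa using hg
  simp only [momentMap, hP, mul_smul, ← Finset.mul_sum, ← Finset.smul_sum]
  rw [mul_inv, smul_smul, mul_right_comm, inv_mul_cancel₀ hg', one_mul]

/-- The map `W / T⁵ → ℝ⁵ × F` formed by the moment map and the canonical projection; it is the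
canonical trivialization `h : W / T⁵ → Δ° × F`. -/
def trivialization : MainOrbitSpace → (Fin 5 → ℝ) × MainParam :=
  Quotient.lift (fun L : MainStratum => (momentMap L.1, (Quotient.mk _ L : MainParam))) (by
    rintro a b ⟨t, ht⟩
    have ht' : t • b.1 = a.1 := ht
    apply Prod.ext
    · change momentMap a.1 = momentMap b.1
      rw [← ht', momentMap_smul]
    · exact Quotient.sound ⟨t.1, ht'⟩)

/-! ## The space of parameters of the main stratum in the coordinates of a chart -/

/-- The matrix representing `L` in the chart `M_I`: its rows indexed by `I` form the identity
matrix. -/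
def chartMatrix (I : Pair) (L : Gr) : Matrix (Fin 5) (Fin 2) ℂ :=
  L.matrix * (L.matrix.submatrix I.row id)⁻¹

/-- The cubic surface `c₁ c₂' c₃ = c₁' c₂ c₃'` in `(CP¹)³`. -/
def cubicSurface : Set (Fin 3 → CP1) :=
  {c | (c 0).rep 0 * (c 1).rep 1 * (c 2).rep 0 = (c 0).rep 1 * (c 1).rep 0 * (c 2).rep 1}

/-- The subset of the cubic surface where `cᵢ ≠ 0`, `cᵢ' ≠ 0`, `cᵢ ≠ cᵢ'`. It is the space of
parameters `F_I` of the main stratum in the coordinates of any chart `M_I`. -/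
def openCubic : Set (Fin 3 → CP1) :=
  {c | c ∈ cubicSurface ∧ ∀ i, (c i).rep 0 ≠ 0 ∧ (c i).rep 1 ≠ 0 ∧ (c i).rep 0 ≠ (c i).rep 1}

theorem Pair.cases_row (I : Pair) (x : Fin 5) :
    x = I.row 0 ∨ x = I.row 1 ∨ x = I.co 0 ∨ x = I.co 1 ∨ x = I.co 2 := by
  by_cases hx : x ∈ I.1
  · have : x ∈ Set.range (I.1.orderEmbOfFin I.2) := by
      rw [Finset.range_orderEmbOfFin]; exact hx
    obtain ⟨k, rfl⟩ := this
    fin_cases k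
    · left; rfl
    · right; left; rfl
  · have : x ∈ Set.range ((I.1ᶜ).orderEmbOfFin I.card_compl) := by
      rw [Finset.range_orderEmbOfFin]; simpa using hx
    obtain ⟨k, rfl⟩ := this
    fin_cases k
    · right; right; left; rfl
    · right; right; right; left; rfl
    · right; right; right; right; rfl

theorem Pair.cases_of (J I : Pair) (k : Fin 2) : J.row k = I.row 0 ∨ J.row k = I.row 1 ∨
    J.row k = I.co 0 ∨ J.row k = I.co 1 ∨ J.row k = I.co 2 := I.cases_row _

theorem Pair.row_mem (I : Pair) (k : Fin 2) : I.row k ∈ I.1 := Finset.orderEmbOfFin_mem _ _ _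

theorem Pair.co_notMem (I : Pair) (k : Fin 3) : I.co k ∉ I.1 := by
  exact Finset.mem_compl.1 (Finset.orderEmbOfFin_mem (I.1ᶜ) I.card_compl k)

theorem Pair.row_ne_co (I : Pair) (k : Fin 2) (m : Fin 3) : I.row k ≠ I.co m := by
  intro h
  exact I.co_notMem m (h ▸ I.row_mem k)

theorem Pair.row_inj (I : Pair) {k m : Fin 2} : I.row k = I.row m ↔ k = m :=
  (I.1.orderEmbOfFin I.2).injective.eq_iff

theorem Pair.co_inj (I : Pair) {k m : Fin 3} : I.co k = I.co m ↔ k = m :=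
  ((I.1ᶜ).orderEmbOfFin I.card_compl).injective.eq_iff

/-- All minors, on ordered or unordered pairs of rows, are non-zero. -/
theorem minor_ne_zero {A : Matrix (Fin 5) (Fin 2) ℂ} (h : ∀ I, plucker A I ≠ 0) {x y : Fin 5}
    (hxy : x ≠ y) : A x 0 * A y 1 - A x 1 * A y 0 ≠ 0 := by
  let I : Pair := ⟨{x, y}, Finset.card_pair hxy⟩
  have hI := h I
  rw [plucker, Matrix.det_fin_two] at hI
  simp only [Matrix.submatrix_apply, id] at hI
  have h0 := I.row_mem 0
  have h1 := I.row_mem 1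
  have h01 : I.row 0 ≠ I.row 1 := fun h => by simpa using I.row_inj.1 h
  have e : I.1 = {x, y} := rfl
  rw [e, Finset.mem_insert, Finset.mem_singleton] at h0 h1
  intro hz
  apply hI
  rcases h0 with h0 | h0 <;> rcases h1 with h1 | h1
  · exact absurd (h0.trans h1.symm) h01
  · rw [h0, h1]; linear_combination hz
  · rw [h0, h1]; linear_combination -hz
  · exact absurd (h0.trans h1.symm) h01

theorem MainStratum.plucker_ne_zero (L : MainStratum) (I : Pair) : plucker L.1.matrix I ≠ 0 :=
  (L.2 I).2 trivial

theorem chartMatrix_row (I : Pair) (L : MainStratum) :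
    (chartMatrix I L.1).submatrix I.row id = 1 := by
  have hu : IsUnit (L.1.matrix.submatrix I.row id).det := (L.plucker_ne_zero I).isUnit
  exact Matrix.mul_nonsing_inv _ hu

theorem chartMatrix_plucker_ne_zero (I : Pair) (L : MainStratum) (J : Pair) :
    plucker (chartMatrix I L.1) J ≠ 0 := by
  rw [chartMatrix, plucker_mul]
  refine mul_ne_zero (L.plucker_ne_zero J) ?_
  rw [Matrix.det_nonsing_inv, Ring.inverse_eq_inv']
  exact inv_ne_zero (L.plucker_ne_zero I)

/-- The coordinates `z₁, z₂, z₃` (`k = 0`) and `z₄, z₅, z₆` (`k = 1`) of `L` in the chart `M_I`. -/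
def chartCoord (I : Pair) (L : Gr) (m : Fin 3) (k : Fin 2) : ℂ := chartMatrix I L (I.co m) k

theorem chartMatrix_rows (I : Pair) (L : MainStratum) :
    chartMatrix I L.1 (I.row 0) 0 = 1 ∧ chartMatrix I L.1 (I.row 0) 1 = 0 ∧
    chartMatrix I L.1 (I.row 1) 0 = 0 ∧ chartMatrix I L.1 (I.row 1) 1 = 1 := by
  have h := chartMatrix_row I L
  have e : ∀ a b, chartMatrix I L.1 (I.row a) b = (1 : Matrix (Fin 2) (Fin 2) ℂ) a b :=
    fun a b => congrFun (congrFun h a) b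
  refine ⟨?_, ?_, ?_, ?_⟩ <;> rw [e] <;> simp

theorem chartCoord_ne_zero (I : Pair) (L : MainStratum) (m : Fin 3) (k : Fin 2) :
    chartCoord I L.1 m k ≠ 0 := by
  obtain ⟨h00, h01, h10, h11⟩ := chartMatrix_rows I L
  have h0 := minor_ne_zero (chartMatrix_plucker_ne_zero I L) (I.row_ne_co 0 m)
  have h1 := minor_ne_zero (chartMatrix_plucker_ne_zero I L) (I.row_ne_co 1 m)
  rw [h00, h01] at h0
  rw [h10, h11] at h1
  fin_cases k
  · intro h
    apply h1
    have h' : chartMatrix I L.1 (I.co m) 0 = 0 := h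
    rw [h']; ring
  · intro h
    apply h0
    have h' : chartMatrix I L.1 (I.co m) 1 = 0 := h
    rw [h']; ring

theorem chartCoord_minor_ne (I : Pair) (L : MainStratum) {m n : Fin 3} (h : m ≠ n) :
    chartCoord I L.1 m 0 * chartCoord I L.1 n 1 ≠ chartCoord I L.1 n 0 * chartCoord I L.1 m 1 := by
  have h0 := minor_ne_zero (chartMatrix_plucker_ne_zero I L)
    (fun e => h (I.co_inj.1 e) : I.co m ≠ I.co n)
  intro e
  apply h0
  simp only [chartCoord] at e
  linear_combination e

theorem pair_ne_zero {a b : ℂ} (h : a ≠ 0) : (![a, b] : Fin 2 → ℂ) ≠ 0 :=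
  fun e => h (congrFun e 0)

/-- The parameters `(c₁ : c₁')`, `(c₂ : c₂')`, `(c₃ : c₃')` of a point of the main stratum in the
chart `M_I`, determined by `c₁' z₁ z₅ = c₁ z₂ z₄`, `c₂' z₁ z₆ = c₂ z₃ z₄`,
`c₃' z₂ z₆ = c₃ z₃ z₅`. -/
def chartParam (I : Pair) (L : MainStratum) : Fin 3 → CP1 :=
  let z := chartCoord I L.1
  have hz := chartCoord_ne_zero I L
  ![CP1.pt (z 0 0 * z 1 1) (z 1 0 * z 0 1) (pair_ne_zero (mul_ne_zero (hz 0 0) (hz 1 1))),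
    CP1.pt (z 0 0 * z 2 1) (z 2 0 * z 0 1) (pair_ne_zero (mul_ne_zero (hz 0 0) (hz 2 1))),
    CP1.pt (z 1 0 * z 2 1) (z 2 0 * z 1 1) (pair_ne_zero (mul_ne_zero (hz 1 0) (hz 2 1)))]

theorem CP1.pt_rep (a b : ℂ) (h : (![a, b] : Fin 2 → ℂ) ≠ 0) :
    ∃ u : ℂ, u ≠ 0 ∧ (CP1.pt a b h).rep 0 = u * a ∧ (CP1.pt a b h).rep 1 = u * b := by
  obtain ⟨u, hu⟩ := Projectivization.exists_smul_eq_mk_rep ℂ ![a, b] h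
  refine ⟨u, u.ne_zero, ?_, ?_⟩
  · exact (congrFun hu 0).symm
  · exact (congrFun hu 1).symm

theorem CP1.pt_eq_iff {a b a' b' : ℂ} (h : (![a, b] : Fin 2 → ℂ) ≠ 0)
    (h' : (![a', b'] : Fin 2 → ℂ) ≠ 0) (hb : b ≠ 0) (hb' : b' ≠ 0) :
    CP1.pt a b h = CP1.pt a' b' h' ↔ a * b' = a' * b := by
  rw [CP1.pt, CP1.pt, Projectivization.mk_eq_mk_iff']
  constructor
  · rintro ⟨u, hu⟩
    have h0 : u * a' = a := congrFun hu 0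
    have h1 : u * b' = b := congrFun hu 1
    rw [← h0, ← h1]; ring
  · intro e
    refine ⟨b / b', ?_⟩
    funext k
    fin_cases k
    · change b / b' * a' = a
      field_simp
      linear_combination -e
    · change b / b' * b' = b
      field_simp

theorem chartParam_mem (I : Pair) (L : MainStratum) : chartParam I L ∈ openCubic := by
  have hz := chartCoord_ne_zero I L
  have hm := fun {m n : Fin 3} (h : m ≠ n) => chartCoord_minor_ne I L h
  obtain ⟨u, hu, hu0, hu1⟩ := CP1.pt_rep _ _
    (pair_ne_zero (b := chartCoord I L.1 1 0 * chartCoord I L.1 0 1)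
      (mul_ne_zero (hz 0 0) (hz 1 1)))
  obtain ⟨v, hv, hv0, hv1⟩ := CP1.pt_rep _ _
    (pair_ne_zero (b := chartCoord I L.1 2 0 * chartCoord I L.1 0 1)
      (mul_ne_zero (hz 0 0) (hz 2 1)))
  obtain ⟨w, hw, hw0, hw1⟩ := CP1.pt_rep _ _
    (pair_ne_zero (b := chartCoord I L.1 2 0 * chartCoord I L.1 1 1)
      (mul_ne_zero (hz 1 0) (hz 2 1)))
  refine ⟨?_, ?_⟩
  · simp only [cubicSurface, Set.mem_ofPred_eq, chartParam, Matrix.cons_val]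
    rw [hu0, hv1, hw0, hu1, hv0, hw1]
    ring
  · intro i
    fin_cases i
    · change (CP1.pt _ _ _).rep 0 ≠ 0 ∧ (CP1.pt _ _ _).rep 1 ≠ 0 ∧
        (CP1.pt _ _ _).rep 0 ≠ (CP1.pt _ _ _).rep 1
      rw [hu0, hu1]
      exact ⟨mul_ne_zero hu (mul_ne_zero (hz _ _) (hz _ _)),
        mul_ne_zero hu (mul_ne_zero (hz _ _) (hz _ _)),
        fun e => hm (by decide) (mul_left_cancel₀ hu e)⟩
    · change (CP1.pt _ _ _).rep 0 ≠ 0 ∧ (CP1.pt _ _ _).rep 1 ≠ 0 ∧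
        (CP1.pt _ _ _).rep 0 ≠ (CP1.pt _ _ _).rep 1
      rw [hv0, hv1]
      exact ⟨mul_ne_zero hv (mul_ne_zero (hz _ _) (hz _ _)),
        mul_ne_zero hv (mul_ne_zero (hz _ _) (hz _ _)),
        fun e => hm (by decide) (mul_left_cancel₀ hv e)⟩
    · change (CP1.pt _ _ _).rep 0 ≠ 0 ∧ (CP1.pt _ _ _).rep 1 ≠ 0 ∧
        (CP1.pt _ _ _).rep 0 ≠ (CP1.pt _ _ _).rep 1
      rw [hw0, hw1]
      exact ⟨mul_ne_zero hw (mul_ne_zero (hz _ _) (hz _ _)),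
        mul_ne_zero hw (mul_ne_zero (hz _ _) (hz _ _)),
        fun e => hm (by decide) (mul_left_cancel₀ hw e)⟩

theorem chartMatrix_span (I : Pair) (L : MainStratum) :
    LinearIndependent ℂ (chartMatrix I L.1).col ∧
      Submodule.span ℂ (Set.range (chartMatrix I L.1).col) = L.1.1 := by
  set B := L.1.matrix.submatrix I.row id with hB
  have hu : IsUnit B.det := (L.plucker_ne_zero I).isUnit
  have hmul : chartMatrix I L.1 * B = L.1.matrix := by
    rw [chartMatrix, Matrix.mul_assoc, Matrix.nonsing_inv_mul _ hu, Matrix.mul_one]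
  have hle : ∀ (A : Matrix (Fin 5) (Fin 2) ℂ) (g : Matrix (Fin 2) (Fin 2) ℂ),
      Submodule.span ℂ (Set.range (A * g).col) ≤ Submodule.span ℂ (Set.range A.col) := by
    intro A g
    rw [Submodule.span_le]
    rintro _ ⟨k, rfl⟩
    refine (Submodule.mem_span_range_iff_exists_fun ℂ).2 ⟨fun i => g i k, ?_⟩
    funext x
    have e : (A * g).col k x = ∑ i, A x i * g i k := rfl
    rw [e]
    simp [mul_comm]
  have hs : Submodule.span ℂ (Set.range (chartMatrix I L.1).col) = L.1.1 := by
    rw [← L.1.matrix_span]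
    apply le_antisymm
    · exact hle _ _
    · calc _ = Submodule.span ℂ (Set.range (chartMatrix I L.1 * B).col) := by rw [hmul]
        _ ≤ _ := hle _ _
  refine ⟨?_, hs⟩
  rw [linearIndependent_iff_card_eq_finrank_span, Set.finrank, hs, L.1.2]
  rfl

/-- The normalized matrix is determined by its column space. -/
theorem chartMatrix_unique (I : Pair) (L : MainStratum) {B : Matrix (Fin 5) (Fin 2) ℂ}
    (hB : LinearIndependent ℂ B.col) (hBL : Submodule.span ℂ (Set.range B.col) = L.1.1)
    (h1 : B.submatrix I.row id = 1) : chartMatrix I L.1 = B := by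
  obtain ⟨hc, hs⟩ := chartMatrix_span I L
  obtain ⟨g, -, hg⟩ := exists_change hB (hBL.trans hs.symm)
  have h2 : (chartMatrix I L.1).submatrix I.row id = B.submatrix I.row id * g := by
    rw [hg]; rfl
  rw [chartMatrix_row, h1, one_mul] at h2
  rw [hg, ← h2, Matrix.mul_one]

theorem chartCoord_smul (I : Pair) {L M : MainStratum} (t : AlgTorus) (h : t • L.1 = M.1)
    (x : Fin 5) (k : Fin 2) :
    chartMatrix I M.1 x k = t x * (t (I.row k) : ℂ)⁻¹ * chartMatrix I L.1 x k := by
  obtain ⟨hc, hs⟩ := chartMatrix_span I L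
  obtain ⟨h00, h01, h10, h11⟩ := chartMatrix_rows I L
  have hs' := (chartMatrix_span I M).2
  obtain ⟨g, -, hg⟩ := exists_change_smul t hc hs (hs'.trans (by rw [h]))
  obtain ⟨m00, m01, m10, m11⟩ := chartMatrix_rows I M
  have e : ∀ x k, chartMatrix I M.1 x k =
      t x * chartMatrix I L.1 x 0 * g 0 k + t x * chartMatrix I L.1 x 1 * g 1 k := by
    intro x k
    rw [hg, Matrix.mul_apply, Fin.sum_univ_two]
    rfl
  have n0 := (t (I.row 0)).ne_zero
  have n1 := (t (I.row 1)).ne_zero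
  rw [e, h00, h01] at m00 m01
  rw [e, h10, h11] at m10 m11
  have g00 : g 0 0 = (t (I.row 0) : ℂ)⁻¹ := by
    field_simp; linear_combination m00
  have g11 : g 1 1 = (t (I.row 1) : ℂ)⁻¹ := by
    field_simp; linear_combination m11
  have g01 : g 0 1 = 0 := by
    have : (t (I.row 0) : ℂ) * g 0 1 = 0 := by linear_combination m01
    exact (mul_eq_zero.1 this).resolve_left n0
  have g10 : g 1 0 = 0 := by
    have : (t (I.row 1) : ℂ) * g 1 0 = 0 := by linear_combination m10
    exact (mul_eq_zero.1 this).resolve_left n1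
  rw [e]
  fin_cases k
  · change _ * g 0 0 + _ * g 1 0 = _
    rw [g00, g10]; simp; ring
  · change _ * g 0 1 + _ * g 1 1 = _
    rw [g01, g11]; simp; ring

theorem chartParam_eq_iff (I : Pair) (L M : MainStratum) :
    chartParam I L = chartParam I M ↔ ∃ t : AlgTorus, t • L.1 = M.1 := by
  have hz := chartCoord_ne_zero I L
  have hw := chartCoord_ne_zero I M
  constructor
  · intro h
    have c0 := (CP1.pt_eq_iff _ _ (mul_ne_zero (hz _ _) (hz _ _))
      (mul_ne_zero (hw _ _) (hw _ _))).1 (congrFun h 0)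
    have c1 := (CP1.pt_eq_iff _ _ (mul_ne_zero (hz _ _) (hz _ _))
      (mul_ne_zero (hw _ _) (hw _ _))).1 (congrFun h 1)
    set z := chartCoord I L.1 with hzdef
    set w := chartCoord I M.1 with hwdef
    have hu : ∀ m k, w m k / z m k ≠ 0 := fun m k => div_ne_zero (hw m k) (hz m k)
    let u : Fin 3 → ℂˣ := fun m => Units.mk0 _ (hu m 0)
    let l : ℂˣ := u 0 * (Units.mk0 _ (hu 0 1))⁻¹
    let t : AlgTorus := fun x =>
      if x = I.row 0 then 1 else if x = I.row 1 then l else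
      if x = I.co 0 then u 0 else if x = I.co 1 then u 1 else u 2
    have t0 : t (I.row 0) = 1 := by simp [t]
    have t1 : t (I.row 1) = l := by
      have : I.row 1 ≠ I.row 0 := fun h => by simpa using I.row_inj.1 h
      simp [t, this]
    have tc : ∀ m, t (I.co m) = u m := by
      intro m
      have a0 := (I.row_ne_co 0 m).symm
      have a1 := (I.row_ne_co 1 m).symm
      simp only [t, if_neg a0, if_neg a1, I.co_inj]
      fin_cases m <;> simp
    refine ⟨t, ?_⟩
    obtain ⟨hc, hs⟩ := chartMatrix_span I L
    obtain ⟨hc', hs'⟩ := chartMatrix_span I M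
    obtain ⟨h00, h01, h10, h11⟩ := chartMatrix_rows I L
    obtain ⟨m00, m01, m10, m11⟩ := chartMatrix_rows I M
    let g : Matrix (Fin 2) (Fin 2) ℂ := Matrix.diagonal ![1, (l : ℂ)⁻¹]
    have hl : (l : ℂ) = w 0 0 / z 0 0 * (w 0 1 / z 0 1)⁻¹ := by
      simp [l, u]
    have key : ∀ x k, chartMatrix I M.1 x k =
        t x * chartMatrix I L.1 x k * (![1, (l : ℂ)⁻¹] : Fin 2 → ℂ) k := by
      have hco : ∀ m k, w m k = (u m : ℂ) * z m k * (![1, (l : ℂ)⁻¹] : Fin 2 → ℂ) k := by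
        intro m k
        have hz00 := hz 0 0
        have hz01 := hz 0 1
        have hw00 := hw 0 0
        have hw01 := hw 0 1
        fin_cases k
        · have := hz m 0
          simp [u]
          field_simp
        · have hzm := hz m 0
          have hwm := hw m 0
          have hzm1 := hz m 1
          change w m 1 = (w m 0 / z m 0) * z m 1 * (l : ℂ)⁻¹
          rw [hl]
          field_simp
          fin_cases m
          · simp
            ring
          · simp
            linear_combination -c0
          · simp
            linear_combination -c1
      intro x k
      rcases I.cases_row x with rfl | rfl | rfl | rfl | rfl
      · rw [t0]
        fin_cases k
        · simp [h00, m00]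
        · simp [h01, m01]
      · rw [t1]
        fin_cases k
        · simp [h10, m10]
        · simp [h11, m11]
      · rw [tc]; exact hco 0 k
      · rw [tc]; exact hco 1 k
      · rw [tc]; exact hco 2 k
    have hg : chartMatrix I M.1 = (Matrix.of fun x y => (t x : ℂ) * chartMatrix I L.1 x y) * g := by
      ext x k
      rw [Matrix.mul_diagonal, key]
      rfl
    apply Subtype.ext
    have hcol : (Matrix.of fun x y => (t x : ℂ) * chartMatrix I L.1 x y).col =
      (scaleEquiv t).toLinearMap ∘ (chartMatrix I L.1).col := rfl
    have hle : Submodule.span ℂ (Set.range (chartMatrix I M.1).col) ≤ (t • L.1).1 := by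
      rw [smul_val, ← hs, ← Submodule.span_image, ← Set.range_comp, ← hcol, Submodule.span_le]
      rintro _ ⟨k, rfl⟩
      have : (chartMatrix I M.1).col k = (![1, (l : ℂ)⁻¹] : Fin 2 → ℂ) k •
          (Matrix.of fun x y => (t x : ℂ) * chartMatrix I L.1 x y).col k := by
        funext x
        simp only [Matrix.col_apply, Pi.smul_apply, smul_eq_mul, Matrix.of_apply]
        rw [key]; ring
      rw [this]
      exact Submodule.smul_mem _ _ (Submodule.subset_span ⟨k, rfl⟩)
    rw [hs'] at hle
    exact (Submodule.eq_of_le_of_finrank_eq hle (by rw [M.1.2, (t • L.1).2])).symm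
  · rintro ⟨t, ht⟩
    have e := chartCoord_smul I t ht
    have e' : ∀ m k, chartCoord I M.1 m k =
        t (I.co m) * (t (I.row k) : ℂ)⁻¹ * chartCoord I L.1 m k := fun m k => e _ _
    funext i
    fin_cases i
    · refine (CP1.pt_eq_iff _ _ (mul_ne_zero (hz _ _) (hz _ _))
        (mul_ne_zero (hw _ _) (hw _ _))).2 ?_
      simp only [e']; ring
    · refine (CP1.pt_eq_iff _ _ (mul_ne_zero (hz _ _) (hz _ _))
        (mul_ne_zero (hw _ _) (hw _ _))).2 ?_
      simp only [e']; ring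
    · refine (CP1.pt_eq_iff _ _ (mul_ne_zero (hz _ _) (hz _ _))
        (mul_ne_zero (hw _ _) (hw _ _))).2 ?_
      simp only [e']; ring

/-- A matrix with prescribed chart parameters. -/
theorem exists_of_param (I : Pair) {c : Fin 3 → CP1} (hc : c ∈ openCubic) :
    ∃ L : MainStratum, chartParam I L = c := by
  obtain ⟨hcub, hne⟩ := hc
  have hcub' : (c 0).rep 0 * (c 1).rep 1 * (c 2).rep 0 = (c 0).rep 1 * (c 1).rep 0 * (c 2).rep 1 :=
    hcub
  obtain ⟨a0, a1, a01⟩ := hne 0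
  obtain ⟨b0, b1, b01⟩ := hne 1
  obtain ⟨d0, d1, d01⟩ := hne 2
  set p0 := (c 0).rep 0
  set p1 := (c 0).rep 1
  set q0 := (c 1).rep 0
  set q1 := (c 1).rep 1
  have hpq : p1 * q0 - p0 * q1 ≠ 0 := by
    intro h
    apply d01
    have h2 : p0 * q1 * ((c 2).rep 0 - (c 2).rep 1) = 0 := by
      linear_combination hcub' + (c 2).rep 1 * h
    rcases mul_eq_zero.1 h2 with h3 | h3
    · exact absurd h3 (mul_ne_zero a0 b1)
    · exact sub_eq_zero.1 h3
  let B : Matrix (Fin 5) (Fin 2) ℂ := Matrix.of fun x =>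
    if x = I.row 0 then ![1, 0] else if x = I.row 1 then ![0, 1] else
    if x = I.co 0 then ![1, 1] else if x = I.co 1 then ![p1, p0] else ![q1, q0]
  have r10 : I.row 1 ≠ I.row 0 := fun h => by simpa using I.row_inj.1 h
  have hBx : ∀ x, B x =
    if x = I.row 0 then ![1, 0] else if x = I.row 1 then ![0, 1] else
    if x = I.co 0 then ![1, 1] else if x = I.co 1 then ![p1, p0] else ![q1, q0] := fun _ => rfl
  have br0 : B (I.row 0) = ![1, 0] := by rw [hBx]; simp []
  have br1 : B (I.row 1) = ![0, 1] := by rw [hBx]; simp [r10]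
  have n0 := fun m => (I.row_ne_co 0 m).symm
  have n1 := fun m => (I.row_ne_co 1 m).symm
  have bc0 : B (I.co 0) = ![1, 1] := by rw [hBx]; simp [n0, n1]
  have bc1 : B (I.co 1) = ![p1, p0] := by rw [hBx]; simp [n0, n1, I.co_inj]
  have bc2 : B (I.co 2) = ![q1, q0] := by rw [hBx]; simp [n0, n1, I.co_inj]
  have hB1 : B.submatrix I.row id = 1 := by
    ext i j
    rw [Matrix.submatrix_apply]
    fin_cases i
    · change B (I.row 0) j = _
      rw [br0]; fin_cases j <;> simp
    · change B (I.row 1) j = _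
      rw [br1]; fin_cases j <;> simp
  have hBlin : LinearIndependent ℂ B.col := by
    rw [← Matrix.mulVec_injective_iff]
    intro v w h
    have h' : ∀ i, B.mulVec v (I.row i) = B.mulVec w (I.row i) := fun i => congrFun h _
    have e : ∀ u : Fin 2 → ℂ, ∀ i, B.mulVec u (I.row i) = u i := by
      intro u i
      have : B.mulVec u (I.row i) = (B.submatrix I.row id).mulVec u i := rfl
      rw [this, hB1, Matrix.one_mulVec]
    funext i
    rw [← e v, ← e w]; exact h' i
  have hBp : ∀ J, plucker B J ≠ 0 := by
    intro J
    have hJ : J.row 0 ≠ J.row 1 := fun h => by simpa using J.row_inj.1 h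
    have s1 : p0 - p1 ≠ 0 := sub_ne_zero.2 a01
    have s2 : p1 - p0 ≠ 0 := sub_ne_zero.2 a01.symm
    have s3 : q0 - q1 ≠ 0 := sub_ne_zero.2 b01
    have s4 : q1 - q0 ≠ 0 := sub_ne_zero.2 b01.symm
    have s5 : q1 * p0 - q0 * p1 ≠ 0 := by
      intro h; apply hpq; linear_combination -h
    have s6 : p1 * q0 - p0 * q1 ≠ 0 := hpq
    rw [plucker, Matrix.det_fin_two]
    simp only [Matrix.submatrix_apply, id]
    rcases J.cases_of I 0 with h | h | h | h | h <;> rcases J.cases_of I 1 with h' | h' | h' | h' | h'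
    all_goals first
      | exact absurd (h.trans h'.symm) hJ
      | (rw [h, h']
         simp only [br0, br1, bc0, bc1, bc2, Matrix.cons_val_zero, Matrix.cons_val_one, one_mul,
           zero_mul, mul_one, mul_zero, sub_zero, zero_sub]
         first
           | assumption
           | exact one_ne_zero
           | exact neg_ne_zero.2 one_ne_zero
           | (apply neg_ne_zero.2; assumption))
  let L : Gr := Frame.span ⟨B, hBlin⟩
  have hLs : Submodule.span ℂ (Set.range B.col) = L.1 := rfl
  obtain ⟨g, hg, hLg⟩ := exists_change hBlin
    (hLs.trans L.matrix_span.symm)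
  have hL : L ∈ stratum Set.univ := by
    intro J
    refine ⟨fun _ => trivial, fun _ => ?_⟩
    rw [hLg, plucker_mul]
    exact mul_ne_zero (hBp J) hg
  refine ⟨⟨L, hL⟩, ?_⟩
  have hM : chartMatrix I L = B := chartMatrix_unique I ⟨L, hL⟩ hBlin hLs hB1
  have hz : ∀ m k, chartCoord I L m k = B (I.co m) k := fun m k => by rw [chartCoord, hM]
  have eqc : ∀ (x : CP1) (a b : ℂ) (h : (![a, b] : Fin 2 → ℂ) ≠ 0), x.rep 1 ≠ 0 → b ≠ 0 →
      a * x.rep 1 = x.rep 0 * b → CP1.pt a b h = x := by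
    intro x a b h hx hb e
    have hx' : (![x.rep 0, x.rep 1] : Fin 2 → ℂ) ≠ 0 := fun e => hx (congrFun e 1)
    have : CP1.pt (x.rep 0) (x.rep 1) hx' = x := by
      conv_rhs => rw [← x.mk_rep]
      rw [CP1.pt]
      congr 1
      funext k
      fin_cases k <;> rfl
    rw [← this, CP1.pt_eq_iff _ _ hb hx]
    exact e
  funext i
  fin_cases i
  · refine eqc (c 0) _ _ _ a1 ?_ ?_
    · simp only [hz, bc0, bc1]; simpa using a1
    · simp only [hz, bc0, bc1]; simp; ring
  · refine eqc (c 1) _ _ _ b1 ?_ ?_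
    · simp only [hz, bc0, bc2]; simpa using b1
    · simp only [hz, bc0, bc2]; simp; ring
  · refine eqc (c 2) _ _ _ d1 ?_ ?_
    · simp only [hz, bc1, bc2]; simpa using ⟨b1, a0⟩
    · simp only [hz, bc1, bc2]; simp; linear_combination -hcub'

/-- The map `F → F_I` reading off the parameters in the chart `M_I`. -/
def paramToChart (I : Pair) : MainParam → openCubic :=
  Quotient.lift (fun L => ⟨chartParam I L, chartParam_mem I L⟩) (by
    rintro a b ⟨t, ht⟩
    exact Subtype.ext ((chartParam_eq_iff I b a).2 ⟨t, ht⟩).symm)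

theorem paramToChart_bijective (I : Pair) : Function.Bijective (paramToChart I) := by
  constructor
  · intro a b
    induction a using Quotient.ind with | _ a => ?_
    induction b using Quotient.ind with | _ b => ?_
    intro h
    have h' : chartParam I b = chartParam I a := (congrArg Subtype.val h).symm
    obtain ⟨t, ht⟩ := (chartParam_eq_iff I b a).1 h'
    exact Quotient.sound ⟨t, ht⟩
  · rintro ⟨c, hc⟩
    obtain ⟨L, hL⟩ := exists_of_param I hc
    exact ⟨Quotient.mk _ L, Subtype.ext hL⟩

/-- The canonical bijection `f_I : F_I → F`. -/
def chartEquiv (I : Pair) : openCubic ≃ MainParam :=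
  (Equiv.ofBijective _ (paramToChart_bijective I)).symm

/-- The transition map `f_{I,J} : F_I → F_J` between the spaces of parameters of the main stratum in
the charts `M_I` and `M_J`. -/
def transition (I J : Pair) : openCubic ≃ openCubic := (chartEquiv I).trans (chartEquiv J).symm

/-! ## Virtual spaces of parameters and universal spaces of parameters -/

/-- Let `F_I` be mapped to a space `X` by `inc`. The virtual space of parameters of the stratum
`W_σ` in the chart `M_I` consists of the limits `c` in `X` of sequences `cₙ` in `F_I` such that, for
some `xₙ` in `Δ°`, the points `yₙ = h⁻¹(xₙ, f_I(cₙ))` of `W / T⁵` converge in `G_{5,2} / T⁵` to a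
point of `W_σ / T⁵`. -/
def virtualSpace {X : Type} [TopologicalSpace X] (inc : openCubic → X) (I : Pair) (σ : Set Pair) :
    Set X :=
  {c | ∃ (x : ℕ → Fin 5 → ℝ) (cn : ℕ → openCubic) (y : ℕ → MainOrbitSpace),
    (∀ n, x n ∈ openHypersimplex) ∧
    (∀ n, trivialization (y n) = (x n, chartEquiv I (cn n))) ∧
    Tendsto (fun n => inc (cn n)) atTop (𝓝 c) ∧
    ∃ w ∈ orbitStratum σ, Tendsto (fun n => (y n).incl) atTop (𝓝 w)}

/-- A universal space of parameters for the `T⁵`-action on `G_{5,2}`: a compactification of the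
spaces of parameters `F_I` of the main stratum such that for each stratum the virtual spaces of
parameters in any two charts are homeomorphic. -/
structure IsUniversalSpace (X : Type) [TopologicalSpace X] (inc : openCubic → X) : Prop where
  compact : CompactSpace X
  hausdorff : T2Space X
  isEmbedding : IsEmbedding inc
  denseRange : DenseRange inc
  virtual_homeomorph : ∀ σ, Admissible σ → ∀ I J,
    Nonempty (virtualSpace inc I σ ≃ₜ virtualSpace inc J σ)

/-! ## The blowups -/

/-- The point `(1 : 1)`. -/
def CP1.one : CP1 := CP1.pt 1 1 (pair_ne_zero one_ne_zero)

/-- The point `(1 : 0)`. -/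
def CP1.inf : CP1 := CP1.pt 1 0 (pair_ne_zero one_ne_zero)

/-- The point `(0 : 1)`. -/
def CP1.zero : CP1 := CP1.pt 0 1 fun e => one_ne_zero (congrFun e 1)

theorem one_mem_cubicSurface : (fun _ => CP1.one) ∈ cubicSurface := by
  obtain ⟨u, hu, h0, h1⟩ := CP1.pt_rep 1 1 (pair_ne_zero one_ne_zero)
  change CP1.one.rep 0 * CP1.one.rep 1 * CP1.one.rep 0 =
    CP1.one.rep 1 * CP1.one.rep 0 * CP1.one.rep 1
  rw [CP1.one, h0, h1]

/-- The point `((1:1),(1:1),(1:1))` of the cubic surface. -/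
def cubicCenter : cubicSurface := ⟨fun _ => CP1.one, one_mem_cubicSurface⟩

/-- The projective embedding of the cubic surface. -/
def cubicEmb : cubicSurface → CProj (Fin 3 → Fin 2) := fun c => segre c.1

/-- The blowup of the cubic surface at the point `((1:1),(1:1),(1:1))`. -/
abbrev FTilde : Type := Blowup cubicEmb ![cubicCenter]

theorem openCubic_ne_center (c : openCubic) (a : Fin 1) :
    cubicEmb ⟨c.1, c.2.1⟩ ≠ cubicEmb (![cubicCenter] a) := by
  have ha : (![cubicCenter] : Fin 1 → cubicSurface) a = cubicCenter := by fin_cases a; rfl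
  rw [ha]
  intro h
  have h1 : c.1 0 = CP1.one := congrFun (segre_injective h) 0
  obtain ⟨u, hu, h0, h1'⟩ := CP1.pt_rep 1 1 (pair_ne_zero one_ne_zero)
  apply (c.2.2 0).2.2
  rw [h1, CP1.one, h0, h1']

/-- The inclusion of `F_I` into the blowup of the cubic surface. -/
def FTilde.incl (c : openCubic) : FTilde :=
  Blowup.lift cubicEmb ![cubicCenter] ⟨c.1, c.2.1⟩ (openCubic_ne_center c)

/-- The blowup of `CP¹ × CP¹` at `((1:0),(1:0))`, `((0:1),(0:1))`, `((1:1),(1:1))`. -/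
abbrev BlowupP1P1 : Type :=
  Blowup (segre : (Fin 2 → CP1) → CProj (Fin 2 → Fin 2))
    ![fun _ => CP1.inf, fun _ => CP1.zero, fun _ => CP1.one]

/-- The blowup of `CP²` at `(1:0:0)`, `(0:1:0)`, `(0:0:1)`, `(1:1:1)`. -/
abbrev BlowupP2 : Type :=
  Blowup (id : CProj (Fin 3) → CProj (Fin 3))
    ![Projectivization.mk ℂ ![1, 0, 0] fun e => one_ne_zero (congrFun e 0),
      Projectivization.mk ℂ ![0, 1, 0] fun e => one_ne_zero (congrFun e 1),
      Projectivization.mk ℂ ![0, 0, 1] fun e => one_ne_zero (congrFun e 2),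
      Projectivization.mk ℂ ![1, 1, 1] fun e => one_ne_zero (congrFun e 0)]

end

noncomputable section

/-! ## Topology of complex projective spaces -/

/-! The rows of a matrix in the main stratum are five distinct points of CP¹, so F is the space of
such configurations up to projective equivalence. All the compactifications in the theorem are one
surface in disguise: the closure `FiveClosure` of F in (CP¹)⁵ under five cross-ratios, one for each
choice of four of the five points. Three of these are c₁, c₂, c₃; the others are `paramD` and
`paramE`.

In the plane with coordinates x₀ = c₁c₂, x₁ = c₁'c₂, x₂ = c₁c₂', the first four parameters are (x₀ :
x₁), (x₀ : x₂), (x₁ : x₂) and (x₁ - x₀ : x₂ - x₀), the linear projections from (0:0:1), (0:1:0),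
(1:0:0) and (1:1:1). The fifth is ((x₀ - x₁)x₂ : (x₀ - x₂)x₁), the pencil of conics through these
four points; by `FiveClosure.ext_of_four` it is determined by the others. So recording the
cross-ratios amounts to recording the blowup data. In the same way c₃ is a coordinate on the
exceptional curves over ((1:0),(1:0)) and ((0:1),(0:1)) in CP¹ × CP¹, and `paramD` is one on the
curves over the centres with all entries (1:1), both there and in the cubic surface.

The comparison is topological. By `exists_homeomorph_of_denseRange`, two compact Hausdorff spaces in
which F has dense image are homeomorphic compatibly with these images as soon as limits in one
determine limits in the other. Limits are controlled by multihomogeneous relations: each holds on F,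
and survives in the limit once representatives are rescaled to converge. A point of CP¹ is then
pinned down by any surviving relation with a non-zero coefficient (`CP1.eq_of_linear`).

The transition maps extend because the parameters in every chart are cross-ratios of the same five
rows. Changing the chart relabels the quadruples and reorders each of them, which acts on a single
cross-ratio by a projective transformation of CP¹ (`crossRatio_perm`). Hence f_{I,J} extends to a
homeomorphism of `FiveClosure`, and so of `FTilde`. Such an extension carries virtual spaces to
virtual spaces, since f_I(cₙ) = f_J(f_{I,J}(cₙ)): the same sequence in W/T⁵ serves both charts. -/

theorem isOpenQuotientMap_mk' {ι : Type} :
    IsOpenQuotientMap (Projectivization.mk' ℂ : {v : ι → ℂ // v ≠ 0} → CProj ι) := by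
  refine ⟨Quotient.mk''_surjective, continuous_coinduced_rng, fun O hO => ?_⟩
  rw [isOpen_coinduced]
  -- The saturation of an open set is the union of its translates under scalars, hence open.
  have : Projectivization.mk' ℂ ⁻¹' (Projectivization.mk' ℂ '' O) =
      ⋃ a : ℂˣ, (fun v : {v : ι → ℂ // v ≠ 0} =>
        (⟨a • v.1, (smul_ne_zero_iff_ne a).2 v.2⟩ : {v : ι → ℂ // v ≠ 0})) ⁻¹' O := by
    ext v
    simp only [Set.mem_preimage, Set.mem_image, Set.mem_iUnion]
    constructor
    · rintro ⟨w, hw, h⟩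
      obtain ⟨a, ha⟩ := (Projectivization.mk_eq_mk_iff ℂ _ _ w.2 v.2).1 h
      exact ⟨a, by convert hw⟩
    · rintro ⟨a, ha⟩
      exact ⟨_, ha, (Projectivization.mk_eq_mk_iff ℂ _ _ _ _).2 ⟨a, rfl⟩⟩
  rw [this]
  refine isOpen_iUnion fun a => hO.preimage (Continuous.subtype_mk ?_ _)
  exact continuous_subtype_val.const_smul a

/-- Proportionality of non-zero vectors is the vanishing of all 2 × 2 minors, a closed condition;
for an open quotient map this gives the Hausdorff property. -/
instance {ι : Type} [Finite ι] : T2Space (CProj ι) := by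
  rw [t2Space_iff_of_isOpenQuotientMap isOpenQuotientMap_mk']
  have : {q : {v : ι → ℂ // v ≠ 0} × {v : ι → ℂ // v ≠ 0} |
      Projectivization.mk' ℂ q.1 = Projectivization.mk' ℂ q.2} =
      {q | ∀ i j, q.1.1 i * q.2.1 j = q.1.1 j * q.2.1 i} := by
    ext ⟨v, w⟩
    simp only [Set.mem_ofPred_eq, Projectivization.mk'_eq_mk, Projectivization.mk_eq_mk_iff']
    constructor
    · rintro ⟨a, ha⟩ i j
      rw [← ha]
      simp only [Pi.smul_apply, smul_eq_mul]
      ring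
    · intro h
      obtain ⟨j, hj⟩ := Function.ne_iff.1 w.2
      have hj' : w.1 j ≠ 0 := hj
      refine ⟨v.1 j / w.1 j, ?_⟩
      funext i
      have := h i j
      simp only [Pi.smul_apply, smul_eq_mul]
      field_simp
      linear_combination -this
  rw [this]
  simp only [Set.ofPred_forall]
  refine isClosed_iInter fun i => isClosed_iInter fun j => isClosed_eq ?_ ?_
  · exact ((continuous_apply i).comp (continuous_subtype_val.comp continuous_fst)).mul
      ((continuous_apply j).comp (continuous_subtype_val.comp continuous_snd))
  · exact ((continuous_apply j).comp (continuous_subtype_val.comp continuous_fst)).mul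
      ((continuous_apply i).comp (continuous_subtype_val.comp continuous_snd))

instance {ι : Type} [Finite ι] : CompactSpace (CProj ι) := by
  have := Fintype.ofFinite ι
  have hf : ∀ v : Metric.sphere (0 : ι → ℂ) 1, v.1 ≠ 0 := fun v h => by
    have := v.2
    rw [mem_sphere_zero_iff_norm, h, norm_zero] at this
    exact zero_ne_one this
  have hc : Continuous fun v : Metric.sphere (0 : ι → ℂ) 1 =>
      (Projectivization.mk' ℂ ⟨v.1, hf v⟩ : CProj ι) :=
    isOpenQuotientMap_mk'.continuous.comp (continuous_subtype_val.subtype_mk _)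
  -- The unit sphere is compact and meets every line.
  refine Function.Surjective.compactSpace hc fun x => ?_
  induction x using Projectivization.ind with | _ v hv
  have hn : ‖v‖ ≠ 0 := norm_ne_zero_iff.2 hv
  refine ⟨⟨((‖v‖ : ℂ)⁻¹) • v, ?_⟩, ?_⟩
  · rw [mem_sphere_zero_iff_norm, norm_smul, norm_inv, Complex.norm_real, norm_norm,
      inv_mul_cancel₀ hn]
  · exact (Projectivization.mk_eq_mk_iff' ℂ _ _ _ _).2 ⟨_, rfl⟩

theorem tendsto_mk {U ι : Type} {l : Filter U} {α : U → ι → ℂ} {a : ι → ℂ}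
    (h : Tendsto α l (𝓝 a)) (hα : ∀ u, α u ≠ 0) (ha : a ≠ 0) :
    Tendsto (fun u => Projectivization.mk ℂ (α u) (hα u)) l (𝓝 (Projectivization.mk ℂ a ha)) := by
  have h1 : Tendsto (fun u => (⟨α u, hα u⟩ : {v : ι → ℂ // v ≠ 0})) l (𝓝 ⟨a, ha⟩) :=
    tendsto_subtype_rng.2 h
  exact (isOpenQuotientMap_mk'.continuous.tendsto _).comp h1

/-- Representatives of a convergent family in projective space may be scaled to converge. -/
theorem exists_tendsto_smul {U ι : Type} {l : Filter U} {g : U → CProj ι} {x : CProj ι}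
    (hg : Tendsto g l (𝓝 x)) (n : U → ι → ℂ)
    (hn : ∀ u, ∃ h, g u = Projectivization.mk ℂ (n u) h) :
    ∃ s : U → ℂ, (∀ u, s u ≠ 0) ∧ Tendsto (fun u => s u • n u) l (𝓝 x.rep) := by
  obtain ⟨k, hk⟩ := Function.ne_iff.1 x.rep_nonzero
  have hk : x.rep k ≠ 0 := hk
  -- A local section near `x`: the representative whose `k`-th coordinate is that of `x.rep`. It
  -- takes the junk value 0 where the `k`-th coordinate vanishes, which does not happen near `x`.
  let σ : CProj ι → ι → ℂ := fun y => (x.rep k / y.rep k) • y.rep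
  have hσ : ∀ v hv, σ (Projectivization.mk ℂ v hv) = (x.rep k / v k) • v := by
    intro v hv
    obtain ⟨a, ha⟩ := Projectivization.exists_smul_eq_mk_rep ℂ v hv
    have ha0 : (a : ℂ) ≠ 0 := a.ne_zero
    change (x.rep k / (Projectivization.mk ℂ v hv).rep k) • (Projectivization.mk ℂ v hv).rep = _
    rw [← ha]
    funext i
    simp only [Pi.smul_apply, Units.smul_def, smul_eq_mul]
    by_cases h0 : v k = 0
    · simp [h0]
    · field_simp
  have hσx : σ x = x.rep := by
    change (x.rep k / x.rep k) • x.rep = _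
    rw [div_self hk, one_smul]
  have hcont : ContinuousAt σ x := by
    have h1 : ContinuousAt (σ ∘ Projectivization.mk' ℂ)
        (⟨x.rep, x.rep_nonzero⟩ : {v : ι → ℂ // v ≠ 0}) := by
      have : σ ∘ Projectivization.mk' ℂ = fun v => (x.rep k / v.1 k) • v.1 := by
        funext v; exact hσ v.1 v.2
      rw [this]
      have : Continuous fun v : {v : ι → ℂ // v ≠ 0} => v.1 k :=
        (continuous_apply k).comp continuous_subtype_val
      exact ContinuousAt.smul (f := fun v : {v : ι → ℂ // v ≠ 0} => x.rep k / v.1 k)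
        (ContinuousAt.div continuousAt_const this.continuousAt hk)
        continuous_subtype_val.continuousAt
    have h2 := isOpenQuotientMap_mk'.continuousAt_comp_iff.1 h1
    rwa [Projectivization.mk'_eq_mk, x.mk_rep] at h2
  have ht : Tendsto (fun u => σ (g u)) l (𝓝 x.rep) := by
    have := hcont.tendsto.comp hg
    rwa [hσx] at this
  classical
  -- The value 1 only keeps the scalar non-zero; eventually the other branch applies.
  refine ⟨fun u => if n u k = 0 then 1 else x.rep k / n u k, fun u => ?_, ht.congr' ?_⟩
  · by_cases h : n u k = 0
    · simp [h]
    · simp [h, hk]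
  · have h0 : ∀ᶠ u in l, σ (g u) k ≠ 0 :=
      ((continuous_apply k).continuousAt.tendsto.comp ht).eventually_ne hk
    filter_upwards [h0] with u hu
    obtain ⟨h, e⟩ := hn u
    rw [e, hσ] at hu ⊢
    have : n u k ≠ 0 := fun h => hu (by simp [h])
    rw [if_neg this]

theorem exists_tendsto_smul_rep {U ι : Type} {l : Filter U} {g : U → CProj ι} {x : CProj ι}
    (hg : Tendsto g l (𝓝 x)) :
    ∃ s : U → ℂ, (∀ u, s u ≠ 0) ∧ Tendsto (fun u => s u • (g u).rep) l (𝓝 x.rep) :=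
  exists_tendsto_smul hg _ fun u => ⟨(g u).rep_nonzero, (g u).mk_rep.symm⟩

/-! ## Equality of points of projective spaces -/

theorem CProj.eq_of_cross {ι : Type} {p q : CProj ι}
    (h : ∀ i j, p.rep i * q.rep j = p.rep j * q.rep i) : p = q := by
  obtain ⟨j, hj⟩ := Function.ne_iff.1 q.rep_nonzero
  have hj : q.rep j ≠ 0 := hj
  rw [← p.mk_rep, ← q.mk_rep, Projectivization.mk_eq_mk_iff']
  refine ⟨p.rep j / q.rep j, ?_⟩
  funext i
  simp only [Pi.smul_apply, smul_eq_mul]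
  field_simp
  linear_combination -(h i j)

/-- Two points proportional to the same non-zero vector are equal. -/
theorem CProj.eq_of_parallel {ι : Type} {p q : CProj ι} {n : ι → ℂ} {k : ι} (hn : n k ≠ 0)
    (hp : ∀ i j, p.rep i * n j = p.rep j * n i) (hq : ∀ i j, q.rep i * n j = q.rep j * n i) :
    p = q := by
  refine CProj.eq_of_cross fun i j => ?_
  apply mul_left_cancel₀ (mul_ne_zero hn hn)
  have e1 := hp i k
  have e2 := hp j k
  have e3 := hq i k
  have e4 := hq j k
  linear_combination q.rep j * n k * e1 + p.rep k * n i * e4 - q.rep i * n k * e2 -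
    p.rep k * n j * e3

/-- Two points of the same line satisfying the same linear equation are equal. -/
theorem CProj.eq_of_pencil {ι : Type} {p q : CProj ι} (M N : ι → ℂ) {δ ε δ' ε' α β : ℂ}
    (hp : ∀ k, p.rep k = M k * δ + N k * ε) (hq : ∀ k, q.rep k = M k * δ' + N k * ε')
    (h0 : α ≠ 0 ∨ β ≠ 0) (h1 : α * δ = β * ε) (h2 : α * δ' = β * ε') : p = q := by
  have h : δ * ε' = δ' * ε := by
    rcases h0 with h | h
    · apply mul_left_cancel₀ h
      linear_combination ε' * h1 - ε * h2
    · apply mul_left_cancel₀ h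
      linear_combination δ' * h1 - δ * h2
  refine CProj.eq_of_cross fun i j => ?_
  rw [hp, hp, hq, hq]
  linear_combination (M i * N j - M j * N i) * h

/-- A non-zero linear form in two variables has a single projective zero. This is how every relation
below is used: it determines a parameter wherever its two coefficients do not vanish together. -/
theorem CP1.eq_of_linear {p q : CP1} {α β : ℂ} (h0 : α ≠ 0 ∨ β ≠ 0)
    (h1 : α * p.rep 0 = β * p.rep 1) (h2 : α * q.rep 0 = β * q.rep 1) : p = q := by
  refine CProj.eq_of_pencil ![1, 0] ![0, 1] ?_ ?_ h0 h1 h2 <;> simp [Fin.forall_fin_two]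

theorem CP1.rep_ne (p : CP1) : p.rep 0 ≠ 0 ∨ p.rep 1 ≠ 0 := by
  by_contra! h
  refine p.rep_nonzero ?_
  funext i
  fin_cases i
  · exact h.1
  · exact h.2

theorem CProj.rep_mk {ι : Type} (v : ι → ℂ) (hv : v ≠ 0) :
    ∃ s : ℂ, s ≠ 0 ∧ (Projectivization.mk ℂ v hv).rep = s • v := by
  obtain ⟨a, ha⟩ := Projectivization.exists_smul_eq_mk_rep ℂ v hv
  exact ⟨a, a.ne_zero, ha.symm⟩

/-! ## Segre embeddings and blowups -/

theorem continuous_segre {m : ℕ} : Continuous (segre : (Fin m → CP1) → CProj (Fin m → Fin 2)) := by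
  rw [continuous_iff_continuousAt]
  intro c
  have h : ∀ i, Tendsto (fun d : Fin m → CP1 => d i) (𝓝 c) (𝓝 (c i)) :=
    fun i => (continuous_apply i).continuousAt
  choose s hs0 hs using fun i => exists_tendsto_smul_rep (h i)
  -- Rescaling the factors rescales the tensor by the product of the scalars, so the Segre point can
  -- be computed on convergent representatives.
  have key : ∀ d : Fin m → CP1, tensorVec (fun i => s i d • (d i).rep) =
      (∏ i, s i d) • tensorVec fun i => (d i).rep := by
    intro d
    funext e
    simp only [tensorVec, Pi.smul_apply, smul_eq_mul, Finset.prod_mul_distrib]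
  have hne : ∀ d : Fin m → CP1, tensorVec (fun i => s i d • (d i).rep) ≠ 0 :=
    fun d => tensorVec_ne_zero _ fun i => smul_ne_zero (hs0 i d) (d i).rep_nonzero
  have ht : Tendsto (fun d : Fin m → CP1 => tensorVec (fun i => s i d • (d i).rep)) (𝓝 c)
      (𝓝 (tensorVec fun i => (c i).rep)) := by
    rw [tendsto_pi_nhds]
    intro e
    refine tendsto_finsetProd _ fun i _ => ?_
    exact ((continuous_apply (e i)).tendsto _).comp (hs i)
  refine (tendsto_mk ht hne (tensorVec_ne_zero _ fun i => (c i).rep_nonzero)).congr fun d => ?_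
  rw [segre, Projectivization.mk_eq_mk_iff']
  exact ⟨_, (key d).symm⟩

theorem wedgeVec_smul_smul {ι : Type} (p v : ι → ℂ) (s r : ℂ) :
    wedgeVec (s • p) (r • v) = (s * r) • wedgeVec p v := by
  funext ij
  simp only [wedgeVec, Pi.smul_apply, smul_eq_mul]
  ring

/-- Allows the projection from a point to be computed with explicit vectors instead of the
arbitrarily chosen `rep`. -/
theorem mk_wedgeVec_rep {ι : Type} {p v : CProj ι} (h : v ≠ p) {p₀ v₀ : ι → ℂ} {hp : p₀ ≠ 0}
    {hv : v₀ ≠ 0} (ep : p = Projectivization.mk ℂ p₀ hp) (ev : v = Projectivization.mk ℂ v₀ hv) :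
    ∃ h', Projectivization.mk ℂ (wedgeVec p.rep v.rep) (wedgeVec_ne_zero h) =
      Projectivization.mk ℂ (wedgeVec p₀ v₀) h' := by
  obtain ⟨s, hs, es⟩ := CProj.rep_mk p₀ hp
  obtain ⟨r, hr, er⟩ := CProj.rep_mk v₀ hv
  rw [← ep] at es
  rw [← ev] at er
  have e : wedgeVec p.rep v.rep = (s * r) • wedgeVec p₀ v₀ := by
    rw [es, er, wedgeVec_smul_smul]
  have h' : wedgeVec p₀ v₀ ≠ 0 := by
    intro h0
    apply wedgeVec_ne_zero h
    rw [e, h0, smul_zero]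
  exact ⟨h', (Projectivization.mk_eq_mk_iff' ℂ _ _ _ _).2 ⟨s * r, e.symm⟩⟩

theorem continuous_wedgeVec {ι : Type} (p : ι → ℂ) : Continuous (wedgeVec p) := by
  unfold wedgeVec
  fun_prop

theorem Blowup.tendsto_lift {U X ι : Type} [TopologicalSpace X] {j : X → CProj ι}
    (hj : Continuous j) {k : ℕ} {s : Fin k → X} {l : Filter U} {f : U → X} {x : X}
    (hf : Tendsto f l (𝓝 x)) (hfs : ∀ u a, j (f u) ≠ j (s a)) (hx : ∀ a, j x ≠ j (s a)) :
    Tendsto (fun u => Blowup.lift j s (f u) (hfs u)) l (𝓝 (Blowup.lift j s x hx)) := by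
  refine tendsto_subtype_rng.2 (hf.prodMk_nhds (tendsto_pi_nhds.2 fun a => ?_))
  obtain ⟨r, hr0, hr⟩ := exists_tendsto_smul_rep ((hj.tendsto x).comp hf)
  have e : ∀ u, wedgeVec (j (s a)).rep (r u • (j (f u)).rep) =
      r u • wedgeVec (j (s a)).rep (j (f u)).rep := fun u => by
    have := wedgeVec_smul_smul (j (s a)).rep (j (f u)).rep 1 (r u)
    rwa [one_smul, one_mul] at this
  have hne : ∀ u, wedgeVec (j (s a)).rep (r u • (j (f u)).rep) ≠ 0 := fun u => by
    rw [e]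
    exact smul_ne_zero (hr0 u) (wedgeVec_ne_zero (hfs u a))
  refine (tendsto_mk (((continuous_wedgeVec _).tendsto _).comp hr) hne
    (wedgeVec_ne_zero (hx a))).congr fun u => ?_
  rw [Projectivization.mk_eq_mk_iff']
  exact ⟨r u, (e u).symm⟩

/-- The blowup is by definition the closure of the lifts of points outside the centres, and there
lifting is continuous. So density in the base suffices. -/
theorem Blowup.denseRange_lift {U X ι : Type} [TopologicalSpace X] {j : X → CProj ι}
    (hj : Continuous j) {k : ℕ} {s : Fin k → X} {f : U → X} (hf : DenseRange f)
    (hfs : ∀ u a, j (f u) ≠ j (s a)) :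
    DenseRange fun u => Blowup.lift j s (f u) (hfs u) := by
  have key : ∀ x hx, Blowup.lift j s x hx ∈
      closure (Set.range fun u => Blowup.lift j s (f u) (hfs u)) := by
    intro x hx
    have hb : (comap f (𝓝 x)).NeBot := comap_neBot_iff.2 fun t ht => by
      obtain ⟨u, hu⟩ := hf.exists_mem_open isOpen_interior ⟨x, mem_interior_iff_mem_nhds.2 ht⟩
      exact ⟨u, interior_subset hu⟩
    exact mem_closure_of_tendsto (Blowup.tendsto_lift hj tendsto_comap hfs hx)
      (Eventually.of_forall fun u => Set.mem_range_self u)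
  intro z
  rw [closure_subtype]
  refine closure_minimal ?_ isClosed_closure z.2
  intro y hy
  choose h1 h2 using hy
  have := key y.1 h1
  rw [closure_subtype] at this
  convert this using 1
  exact Prod.ext rfl (funext h2)

/-! ## Comparison of compactifications -/

/-- Two compactifications of the same set are homeomorphic if along filters limits in one of them
determine limits in the other. -/
theorem exists_homeomorph_of_denseRange {U X Y : Type} [TopologicalSpace X] [TopologicalSpace Y]
    [CompactSpace X] [T2Space X] [CompactSpace Y] [T2Space Y] {i : U → X} {j : U → Y}
    (hi : DenseRange i) (hj : DenseRange j)
    (h1 : ∀ (l l' : Filter U) [l.NeBot] [l'.NeBot] (x : X) (y y' : Y), Tendsto i l (𝓝 x) →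
      Tendsto j l (𝓝 y) → Tendsto i l' (𝓝 x) → Tendsto j l' (𝓝 y') → y = y')
    (h2 : ∀ (l l' : Filter U) [l.NeBot] [l'.NeBot] (x x' : X) (y : Y), Tendsto i l (𝓝 x) →
      Tendsto j l (𝓝 y) → Tendsto i l' (𝓝 x') → Tendsto j l' (𝓝 y) → x = x') :
    ∃ e : X ≃ₜ Y, ∀ u, e (i u) = j u := by
  -- The closure of the joint graph. Each projection is onto, its image being compact and dense, and
  -- injective by `h1` or `h2`; a continuous bijection from a compact space to a Hausdorff one is a
  -- homeomorphism.
  let Γ : Set (X × Y) := closure (Set.range fun u => (i u, j u))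
  have hΓ : IsClosed Γ := isClosed_closure
  have : CompactSpace Γ := isCompact_iff_compactSpace.1 hΓ.isCompact
  have lim : ∀ z ∈ Γ, ∃ l : Filter U, l.NeBot ∧ Tendsto i l (𝓝 z.1) ∧ Tendsto j l (𝓝 z.2) := by
    intro z hz
    -- The pulled-back neighbourhood filter makes each point of `Γ` a joint limit; no countability
    -- is needed.
    refine ⟨comap (fun u => (i u, j u)) (𝓝 z), ?_, ?_, ?_⟩
    · rw [comap_neBot_iff]
      intro t ht
      obtain ⟨w, hw, u, rfl⟩ := mem_closure_iff_nhds.1 hz t ht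
      exact ⟨u, hw⟩
    · exact (continuous_fst.tendsto z).comp tendsto_comap
    · exact (continuous_snd.tendsto z).comp tendsto_comap
  have mem : ∀ u, (i u, j u) ∈ Γ := fun u => subset_closure ⟨u, rfl⟩
  let p : Γ → X := fun z => z.1.1
  let q : Γ → Y := fun z => z.1.2
  have hp : Continuous p := continuous_fst.comp continuous_subtype_val
  have hq : Continuous q := continuous_snd.comp continuous_subtype_val
  have surj : ∀ {W : Type} [TopologicalSpace W] [T2Space W] (f : Γ → W) (g : U → W),
      Continuous f → DenseRange g → (∀ u, f ⟨_, mem u⟩ = g u) → Function.Surjective f := by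
    intro W _ _ f g hf hg h w
    have hc : IsClosed (Set.range f) := (isCompact_range hf).isClosed
    have : Set.range g ⊆ Set.range f := by
      rintro _ ⟨u, rfl⟩
      exact ⟨_, h u⟩
    exact closure_minimal this hc (hg w)
  have bp : Function.Bijective p := by
    refine ⟨?_, surj p i hp hi fun u => rfl⟩
    rintro ⟨⟨x, y⟩, hz⟩ ⟨⟨x', y'⟩, hz'⟩ h
    obtain rfl : x = x' := h
    obtain ⟨l, _, h3, h4⟩ := lim _ hz
    obtain ⟨l', _, h5, h6⟩ := lim _ hz'
    obtain rfl := h1 l l' x y y' h3 h4 h5 h6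
    rfl
  have bq : Function.Bijective q := by
    refine ⟨?_, surj q j hq hj fun u => rfl⟩
    rintro ⟨⟨x, y⟩, hz⟩ ⟨⟨x', y'⟩, hz'⟩ h
    obtain rfl : y = y' := h
    obtain ⟨l, _, h3, h4⟩ := lim _ hz
    obtain ⟨l', _, h5, h6⟩ := lim _ hz'
    obtain rfl := h2 l l' x x' y h3 h4 h5 h6
    rfl
  let ep : Γ ≃ₜ X := Continuous.homeoOfEquivCompactToT2 (f := Equiv.ofBijective p bp) hp
  let eq : Γ ≃ₜ Y := Continuous.homeoOfEquivCompactToT2 (f := Equiv.ofBijective q bq) hq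
  refine ⟨ep.symm.trans eq, fun u => ?_⟩
  have : ep.symm (i u) = ⟨_, mem u⟩ := ep.symm_apply_eq.2 rfl
  change eq (ep.symm (i u)) = _
  rw [this]
  rfl

/-! ## The five cross-ratios on the space of parameters -/

/-- The parameter `((c₁ - c₁') c₂ : (c₂ - c₂') c₁)`. -/
def paramD (c : openCubic) : CP1 :=
  CP1.pt (((c.1 0).rep 0 - (c.1 0).rep 1) * (c.1 1).rep 0)
    (((c.1 1).rep 0 - (c.1 1).rep 1) * (c.1 0).rep 0)
    (pair_ne_zero (mul_ne_zero (sub_ne_zero.2 (c.2.2 0).2.2) (c.2.2 1).1))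

/-- The parameter `((c₁ - c₁') c₂' : c₁' (c₂ - c₂'))`. -/
def paramE (c : openCubic) : CP1 :=
  CP1.pt (((c.1 0).rep 0 - (c.1 0).rep 1) * (c.1 1).rep 1)
    (((c.1 1).rep 0 - (c.1 1).rep 1) * (c.1 0).rep 1)
    (pair_ne_zero (mul_ne_zero (sub_ne_zero.2 (c.2.2 0).2.2) (c.2.2 1).2.1))

/-- The five cross-ratios of a point of the space of parameters. -/
def fiveParam (c : openCubic) : Fin 5 → CP1 := ![c.1 0, c.1 1, c.1 2, paramD c, paramE c]

/-- The closure of the space of parameters in `(CP¹)⁵` under the five cross-ratios. -/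
abbrev FiveClosure : Type := closure (Set.range fiveParam)

/-- The inclusion of the space of parameters into its closure in `(CP¹)⁵`. -/
def FiveClosure.incl (c : openCubic) : FiveClosure :=
  ⟨fiveParam c, subset_closure (Set.mem_range_self c)⟩

instance : CompactSpace FiveClosure := isCompact_iff_compactSpace.1 isClosed_closure.isCompact

theorem denseRange_subtype_closure {U X : Type} [TopologicalSpace X] (f : U → X) :
    DenseRange fun u => (⟨f u, subset_closure (Set.mem_range_self u)⟩ :
      closure (Set.range f)) := by
  intro z
  rw [closure_subtype, ← Set.range_comp]
  exact z.2

theorem FiveClosure.denseRange_incl : DenseRange FiveClosure.incl :=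
  denseRange_subtype_closure fiveParam

/-- The device by which an identity on F passes to the boundary: multiply it by the scalars that
make both sides converge. -/
theorem eq_of_tendsto {U : Type} {l : Filter U} [l.NeBot] {f g : U → ℂ} {a b : ℂ}
    (hf : Tendsto f l (𝓝 a)) (hg : Tendsto g l (𝓝 b)) (h : ∀ u, f u = g u) : a = b :=
  tendsto_nhds_unique hf (hg.congr fun u => (h u).symm)

theorem tendsto_component {U ι : Type} {l : Filter U} {s : U → ℂ} {n : U → ι → ℂ} {a : ι → ℂ}
    (h : Tendsto (fun u => s u • n u) l (𝓝 a)) (i : ι) :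
    Tendsto (fun u => s u * n u i) l (𝓝 (a i)) :=
  ((continuous_apply i).tendsto a).comp h

theorem CP1.exists_tendsto_mul {U : Type} {l : Filter U} {g : U → CP1} {x : CP1}
    (hg : Tendsto g l (𝓝 x)) : ∃ s : U → ℂ, (∀ u, s u ≠ 0) ∧
      Tendsto (fun u => s u * (g u).rep 0) l (𝓝 (x.rep 0)) ∧
      Tendsto (fun u => s u * (g u).rep 1) l (𝓝 (x.rep 1)) := by
  obtain ⟨s, hs0, hs⟩ := exists_tendsto_smul_rep hg
  exact ⟨s, hs0, tendsto_component hs 0, tendsto_component hs 1⟩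

/-- The scaled vector is the defining polynomial one rather than `(paramD u).rep`, so that relations
with the other parameters become polynomial identities. -/
theorem paramD_exists_tendsto {l : Filter openCubic} {x : CP1} (h : Tendsto paramD l (𝓝 x)) :
    ∃ s : openCubic → ℂ,
      Tendsto (fun u => s u * (((u.1 0).rep 0 - (u.1 0).rep 1) * (u.1 1).rep 0)) l
        (𝓝 (x.rep 0)) ∧
      Tendsto (fun u => s u * (((u.1 1).rep 0 - (u.1 1).rep 1) * (u.1 0).rep 0)) l
        (𝓝 (x.rep 1)) := by
  obtain ⟨s, hs0, hs⟩ := exists_tendsto_smul h _ fun u => ⟨_, rfl⟩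
  exact ⟨s, tendsto_component hs 0, tendsto_component hs 1⟩

theorem paramE_exists_tendsto {l : Filter openCubic} {x : CP1} (h : Tendsto paramE l (𝓝 x)) :
    ∃ s : openCubic → ℂ,
      Tendsto (fun u => s u * (((u.1 0).rep 0 - (u.1 0).rep 1) * (u.1 1).rep 1)) l
        (𝓝 (x.rep 0)) ∧
      Tendsto (fun u => s u * (((u.1 1).rep 0 - (u.1 1).rep 1) * (u.1 0).rep 1)) l
        (𝓝 (x.rep 1)) := by
  obtain ⟨s, hs0, hs⟩ := exists_tendsto_smul h _ fun u => ⟨_, rfl⟩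
  exact ⟨s, tendsto_component hs 0, tendsto_component hs 1⟩

theorem FiveClosure.tendsto_components {l : Filter openCubic} {z : FiveClosure}
    (h : Tendsto FiveClosure.incl l (𝓝 z)) :
    (∀ i : Fin 3, Tendsto (fun u : openCubic => u.1 i) l (𝓝 (z.1 (i.castAdd 2)))) ∧
      Tendsto paramD l (𝓝 (z.1 3)) ∧ Tendsto paramE l (𝓝 (z.1 4)) := by
  have h' := tendsto_pi_nhds.1 (tendsto_subtype_rng.1 h)
  refine ⟨fun i => ?_, h' 3, h' 4⟩
  fin_cases i
  · exact h' 0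
  · exact h' 1
  · exact h' 2

theorem openCubic_relation (c : openCubic) :
    (c.1 0).rep 0 * (c.1 1).rep 1 * (c.1 2).rep 0 =
      (c.1 0).rep 1 * (c.1 1).rep 0 * (c.1 2).rep 1 := c.2.1

/-- The equations between the cross-ratios on the closure. -/
theorem FiveClosure.relations {l : Filter openCubic} [l.NeBot] {z : FiveClosure}
    (h : Tendsto FiveClosure.incl l (𝓝 z)) :
    (z.1 0).rep 0 * (z.1 1).rep 1 * (z.1 2).rep 0 =
      (z.1 0).rep 1 * (z.1 1).rep 0 * (z.1 2).rep 1 ∧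
    (z.1 3).rep 0 * ((z.1 1).rep 0 - (z.1 1).rep 1) * (z.1 0).rep 0 =
      (z.1 3).rep 1 * ((z.1 0).rep 0 - (z.1 0).rep 1) * (z.1 1).rep 0 ∧
    (z.1 3).rep 0 * ((z.1 0).rep 0 * (z.1 2).rep 0 - (z.1 0).rep 1 * (z.1 2).rep 1) =
      (z.1 3).rep 1 * (z.1 2).rep 0 * ((z.1 0).rep 0 - (z.1 0).rep 1) ∧
    (z.1 4).rep 0 * (z.1 2).rep 0 * (z.1 3).rep 1 =
      (z.1 4).rep 1 * (z.1 2).rep 1 * (z.1 3).rep 0 ∧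
    (z.1 4).rep 0 * (z.1 3).rep 1 * (z.1 0).rep 1 = (z.1 4).rep 1 *
      ((z.1 3).rep 0 * (z.1 0).rep 0 - (z.1 3).rep 1 * ((z.1 0).rep 0 - (z.1 0).rep 1)) ∧
    (z.1 4).rep 0 * ((z.1 3).rep 1 * (z.1 1).rep 0 -
      (z.1 3).rep 0 * ((z.1 1).rep 0 - (z.1 1).rep 1)) =
      (z.1 4).rep 1 * (z.1 3).rep 0 * (z.1 1).rep 1 := by
  obtain ⟨hc, hd, he⟩ := FiveClosure.tendsto_components h
  obtain ⟨r, -, x0, y0⟩ := CP1.exists_tendsto_mul (hc 0)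
  obtain ⟨s, -, x1, y1⟩ := CP1.exists_tendsto_mul (hc 1)
  obtain ⟨t, -, x2, y2⟩ := CP1.exists_tendsto_mul (hc 2)
  obtain ⟨p, d0, d1⟩ := paramD_exists_tendsto hd
  obtain ⟨q, e0, e1⟩ := paramE_exists_tendsto he
  -- On F these relations are redundant, but at a boundary point some of them degenerate to 0 = 0
  -- and the others are needed.
  refine ⟨?_, ?_, ?_, ?_, ?_, ?_⟩
  · exact eq_of_tendsto ((x0.mul y1).mul x2) ((y0.mul x1).mul y2) fun u => by
      linear_combination r u * s u * t u * openCubic_relation u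
  · exact eq_of_tendsto ((d0.mul (x1.sub y1)).mul x0) ((d1.mul (x0.sub y0)).mul x1) fun u => by
      ring
  · exact eq_of_tendsto (d0.mul ((x0.mul x2).sub (y0.mul y2)))
      ((d1.mul x2).mul (x0.sub y0)) fun u => by
        linear_combination p u * r u * t u * ((u.1 0).rep 0 - (u.1 0).rep 1) * openCubic_relation u
  · exact eq_of_tendsto ((e0.mul x2).mul d1) ((e1.mul y2).mul d0) fun u => by
      linear_combination p u * q u * t u * ((u.1 0).rep 0 - (u.1 0).rep 1) *
        ((u.1 1).rep 0 - (u.1 1).rep 1) * openCubic_relation u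
  · exact eq_of_tendsto ((e0.mul d1).mul y0)
      (e1.mul ((d0.mul x0).sub (d1.mul (x0.sub y0)))) fun u => by ring
  · exact eq_of_tendsto (e0.mul ((d1.mul x1).sub (d0.mul (x1.sub y1))))
      ((e1.mul d0).mul y1) fun u => by ring

/-- The first four cross-ratios determine the fifth one. -/
theorem FiveClosure.ext_of_four {l l' : Filter openCubic} [l.NeBot] [l'.NeBot] {z z' : FiveClosure}
    (h : Tendsto FiveClosure.incl l (𝓝 z)) (h' : Tendsto FiveClosure.incl l' (𝓝 z'))
    (h0 : z.1 0 = z'.1 0) (h1 : z.1 1 = z'.1 1) (h2 : z.1 2 = z'.1 2) (h3 : z.1 3 = z'.1 3) :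
    z = z' := by
  obtain ⟨-, -, -, a1, a2, a3⟩ := FiveClosure.relations h
  obtain ⟨-, -, -, b1, b2, b3⟩ := FiveClosure.relations h'
  simp only [← h0, ← h1, ← h2, ← h3] at b1 b2 b3
  have h4 : z.1 4 = z'.1 4 := by
    have n0 := (z.1 0).rep_ne
    have n1 := (z.1 1).rep_ne
    have n2 := (z.1 2).rep_ne
    have n3 := (z.1 3).rep_ne
    -- Three relations are linear in the fifth parameter. The first degenerates only if the third
    -- and fourth parameters are both (0:1) or both (1:0); the second works in the former case, the
    -- third in the latter.
    by_cases k0 : (z.1 2).rep 0 * (z.1 3).rep 1 = 0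
    · by_cases k1 : (z.1 2).rep 1 * (z.1 3).rep 0 = 0
      · by_cases k2 : (z.1 3).rep 0 = 0
        · refine CP1.eq_of_linear (α := (z.1 3).rep 1 * (z.1 0).rep 1)
            (β := (z.1 3).rep 0 * (z.1 0).rep 0 -
              (z.1 3).rep 1 * ((z.1 0).rep 0 - (z.1 0).rep 1)) ?_ ?_ ?_
          · have k3 : (z.1 3).rep 1 ≠ 0 := by tauto
            by_contra! hh
            have e1 : (z.1 0).rep 1 = 0 := by simpa [k3] using hh.1
            have e2 : (z.1 0).rep 0 = 0 := by simpa [k2, k3, e1] using hh.2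
            tauto
          · linear_combination a2
          · linear_combination b2
        · refine CP1.eq_of_linear (α := (z.1 3).rep 1 * (z.1 1).rep 0 -
              (z.1 3).rep 0 * ((z.1 1).rep 0 - (z.1 1).rep 1))
            (β := (z.1 3).rep 0 * (z.1 1).rep 1) ?_ ?_ ?_
          · have k3 : (z.1 2).rep 1 = 0 := by simpa [k2] using k1
            have k4 : (z.1 3).rep 1 = 0 := by
              have : (z.1 2).rep 0 ≠ 0 := by tauto
              simpa [this] using k0
            by_contra! hh
            have e1 : (z.1 1).rep 1 = 0 := by simpa [k2] using hh.2
            have e2 : (z.1 1).rep 0 = 0 := by simpa [k2, k4, e1] using hh.1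
            tauto
          · linear_combination a3
          · linear_combination b3
      · exact CP1.eq_of_linear (α := (z.1 2).rep 0 * (z.1 3).rep 1)
          (β := (z.1 2).rep 1 * (z.1 3).rep 0) (Or.inr k1) (by linear_combination a1)
          (by linear_combination b1)
    · exact CP1.eq_of_linear (α := (z.1 2).rep 0 * (z.1 3).rep 1)
        (β := (z.1 2).rep 1 * (z.1 3).rep 0) (Or.inl k0) (by linear_combination a1)
        (by linear_combination b1)
  apply Subtype.ext
  funext i
  fin_cases i
  · exact h0
  · exact h1
  · exact h2
  · exact h3
  · exact h4

/-- Outside of the point where the first two cross-ratios are `(1 : 1)`, the first three of them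
determine the fourth one. -/
theorem FiveClosure.fourth_eq {l l' : Filter openCubic} [l.NeBot] [l'.NeBot] {z z' : FiveClosure}
    (h : Tendsto FiveClosure.incl l (𝓝 z)) (h' : Tendsto FiveClosure.incl l' (𝓝 z'))
    (h0 : z.1 0 = z'.1 0) (h1 : z.1 1 = z'.1 1) (h2 : z.1 2 = z'.1 2)
    (hne : (z.1 0).rep 0 ≠ (z.1 0).rep 1 ∨ (z.1 1).rep 0 ≠ (z.1 1).rep 1) : z.1 3 = z'.1 3 := by
  obtain ⟨-, a1, a2, -⟩ := FiveClosure.relations h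
  obtain ⟨-, b1, b2, -⟩ := FiveClosure.relations h'
  simp only [← h0, ← h1, ← h2] at b1 b2
  have n0 := (z.1 0).rep_ne
  have n1 := (z.1 1).rep_ne
  have n2 := (z.1 2).rep_ne
  -- Away from ((1:1),(1:1)) both coefficients of this relation vanish only when the first two
  -- parameters are (0:1).
  by_cases k : ((z.1 1).rep 0 - (z.1 1).rep 1) * (z.1 0).rep 0 ≠ 0 ∨
      ((z.1 0).rep 0 - (z.1 0).rep 1) * (z.1 1).rep 0 ≠ 0
  · exact CP1.eq_of_linear k (by linear_combination a1) (by linear_combination b1)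
  · push Not at k
    obtain ⟨k1, k2⟩ := k
    rw [mul_eq_zero, sub_eq_zero] at k1 k2
    have e0 : (z.1 0).rep 0 = 0 := by
      rcases k1 with k1 | k1
      · rcases k2 with k2 | k2
        · tauto
        · rw [k2] at k1
          exact absurd k1.symm (by tauto)
      · exact k1
    have e1 : (z.1 0).rep 1 ≠ 0 := by tauto
    -- At (0:1) the next relation says that the fourth parameter equals the third.
    refine CP1.eq_of_linear
      (α := (z.1 0).rep 0 * (z.1 2).rep 0 - (z.1 0).rep 1 * (z.1 2).rep 1)
      (β := (z.1 2).rep 0 * ((z.1 0).rep 0 - (z.1 0).rep 1)) ?_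
      (by linear_combination a2) (by linear_combination b2)
    rw [e0]
    simpa [e1] using n2.symm

/-! ## Density of the space of parameters of the main stratum -/

theorem tendsto_of_eventually_eq_mk {U ι : Type} {l : Filter U} {g : U → CProj ι}
    {α : U → ι → ℂ} {a : ι → ℂ} (ha : a ≠ 0) (h : Tendsto α l (𝓝 a))
    (hg : ∀ᶠ u in l, ∃ hu, g u = Projectivization.mk ℂ (α u) hu) :
    Tendsto g l (𝓝 (Projectivization.mk ℂ a ha)) := by
  classical
  -- Where `α` vanishes it is replaced by its limit `a`; this keeps the family convergent and
  -- everywhere non-zero.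
  have hα : ∀ u, (if α u = 0 then a else α u) ≠ 0 := fun u => by
    split_ifs with hu
    · exact ha
    · exact hu
  have ht : Tendsto (fun u => if α u = 0 then a else α u) l (𝓝 a) :=
    tendsto_const_nhds.if' h
  refine (tendsto_mk ht hα ha).congr' ?_
  filter_upwards [hg] with u ⟨hu, e⟩
  rw [e]
  congr 1
  rw [if_neg hu]

theorem tendsto_of_eventually_eq_mk_rep {U ι : Type} {l : Filter U} {g : U → CProj ι}
    {α : U → ι → ℂ} {x : CProj ι} (h : Tendsto α l (𝓝 x.rep))
    (hg : ∀ᶠ u in l, ∃ hu, g u = Projectivization.mk ℂ (α u) hu) :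
    Tendsto g l (𝓝 x) := by
  have := tendsto_of_eventually_eq_mk x.rep_nonzero h hg
  rwa [x.mk_rep] at this

/-- A non-zero polynomial has no zeros in a small punctured disc. This and the quadratic case make
small perturbations generic. -/
theorem eventually_linear_ne_zero {a b : ℂ} (h : a ≠ 0 ∨ b ≠ 0) :
    ∀ᶠ t in 𝓝[≠] (0 : ℂ), a + t * b ≠ 0 := by
  by_cases ha : a = 0
  · have hb : b ≠ 0 := by tauto
    filter_upwards [self_mem_nhdsWithin] with t ht
    rw [ha, zero_add]
    exact mul_ne_zero ht hb
  · have : ContinuousAt (fun t : ℂ => a + t * b) 0 := by fun_prop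
    refine nhdsWithin_le_nhds (this.eventually_ne ?_)
    simpa using ha

theorem eventually_quadratic_ne_zero {a b c : ℂ} (h : b ≠ 0 ∨ c ≠ 0) :
    ∀ᶠ t in 𝓝[≠] (0 : ℂ), a + t * (b + t * c) ≠ 0 := by
  by_cases ha : a = 0
  · filter_upwards [self_mem_nhdsWithin, eventually_linear_ne_zero h] with t ht h'
    rw [ha, zero_add]
    exact mul_ne_zero ht h'
  · have : ContinuousAt (fun t : ℂ => a + t * (b + t * c)) 0 := by fun_prop
    refine nhdsWithin_le_nhds (this.eventually_ne ?_)
    simpa using ha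

theorem exists_openCubic (v : Fin 3 → Fin 2 → ℂ)
    (hv : ∀ i, v i 0 ≠ 0 ∧ v i 1 ≠ 0 ∧ v i 0 ≠ v i 1)
    (h : v 0 0 * v 1 1 * v 2 0 = v 0 1 * v 1 0 * v 2 1) :
    ∃ c : openCubic, ∀ i, ∃ hi, c.1 i = Projectivization.mk ℂ (v i) hi := by
  have hi : ∀ i, v i ≠ 0 := fun i h0 => (hv i).1 (congrFun h0 0)
  choose s hs es using fun i => CProj.rep_mk (v i) (hi i)
  have es : ∀ i k, (Projectivization.mk ℂ (v i) (hi i)).rep k = s i * v i k :=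
    fun i k => congrFun (es i) k
  refine ⟨⟨fun i => Projectivization.mk ℂ (v i) (hi i), ?_, fun i => ?_⟩, fun i => ⟨hi i, rfl⟩⟩
  · change _ * _ * _ = _ * _ * _
    simp only [es]
    linear_combination s 0 * s 1 * s 2 * h
  · simp only [es]
    exact ⟨mul_ne_zero (hs i) (hv i).1, mul_ne_zero (hs i) (hv i).2.1,
      fun e => (hv i).2.2 (mul_left_cancel₀ (hs i) e)⟩

/-- Small generic perturbations of the first two parameters lie in the space of parameters. -/
theorem eventually_exists_openCubic (v w : Fin 2 → ℂ) :
    ∀ᶠ t in 𝓝[≠] (0 : ℂ), ∃ c : openCubic,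
      (∃ h, c.1 0 = Projectivization.mk ℂ (v + t • ![1, 2]) h) ∧
      (∃ h, c.1 1 = Projectivization.mk ℂ (w + t • ![1, 3]) h) ∧
      ∃ h, c.1 2 = Projectivization.mk ℂ
        ![(v 1 + t * 2) * (w 0 + t * 1), (v 0 + t * 1) * (w 1 + t * 3)] h := by
  -- The directions (1,2) and (1,3) are chosen to be non-degenerate: in every quantity that must not
  -- vanish, the leading power of `t` has a non-zero coefficient (in the last one 2·1 - 1·3 = -1).
  -- The third parameter is forced by the cubic equation.
  filter_upwards [eventually_linear_ne_zero (a := v 0) (b := 1) (by simp),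
    eventually_linear_ne_zero (a := v 1) (b := 2) (by simp),
    eventually_linear_ne_zero (a := v 0 - v 1) (b := -1) (by simp),
    eventually_linear_ne_zero (a := w 0) (b := 1) (by simp),
    eventually_linear_ne_zero (a := w 1) (b := 3) (by simp),
    eventually_linear_ne_zero (a := w 0 - w 1) (b := -2) (by simp),
    eventually_quadratic_ne_zero (a := v 1 * w 0 - v 0 * w 1)
      (b := 2 * w 0 + v 1 - 3 * v 0 - w 1) (c := -1) (by simp)] with t h1 h2 h3 h4 h5 h6 h7
  obtain ⟨c, hc⟩ := exists_openCubic ![v + t • ![1, 2], w + t • ![1, 3],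
    ![(v 1 + t * 2) * (w 0 + t * 1), (v 0 + t * 1) * (w 1 + t * 3)]] (by
      intro i
      fin_cases i
      · refine ⟨h1, h2, fun e => h3 ?_⟩
        have e : v 0 + t * 1 = v 1 + t * 2 := e
        linear_combination e
      · refine ⟨h4, h5, fun e => h6 ?_⟩
        have e : w 0 + t * 1 = w 1 + t * 3 := e
        linear_combination e
      · refine ⟨mul_ne_zero h2 h4, mul_ne_zero h1 h5, fun e => h7 ?_⟩
        have e : (v 1 + t * 2) * (w 0 + t * 1) = (v 0 + t * 1) * (w 1 + t * 3) := e
        linear_combination e) (by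
      change (v 0 + t * 1) * (w 1 + t * 3) * ((v 1 + t * 2) * (w 0 + t * 1)) =
        (v 1 + t * 2) * (w 0 + t * 1) * ((v 0 + t * 1) * (w 1 + t * 3))
      ring)
  exact ⟨c, hc 0, hc 1, hc 2⟩

theorem tendsto_add_smul {ι : Type} (v g : ι → ℂ) :
    Tendsto (fun t : ℂ => v + t • g) (𝓝[≠] 0) (𝓝 v) := by
  have : Continuous fun t : ℂ => v + t • g := by fun_prop
  have h := this.tendsto 0
  simp only [zero_smul, add_zero] at h
  exact h.mono_left nhdsWithin_le_nhds

/-- Turns a path that exists only for generic small parameters into a closure statement. The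
approximating points are chosen arbitrarily subject to `P`, hence the quantification over all
choices `c`. -/
theorem mem_closure_range_of_eventually {U T X : Type} [TopologicalSpace X] {f : U → X} {x : X}
    {l : Filter T} [l.NeBot] {P : T → U → Prop} (hP : ∀ᶠ t in l, ∃ u, P t u)
    (h : ∀ c : T → U, (∀ᶠ t in l, P t (c t)) → Tendsto (f ∘ c) l (𝓝 x)) :
    x ∈ closure (Set.range f) := by
  have : Nonempty U := by
    obtain ⟨t, u, -⟩ := hP.exists
    exact ⟨u⟩
  obtain ⟨c, hc⟩ := hP.choice
  exact mem_closure_of_tendsto (h c hc) (Eventually.of_forall fun t => Set.mem_range_self _)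

/-- The first two parameters of a point of the space of parameters. -/
def twoParam (c : openCubic) : Fin 2 → CP1 := ![c.1 0, c.1 1]

theorem denseRange_twoParam : DenseRange twoParam := by
  intro z
  refine mem_closure_range_of_eventually (eventually_exists_openCubic (z 0).rep (z 1).rep)
    fun c hc => tendsto_pi_nhds.2 fun i => ?_
  fin_cases i
  · exact tendsto_of_eventually_eq_mk_rep (tendsto_add_smul _ _) (hc.mono fun t h => h.1)
  · exact tendsto_of_eventually_eq_mk_rep (tendsto_add_smul _ _) (hc.mono fun t h => h.2.1)

/-- The point `(c₁ c₂ : c₁' c₂ : c₁ c₂')` of the projective plane. -/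
def planePoint (c : openCubic) : CProj (Fin 3) :=
  Projectivization.mk ℂ ![(c.1 0).rep 0 * (c.1 1).rep 0, (c.1 0).rep 1 * (c.1 1).rep 0,
    (c.1 0).rep 0 * (c.1 1).rep 1] fun e => mul_ne_zero (c.2.2 0).1 (c.2.2 1).1 (congrFun e 0)

theorem denseRange_planePoint : DenseRange planePoint := by
  intro z
  have hev : ∀ᶠ t in 𝓝[≠] (0 : ℂ), ∃ c : openCubic,
      ∃ h, planePoint c = Projectivization.mk ℂ (z.rep + t • ![1, 2, 3]) h := by
    filter_upwards [eventually_linear_ne_zero (a := z.rep 0) (b := 1) (by simp),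
      eventually_linear_ne_zero (a := z.rep 1) (b := 2) (by simp),
      eventually_linear_ne_zero (a := z.rep 2) (b := 3) (by simp),
      eventually_linear_ne_zero (a := z.rep 0 - z.rep 1) (b := -1) (by simp),
      eventually_linear_ne_zero (a := z.rep 0 - z.rep 2) (b := -2) (by simp),
      eventually_linear_ne_zero (a := z.rep 1 - z.rep 2) (b := -1) (by simp)]
      with t h0 h1 h2 h01 h02 h12
    set p := z.rep 0 + t * 1 with hp
    set q := z.rep 1 + t * 2 with hq
    set r := z.rep 2 + t * 3 with hr
    have n01 : p ≠ q := fun e => h01 (by rw [hp, hq] at e; linear_combination e)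
    have n02 : p ≠ r := fun e => h02 (by rw [hp, hr] at e; linear_combination e)
    have n12 : q ≠ r := fun e => h12 (by rw [hq, hr] at e; linear_combination e)
    -- The inverse of `planePoint`: the pairwise ratios of non-zero, distinct coordinates satisfy
    -- the cubic equation automatically.
    obtain ⟨c, hc⟩ := exists_openCubic ![![p, q], ![p, r], ![q, r]] (by
      intro i
      fin_cases i
      · exact ⟨h0, h1, n01⟩
      · exact ⟨h0, h2, n02⟩
      · exact ⟨h1, h2, n12⟩) (by
      change p * r * q = q * p * r
      ring)
    obtain ⟨k0, e0⟩ := hc 0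
    obtain ⟨k1, e1⟩ := hc 1
    obtain ⟨s, hs, es⟩ := CProj.rep_mk _ k0
    obtain ⟨s', hs', es'⟩ := CProj.rep_mk _ k1
    rw [← e0] at es
    rw [← e1] at es'
    have hv : z.rep + t • ![1, 2, 3] = ![p, q, r] := by
      funext i
      fin_cases i <;> rfl
    have hne : z.rep + t • ![1, 2, 3] ≠ 0 := by
      rw [hv]
      exact fun e => h0 (congrFun e 0)
    refine ⟨c, hne, ?_⟩
    rw [planePoint, Projectivization.mk_eq_mk_iff', hv]
    refine ⟨s * s' * p, ?_⟩
    rw [es, es']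
    funext i
    fin_cases i <;> simp <;> ring
  exact mem_closure_range_of_eventually hev fun c hc =>
    tendsto_of_eventually_eq_mk_rep (tendsto_add_smul _ _) hc

/-- Where the cubic equation determines the third coordinate from the first two, a generic
perturbation of those two suffices. Over ((0:1),(0:1)) and ((1:0),(1:0)) the surface contains a
whole line, and the path must be chosen to reach a prescribed third coordinate. -/
theorem denseRange_openCubic :
    DenseRange fun c : openCubic => (⟨c.1, c.2.1⟩ : cubicSurface) := by
  rintro ⟨z, hz⟩
  have hz : (z 0).rep 0 * (z 1).rep 1 * (z 2).rep 0 =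
      (z 0).rep 1 * (z 1).rep 0 * (z 2).rep 1 := hz
  have n0 := (z 0).rep_ne
  have n1 := (z 1).rep_ne
  have n2 := (z 2).rep_ne
  -- a path in the space of parameters whose coordinates converge gives a limit point
  have path : ∀ v : ℂ → Fin 3 → Fin 2 → ℂ,
      (∀ᶠ t in 𝓝[≠] (0 : ℂ), ∀ i, v t i 0 ≠ 0 ∧ v t i 1 ≠ 0 ∧ v t i 0 ≠ v t i 1) →
      (∀ t, v t 0 0 * v t 1 1 * v t 2 0 = v t 0 1 * v t 1 0 * v t 2 1) →
      (∀ i, Continuous fun t => v t i) → (∀ i, v 0 i = (z i).rep) →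
      (⟨z, hz⟩ : cubicSurface) ∈
        closure (Set.range fun c : openCubic => (⟨c.1, c.2.1⟩ : cubicSurface)) := by
    intro v h1 h2 h3 h4
    have hev : ∀ᶠ t in 𝓝[≠] (0 : ℂ), ∃ c : openCubic, ∀ i, ∃ hi,
        c.1 i = Projectivization.mk ℂ (v t i) hi := by
      filter_upwards [h1] with t ht
      exact exists_openCubic (v t) ht (h2 t)
    refine mem_closure_range_of_eventually hev fun c hc =>
      tendsto_subtype_rng.2 (tendsto_pi_nhds.2 fun i => ?_)
    refine tendsto_of_eventually_eq_mk_rep (α := fun t => v t i) ?_ (hc.mono fun t h => h i)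
    rw [← h4]
    exact ((h3 i).tendsto 0).mono_left nhdsWithin_le_nhds
  have hα := eventually_linear_ne_zero (a := (z 2).rep 0) (b := 1) (by simp)
  have hβ := eventually_linear_ne_zero (a := (z 2).rep 1) (b := 2) (by simp)
  have hαβ := eventually_linear_ne_zero (a := (z 2).rep 0 - (z 2).rep 1) (b := -1) (by simp)
  have hα1 : ∀ᶠ t in 𝓝[≠] (0 : ℂ), t * ((z 2).rep 0 + t * 1) ≠ 1 := by
    have : ContinuousAt (fun t : ℂ => t * ((z 2).rep 0 + t * 1)) 0 := by fun_prop
    exact nhdsWithin_le_nhds (this.eventually_ne (by simp))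
  have hβ1 : ∀ᶠ t in 𝓝[≠] (0 : ℂ), t * ((z 2).rep 1 + t * 2) ≠ 1 := by
    have : ContinuousAt (fun t : ℂ => t * ((z 2).rep 1 + t * 2)) 0 := by fun_prop
    exact nhdsWithin_le_nhds (this.eventually_ne (by simp))
  by_cases hx : (z 0).rep 0 = 0 ∧ (z 1).rep 0 = 0
  · obtain ⟨x0, x1⟩ := hx
    have y0 : (z 0).rep 1 ≠ 0 := by tauto
    have y1 : (z 1).rep 1 ≠ 0 := by tauto
    -- With (α : β) the perturbed third coordinate, the first two approach (0:1) at the rates tβ and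
    -- tα, so that the cubic equation holds exactly along the path.
    refine path (fun t => ![![t * ((z 2).rep 1 + t * 2) * (z 0).rep 1, (z 0).rep 1],
      ![t * ((z 2).rep 0 + t * 1) * (z 1).rep 1, (z 1).rep 1],
      ![(z 2).rep 0 + t * 1, (z 2).rep 1 + t * 2]]) ?_ ?_ ?_ ?_
    · filter_upwards [self_mem_nhdsWithin, hα, hβ, hαβ, hα1, hβ1] with t h0 h1 h2 h3 h4 h5
      have h0 : t ≠ 0 := h0
      intro i
      fin_cases i
      · exact ⟨mul_ne_zero (mul_ne_zero h0 h2) y0, y0,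
          fun e => h5 (mul_right_cancel₀ y0 (e.trans (one_mul _).symm))⟩
      · exact ⟨mul_ne_zero (mul_ne_zero h0 h1) y1, y1,
          fun e => h4 (mul_right_cancel₀ y1 (e.trans (one_mul _).symm))⟩
      · refine ⟨h1, h2, fun e => h3 ?_⟩
        have e : (z 2).rep 0 + t * 1 = (z 2).rep 1 + t * 2 := e
        linear_combination e
    · intro t
      simp
      ring
    · intro i
      fin_cases i <;> refine continuous_pi fun k => ?_ <;> fin_cases k <;> simp <;> fun_prop
    · intro i
      fin_cases i <;> funext k <;> fin_cases k <;> simp [x0, x1]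
  by_cases hy : (z 0).rep 1 = 0 ∧ (z 1).rep 1 = 0
  · obtain ⟨y0, y1⟩ := hy
    have x0 : (z 0).rep 0 ≠ 0 := by tauto
    have x1 : (z 1).rep 0 ≠ 0 := by tauto
    -- The same near (1:0), with the rates tα and tβ interchanged.
    refine path (fun t => ![![(z 0).rep 0, t * ((z 2).rep 0 + t * 1) * (z 0).rep 0],
      ![(z 1).rep 0, t * ((z 2).rep 1 + t * 2) * (z 1).rep 0],
      ![(z 2).rep 0 + t * 1, (z 2).rep 1 + t * 2]]) ?_ ?_ ?_ ?_
    · filter_upwards [self_mem_nhdsWithin, hα, hβ, hαβ, hα1, hβ1] with t h0 h1 h2 h3 h4 h5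
      have h0 : t ≠ 0 := h0
      intro i
      fin_cases i
      · exact ⟨x0, mul_ne_zero (mul_ne_zero h0 h1) x0,
          fun e => h4 (mul_right_cancel₀ x0 (e.symm.trans (one_mul _).symm))⟩
      · exact ⟨x1, mul_ne_zero (mul_ne_zero h0 h2) x1,
          fun e => h5 (mul_right_cancel₀ x1 (e.symm.trans (one_mul _).symm))⟩
      · refine ⟨h1, h2, fun e => h3 ?_⟩
        have e : (z 2).rep 0 + t * 1 = (z 2).rep 1 + t * 2 := e
        linear_combination e
    · intro t
      simp
      ring
    · intro i
      fin_cases i <;> refine continuous_pi fun k => ?_ <;> fin_cases k <;> simp <;> fun_prop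
    · intro i
      fin_cases i <;> funext k <;> fin_cases k <;> simp [y0, y1]
  -- Elsewhere a coefficient of the third coordinate survives, so the third coordinate is a ratio of
  -- products of the first two.
  have hn : (z 0).rep 1 * (z 1).rep 0 ≠ 0 ∨ (z 0).rep 0 * (z 1).rep 1 ≠ 0 := by
    simp only [ne_eq, mul_eq_zero]
    tauto
  have hn' : (![(z 0).rep 1 * (z 1).rep 0, (z 0).rep 0 * (z 1).rep 1] : Fin 2 → ℂ) ≠ 0 := by
    intro e
    rcases hn with h | h
    · exact h (congrFun e 0)
    · exact h (congrFun e 1)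
  have e2 : z 2 = Projectivization.mk ℂ _ hn' := by
    obtain ⟨s, -, es⟩ := CProj.rep_mk _ hn'
    refine CP1.eq_of_linear (α := (z 0).rep 0 * (z 1).rep 1) (β := (z 0).rep 1 * (z 1).rep 0)
      hn.symm hz ?_
    rw [es]
    simp
    ring
  refine mem_closure_range_of_eventually (eventually_exists_openCubic (z 0).rep (z 1).rep)
    fun c hc => tendsto_subtype_rng.2 (tendsto_pi_nhds.2 fun i => ?_)
  fin_cases i
  · exact tendsto_of_eventually_eq_mk_rep (tendsto_add_smul _ _) (hc.mono fun t h => h.1)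
  · exact tendsto_of_eventually_eq_mk_rep (tendsto_add_smul _ _) (hc.mono fun t h => h.2.1)
  · change Tendsto _ _ (𝓝 (z 2))
    rw [e2]
    refine tendsto_of_eventually_eq_mk hn' ?_ (hc.mono fun t h => h.2.2)
    have : Continuous fun t : ℂ => (![((z 0).rep 1 + t * 2) * ((z 1).rep 0 + t * 1),
        ((z 0).rep 0 + t * 1) * ((z 1).rep 1 + t * 3)] : Fin 2 → ℂ) := by
      refine continuous_pi fun k => ?_
      fin_cases k <;> simp <;> fun_prop
    have h := this.tendsto 0
    simp only [zero_mul, add_zero] at h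
    exact h.mono_left nhdsWithin_le_nhds

/-! ## Limits in blowups -/

instance {X ι : Type} [TopologicalSpace X] [CompactSpace X] [Finite ι] (j : X → CProj ι) {k : ℕ}
    (s : Fin k → X) : CompactSpace (Blowup j s) :=
  isCompact_iff_compactSpace.1 isClosed_closure.isCompact

theorem isClosed_cubicSurface : IsClosed cubicSurface := by
  refine isClosed_of_closure_subset fun z hz => ?_
  have : (comap (Subtype.val : cubicSurface → _) (𝓝 z)).NeBot := mem_closure_iff_comap_neBot.1 hz
  have h := tendsto_pi_nhds.1 (tendsto_comap (f := (Subtype.val : cubicSurface → _)) (x := 𝓝 z))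
  obtain ⟨r, -, x0, y0⟩ := CP1.exists_tendsto_mul (h 0)
  obtain ⟨s, -, x1, y1⟩ := CP1.exists_tendsto_mul (h 1)
  obtain ⟨t, -, x2, y2⟩ := CP1.exists_tendsto_mul (h 2)
  exact eq_of_tendsto ((x0.mul y1).mul x2) ((y0.mul x1).mul y2) fun u => by
    have hu : (u.1 0).rep 0 * (u.1 1).rep 1 * (u.1 2).rep 0 =
      (u.1 0).rep 1 * (u.1 1).rep 0 * (u.1 2).rep 1 := u.2
    linear_combination r u * s u * t u * hu

instance : CompactSpace cubicSurface := isCompact_iff_compactSpace.1 isClosed_cubicSurface.isCompact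

theorem Blowup.tendsto_base {U X ι : Type} [TopologicalSpace X] {j : X → CProj ι} {k : ℕ}
    {s : Fin k → X} {l : Filter U} {f : U → X} {hf : ∀ u a, j (f u) ≠ j (s a)} {y : Blowup j s}
    (h : Tendsto (fun u => Blowup.lift j s (f u) (hf u)) l (𝓝 y)) : Tendsto f l (𝓝 y.1.1) :=
  (continuous_fst.tendsto _).comp (tendsto_subtype_rng.1 h)

/-- Convergence in an exceptional factor, expressed through any chosen vectors for the centre and
for the moving points: one common scalar makes all entries of the wedge converge. -/
theorem Blowup.exists_tendsto {U X ι : Type} [TopologicalSpace X] {j : X → CProj ι} {k : ℕ}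
    {s : Fin k → X} {l : Filter U} {f : U → X} {hf : ∀ u a, j (f u) ≠ j (s a)} {y : Blowup j s}
    (h : Tendsto (fun u => Blowup.lift j s (f u) (hf u)) l (𝓝 y)) (a : Fin k) {p : ι → ℂ}
    (hp : ∃ hp, j (s a) = Projectivization.mk ℂ p hp) (v : U → ι → ℂ)
    (hv : ∀ u, ∃ hv, j (f u) = Projectivization.mk ℂ (v u) hv) :
    ∃ r : U → ℂ, ∀ i i', Tendsto (fun u => r u * (v u i * p i' - v u i' * p i)) l
      (𝓝 ((y.1.2 a).rep (i, i'))) := by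
  have h2 : Tendsto (fun u => (Blowup.lift j s (f u) (hf u)).1.2 a) l (𝓝 (y.1.2 a)) :=
    tendsto_pi_nhds.1 ((continuous_snd.tendsto _).comp (tendsto_subtype_rng.1 h)) a
  obtain ⟨hp, ep⟩ := hp
  obtain ⟨r, -, hr⟩ := exists_tendsto_smul h2 (fun u => wedgeVec p (v u)) fun u => by
    obtain ⟨hv, ev⟩ := hv u
    exact mk_wedgeVec_rep (hf u a) ep ev
  exact ⟨r, fun i i' => tendsto_component hr (i, i')⟩

/-- A point of an exceptional factor is determined by one column of its representative. -/
theorem Blowup.rep_apply {U X ι : Type} [TopologicalSpace X] {j : X → CProj ι} {k : ℕ}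
    {s : Fin k → X} {l : Filter U} [l.NeBot] {f : U → X} {hf : ∀ u a, j (f u) ≠ j (s a)}
    {y : Blowup j s} (h : Tendsto (fun u => Blowup.lift j s (f u) (hf u)) l (𝓝 y)) (a : Fin k)
    {p : ι → ℂ} (hp : ∃ hp, j (s a) = Projectivization.mk ℂ p hp) {m : ι} (hm : p m = 1)
    (ii : ι × ι) :
    (y.1.2 a).rep ii = (y.1.2 a).rep (ii.1, m) * p ii.2 - (y.1.2 a).rep (ii.2, m) * p ii.1 := by
  obtain ⟨r, hr⟩ := Blowup.exists_tendsto h a hp (fun u => (j (f u)).rep)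
    fun u => ⟨_, (j (f u)).mk_rep.symm⟩
  -- For pₘ = 1 one has vᵢpⱼ - vⱼpᵢ = (vᵢpₘ - vₘpᵢ)pⱼ - (vⱼpₘ - vₘpⱼ)pᵢ.
  exact eq_of_tendsto (hr ii.1 ii.2)
    (((hr ii.1 m).mul tendsto_const_nhds).sub ((hr ii.2 m).mul tendsto_const_nhds)) fun u => by
      rw [hm]
      ring

/-- Serves to compare points of an exceptional curve: the column runs through a two-dimensional
space, and one linear equation, with a cross-ratio as coefficients, singles out the point. -/
theorem CProj.eq_of_column_pencil {ι : Type} {p q : CProj (ι × ι)} {P : ι → ℂ} {m : ι}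
    (hp : ∀ ii : ι × ι, p.rep ii = p.rep (ii.1, m) * P ii.2 - p.rep (ii.2, m) * P ii.1)
    (hq : ∀ ii : ι × ι, q.rep ii = q.rep (ii.1, m) * P ii.2 - q.rep (ii.2, m) * P ii.1)
    (M N : ι → ℂ) {δ ε δ' ε' α β : ℂ} (hp' : ∀ i, p.rep (i, m) = M i * δ + N i * ε)
    (hq' : ∀ i, q.rep (i, m) = M i * δ' + N i * ε') (h0 : α ≠ 0 ∨ β ≠ 0)
    (h1 : α * δ = β * ε) (h2 : α * δ' = β * ε') : p = q := by
  refine CProj.eq_of_pencil (fun ii => M ii.1 * P ii.2 - M ii.2 * P ii.1)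
    (fun ii => N ii.1 * P ii.2 - N ii.2 * P ii.1) (fun ii => ?_) (fun ii => ?_) h0 h1 h2
  · rw [hp, hp', hp']
    ring
  · rw [hq, hq', hq']
    ring

theorem CProj.exists_column_ne {ι : Type} {p : CProj (ι × ι)} {P : ι → ℂ} {m : ι}
    (hp : ∀ ii : ι × ι, p.rep ii = p.rep (ii.1, m) * P ii.2 - p.rep (ii.2, m) * P ii.1) :
    ∃ i, p.rep (i, m) ≠ 0 := by
  by_contra! h
  refine p.rep_nonzero ?_
  funext ii
  rw [hp, h, h]
  simp

theorem CProj.rep_diag {ι : Type} {p : CProj (ι × ι)} {P : ι → ℂ} {m : ι} (hm : P m = 1)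
    (hp : ∀ ii : ι × ι, p.rep ii = p.rep (ii.1, m) * P ii.2 - p.rep (ii.2, m) * P ii.1) :
    p.rep (m, m) = 0 := by
  have := hp (m, m)
  simp only [hm, sub_self] at this
  exact this

/-! ## The blowup of the projective plane -/

theorem planePoint_ne (c : openCubic) (a : Fin 4) : id (planePoint c) ≠ id
    ((![Projectivization.mk ℂ ![1, 0, 0] fun e => one_ne_zero (congrFun e 0),
      Projectivization.mk ℂ ![0, 1, 0] fun e => one_ne_zero (congrFun e 1),
      Projectivization.mk ℂ ![0, 0, 1] fun e => one_ne_zero (congrFun e 2),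
      Projectivization.mk ℂ ![1, 1, 1] fun e => one_ne_zero (congrFun e 0)] :
      Fin 4 → CProj (Fin 3)) a) := by
  obtain ⟨a0, a1, a01⟩ := c.2.2 0
  obtain ⟨b0, b1, -⟩ := c.2.2 1
  -- Each of the four centres violates one of these three conditions.
  have key : ∀ (p : Fin 3 → ℂ) (hp : p ≠ 0), planePoint c = Projectivization.mk ℂ p hp →
      p 0 ≠ 0 ∧ p 1 ≠ 0 ∧ p 0 ≠ p 1 := by
    intro p hp h
    obtain ⟨s, hs⟩ := (Projectivization.mk_eq_mk_iff' ℂ _ _ _ _).1 h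
    have h0 : s * p 0 = (c.1 0).rep 0 * (c.1 1).rep 0 := congrFun hs 0
    have h1 : s * p 1 = (c.1 0).rep 1 * (c.1 1).rep 0 := congrFun hs 1
    refine ⟨fun e => mul_ne_zero a0 b0 ?_, fun e => mul_ne_zero a1 b0 ?_, fun e => a01 ?_⟩
    · rw [← h0, e, mul_zero]
    · rw [← h1, e, mul_zero]
    · apply mul_right_cancel₀ b0
      rw [← h0, ← h1, e]
  fin_cases a <;> intro h <;> have := key _ _ h <;> simp at this

/-- The inclusion of the space of parameters into the blowup of the plane. -/
def BlowupP2.incl (c : openCubic) : BlowupP2 :=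
  Blowup.lift id _ (planePoint c) (planePoint_ne c)

theorem BlowupP2.denseRange_incl : DenseRange BlowupP2.incl :=
  Blowup.denseRange_lift continuous_id denseRange_planePoint _

theorem BlowupP2.rep_apply {l : Filter openCubic} [l.NeBot] {y : BlowupP2}
    (h : Tendsto BlowupP2.incl l (𝓝 y)) :
    (∀ ii, (y.1.2 0).rep ii = (y.1.2 0).rep (ii.1, 0) * (![1, 0, 0] : Fin 3 → ℂ) ii.2 -
      (y.1.2 0).rep (ii.2, 0) * (![1, 0, 0] : Fin 3 → ℂ) ii.1) ∧
    (∀ ii, (y.1.2 1).rep ii = (y.1.2 1).rep (ii.1, 1) * (![0, 1, 0] : Fin 3 → ℂ) ii.2 -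
      (y.1.2 1).rep (ii.2, 1) * (![0, 1, 0] : Fin 3 → ℂ) ii.1) ∧
    (∀ ii, (y.1.2 2).rep ii = (y.1.2 2).rep (ii.1, 2) * (![0, 0, 1] : Fin 3 → ℂ) ii.2 -
      (y.1.2 2).rep (ii.2, 2) * (![0, 0, 1] : Fin 3 → ℂ) ii.1) ∧
    (∀ ii, (y.1.2 3).rep ii = (y.1.2 3).rep (ii.1, 0) * (![1, 1, 1] : Fin 3 → ℂ) ii.2 -
      (y.1.2 3).rep (ii.2, 0) * (![1, 1, 1] : Fin 3 → ℂ) ii.1) :=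
  ⟨Blowup.rep_apply h 0 ⟨_, rfl⟩ rfl, Blowup.rep_apply h 1 ⟨_, rfl⟩ rfl,
    Blowup.rep_apply h 2 ⟨_, rfl⟩ rfl, Blowup.rep_apply h 3 ⟨_, rfl⟩ rfl⟩

/-- The first three equations read off the ratios of the coordinates of the base point. The
remaining four identify the projections from the centres with c₃, c₂, c₁ and `paramD`, in this
order. -/
theorem BlowupP2.relations {l : Filter openCubic} [l.NeBot] {z : FiveClosure} {y : BlowupP2}
    (hz : Tendsto FiveClosure.incl l (𝓝 z)) (hy : Tendsto BlowupP2.incl l (𝓝 y)) :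
    (z.1 0).rep 1 * y.1.1.rep 0 = (z.1 0).rep 0 * y.1.1.rep 1 ∧
    (z.1 1).rep 1 * y.1.1.rep 0 = (z.1 1).rep 0 * y.1.1.rep 2 ∧
    (z.1 2).rep 1 * y.1.1.rep 1 = (z.1 2).rep 0 * y.1.1.rep 2 ∧
    (z.1 2).rep 1 * (y.1.2 0).rep (1, 0) = (z.1 2).rep 0 * (y.1.2 0).rep (2, 0) ∧
    (z.1 1).rep 1 * (y.1.2 1).rep (0, 1) = (z.1 1).rep 0 * (y.1.2 1).rep (2, 1) ∧
    (z.1 0).rep 1 * (y.1.2 2).rep (0, 2) = (z.1 0).rep 0 * (y.1.2 2).rep (1, 2) ∧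
    (z.1 3).rep 1 * (y.1.2 3).rep (1, 0) = (z.1 3).rep 0 * (y.1.2 3).rep (2, 0) := by
  obtain ⟨hc, hd, -⟩ := FiveClosure.tendsto_components hz
  obtain ⟨r, -, x0, y0⟩ := CP1.exists_tendsto_mul (hc 0)
  obtain ⟨s, -, x1, y1⟩ := CP1.exists_tendsto_mul (hc 1)
  obtain ⟨t, -, x2, y2⟩ := CP1.exists_tendsto_mul (hc 2)
  obtain ⟨p, d0, d1⟩ := paramD_exists_tendsto hd
  obtain ⟨q, -, hv⟩ := exists_tendsto_smul (Blowup.tendsto_base hy) _ fun u => ⟨_, rfl⟩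
  have v0 := tendsto_component hv 0
  have v1 := tendsto_component hv 1
  have v2 := tendsto_component hv 2
  obtain ⟨f0, h0⟩ := Blowup.exists_tendsto hy 0 ⟨_, rfl⟩ _ fun u => ⟨_, rfl⟩
  obtain ⟨f1, h1⟩ := Blowup.exists_tendsto hy 1 ⟨_, rfl⟩ _ fun u => ⟨_, rfl⟩
  obtain ⟨f2, h2⟩ := Blowup.exists_tendsto hy 2 ⟨_, rfl⟩ _ fun u => ⟨_, rfl⟩
  obtain ⟨f3, h3⟩ := Blowup.exists_tendsto hy 3 ⟨_, rfl⟩ _ fun u => ⟨_, rfl⟩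
  refine ⟨?_, ?_, ?_, ?_, ?_, ?_, ?_⟩
  · exact eq_of_tendsto (y0.mul v0) (x0.mul v1) fun u => by
      simp only [Matrix.cons_val]
      ring
  · exact eq_of_tendsto (y1.mul v0) (x1.mul v2) fun u => by
      simp only [Matrix.cons_val]
      ring
  · exact eq_of_tendsto (y2.mul v1) (x2.mul v2) fun u => by
      simp only [Matrix.cons_val]
      linear_combination -(q u * t u) * openCubic_relation u
  · exact eq_of_tendsto (y2.mul (h0 1 0)) (x2.mul (h0 2 0)) fun u => by
      simp only [Matrix.cons_val]
      linear_combination -(f0 u * t u) * openCubic_relation u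
  · exact eq_of_tendsto (y1.mul (h1 0 1)) (x1.mul (h1 2 1)) fun u => by
      simp only [Matrix.cons_val]
      ring
  · exact eq_of_tendsto (y0.mul (h2 0 2)) (x0.mul (h2 1 2)) fun u => by
      simp only [Matrix.cons_val]
      ring
  · exact eq_of_tendsto (d1.mul (h3 1 0)) (d0.mul (h3 2 0)) fun u => by
      simp only [Matrix.cons_val]
      ring

/-- The homogeneous coordinates in the plane are determined by their ratios. -/
theorem planePoint_eq {p q : CProj (Fin 3)} {a b c : CP1}
    (p1 : a.rep 1 * p.rep 0 = a.rep 0 * p.rep 1) (p2 : b.rep 1 * p.rep 0 = b.rep 0 * p.rep 2)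
    (p3 : c.rep 1 * p.rep 1 = c.rep 0 * p.rep 2)
    (q1 : a.rep 1 * q.rep 0 = a.rep 0 * q.rep 1) (q2 : b.rep 1 * q.rep 0 = b.rep 0 * q.rep 2)
    (q3 : c.rep 1 * q.rep 1 = c.rep 0 * q.rep 2) : p = q := by
  have na := a.rep_ne
  have nb := b.rep_ne
  -- If `a` and `b` are both (0:1), the first coordinate vanishes and `c` gives the ratio of the
  -- others. Otherwise (a₀b₀ : a₁b₀ : a₀b₁) is a genuine point satisfying the equations for `a` and
  -- `b`.
  by_cases h : a.rep 0 = 0 ∧ b.rep 0 = 0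
  · obtain ⟨ha, hb⟩ := h
    have ha' : a.rep 1 ≠ 0 := by tauto
    have hp : p.rep 0 = 0 := by simpa [ha, ha'] using p1
    have hq : q.rep 0 = 0 := by simpa [ha, ha'] using q1
    refine CProj.eq_of_pencil ![0, 1, 0] ![0, 0, 1] (δ := p.rep 1) (ε := p.rep 2)
      (δ' := q.rep 1) (ε' := q.rep 2) ?_ ?_ c.rep_ne.symm p3 q3
    · simp [Fin.forall_fin_succ, hp]
    · simp [Fin.forall_fin_succ, hq]
  · have hn : ∃ k, (![a.rep 0 * b.rep 0, a.rep 1 * b.rep 0, a.rep 0 * b.rep 1] : Fin 3 → ℂ) k ≠ 0 := by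
      by_contra! hh
      have h0 : a.rep 0 * b.rep 0 = 0 := hh 0
      have h1 : a.rep 1 * b.rep 0 = 0 := hh 1
      have h2 : a.rep 0 * b.rep 1 = 0 := hh 2
      rw [mul_eq_zero] at h0 h1 h2
      tauto
    obtain ⟨k, hk⟩ := hn
    have key : ∀ r : CProj (Fin 3), a.rep 1 * r.rep 0 = a.rep 0 * r.rep 1 →
        b.rep 1 * r.rep 0 = b.rep 0 * r.rep 2 → ∀ i j,
        r.rep i * (![a.rep 0 * b.rep 0, a.rep 1 * b.rep 0, a.rep 0 * b.rep 1] : Fin 3 → ℂ) j =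
        r.rep j * (![a.rep 0 * b.rep 0, a.rep 1 * b.rep 0, a.rep 0 * b.rep 1] : Fin 3 → ℂ) i := by
      intro r r1 r2 i j
      fin_cases i <;> fin_cases j <;> simp <;>
        first
        | ring1
        | linear_combination b.rep 0 * r1
        | linear_combination -b.rep 0 * r1
        | linear_combination a.rep 0 * r2
        | linear_combination -a.rep 0 * r2
        | linear_combination a.rep 1 * r2 - b.rep 1 * r1
        | linear_combination b.rep 1 * r1 - a.rep 1 * r2
    exact CProj.eq_of_parallel hk (key p p1 p2) (key q q1 q2)

/-- The four projections are the first four cross-ratios, so each side determines the other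
directly; the base point follows from the ratios and the fifth cross-ratio from the first four. -/
theorem exists_homeomorph_blowupP2 :
    ∃ e : FiveClosure ≃ₜ BlowupP2, ∀ c, e (FiveClosure.incl c) = BlowupP2.incl c := by
  refine exists_homeomorph_of_denseRange FiveClosure.denseRange_incl BlowupP2.denseRange_incl
    ?_ ?_
  · intro l l' _ _ z y y' hz hy hz' hy'
    obtain ⟨a1, a2, a3, a4, a5, a6, a7⟩ := BlowupP2.relations hz hy
    obtain ⟨b1, b2, b3, b4, b5, b6, b7⟩ := BlowupP2.relations hz' hy'
    obtain ⟨p0, p1, p2, p3⟩ := BlowupP2.rep_apply hy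
    obtain ⟨q0, q1, q2, q3⟩ := BlowupP2.rep_apply hy'
    refine Subtype.ext (Prod.ext (planePoint_eq a1 a2 a3 b1 b2 b3) (funext fun i => ?_))
    fin_cases i
    · refine CProj.eq_of_column_pencil p0 q0 ![0, 1, 0] ![0, 0, 1] ?_ ?_ (z.1 2).rep_ne.symm a4 b4
      · simp [Fin.forall_fin_succ, CProj.rep_diag (by rfl) p0]
      · simp [Fin.forall_fin_succ, CProj.rep_diag (by rfl) q0]
    · refine CProj.eq_of_column_pencil p1 q1 ![1, 0, 0] ![0, 0, 1] ?_ ?_ (z.1 1).rep_ne.symm a5 b5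
      · simp [Fin.forall_fin_succ, CProj.rep_diag (by rfl) p1]
      · simp [Fin.forall_fin_succ, CProj.rep_diag (by rfl) q1]
    · refine CProj.eq_of_column_pencil p2 q2 ![1, 0, 0] ![0, 1, 0] ?_ ?_ (z.1 0).rep_ne.symm a6 b6
      · simp [Fin.forall_fin_succ, CProj.rep_diag (by rfl) p2]
      · simp [Fin.forall_fin_succ, CProj.rep_diag (by rfl) q2]
    · refine CProj.eq_of_column_pencil p3 q3 ![0, 1, 0] ![0, 0, 1] ?_ ?_ (z.1 3).rep_ne.symm a7 b7
      · simp [Fin.forall_fin_succ, CProj.rep_diag (by rfl) p3]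
      · simp [Fin.forall_fin_succ, CProj.rep_diag (by rfl) q3]
  · intro l l' _ _ z z' y hz hy hz' hy'
    obtain ⟨-, -, -, a4, a5, a6, a7⟩ := BlowupP2.relations hz hy
    obtain ⟨-, -, -, b4, b5, b6, b7⟩ := BlowupP2.relations hz' hy'
    obtain ⟨p0, p1, p2, p3⟩ := BlowupP2.rep_apply hy
    -- The determining column is non-zero and its diagonal entry vanishes, so one of the other two
    -- entries is non-zero.
    have n0 : (y.1.2 0).rep (2, 0) ≠ 0 ∨ (y.1.2 0).rep (1, 0) ≠ 0 := by
      obtain ⟨i, hi⟩ := CProj.exists_column_ne p0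
      have := CProj.rep_diag (by rfl) p0
      fin_cases i
      exacts [absurd this hi, Or.inr hi, Or.inl hi]
    have n1 : (y.1.2 1).rep (2, 1) ≠ 0 ∨ (y.1.2 1).rep (0, 1) ≠ 0 := by
      obtain ⟨i, hi⟩ := CProj.exists_column_ne p1
      have := CProj.rep_diag (by rfl) p1
      fin_cases i
      exacts [Or.inr hi, absurd this hi, Or.inl hi]
    have n2 : (y.1.2 2).rep (1, 2) ≠ 0 ∨ (y.1.2 2).rep (0, 2) ≠ 0 := by
      obtain ⟨i, hi⟩ := CProj.exists_column_ne p2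
      have := CProj.rep_diag (by rfl) p2
      fin_cases i
      exacts [Or.inr hi, Or.inl hi, absurd this hi]
    have n3 : (y.1.2 3).rep (2, 0) ≠ 0 ∨ (y.1.2 3).rep (1, 0) ≠ 0 := by
      obtain ⟨i, hi⟩ := CProj.exists_column_ne p3
      have := CProj.rep_diag (by rfl) p3
      fin_cases i
      exacts [absurd this hi, Or.inr hi, Or.inl hi]
    exact FiveClosure.ext_of_four hz hz'
      (CP1.eq_of_linear n2 (by linear_combination -a6) (by linear_combination -b6))
      (CP1.eq_of_linear n1 (by linear_combination -a5) (by linear_combination -b5))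
      (CP1.eq_of_linear n0 (by linear_combination -a4) (by linear_combination -b4))
      (CP1.eq_of_linear n3 (by linear_combination -a7) (by linear_combination -b7))

/-- Outside of the centre the exceptional factor is determined by the base point. -/
theorem Blowup.snd_eq_of_ne {U X ι : Type} [TopologicalSpace X] {j : X → CProj ι}
    (hj : Continuous j) {k : ℕ} {s : Fin k → X} {l l' : Filter U} [l.NeBot] [l'.NeBot] {f : U → X}
    {hf : ∀ u a, j (f u) ≠ j (s a)} {y y' : Blowup j s}
    (h : Tendsto (fun u => Blowup.lift j s (f u) (hf u)) l (𝓝 y))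
    (h' : Tendsto (fun u => Blowup.lift j s (f u) (hf u)) l' (𝓝 y')) (hy : y.1.1 = y'.1.1)
    (a : Fin k) (ha : j y.1.1 ≠ j (s a)) : y.1.2 a = y'.1.2 a := by
  have key : ∀ {l : Filter U} [l.NeBot] {y : Blowup j s},
      Tendsto (fun u => Blowup.lift j s (f u) (hf u)) l (𝓝 y) → ∀ ii jj,
      (y.1.2 a).rep ii * wedgeVec (j (s a)).rep (j y.1.1).rep jj =
        (y.1.2 a).rep jj * wedgeVec (j (s a)).rep (j y.1.1).rep ii := by
    intro l _ y h ii jj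
    obtain ⟨r, hr⟩ := Blowup.exists_tendsto h a ⟨_, (j (s a)).mk_rep.symm⟩
      (fun u => (j (f u)).rep) fun u => ⟨_, (j (f u)).mk_rep.symm⟩
    obtain ⟨q, -, hq⟩ := exists_tendsto_smul_rep ((hj.tendsto _).comp (Blowup.tendsto_base h))
    have hw := tendsto_pi_nhds.1 (((continuous_wedgeVec (j (s a)).rep).tendsto _).comp hq)
    exact eq_of_tendsto ((hr ii.1 ii.2).mul (hw jj)) ((hr jj.1 jj.2).mul (hw ii)) fun u => by
      simp only [Function.comp_apply, wedgeVec, Pi.smul_apply, smul_eq_mul]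
      ring
  -- Both factors are parallel to the wedge of the centre with the common base point, which is
  -- non-zero off the centre.
  obtain ⟨ii, hii⟩ := Function.ne_iff.1 (wedgeVec_ne_zero ha)
  refine CProj.eq_of_parallel hii (key h) ?_
  rw [hy]
  exact key h'

/-! ### Explicit representatives for Segre images and the special points of the line -/

theorem segre_eq_mk {m : ℕ} {c : Fin m → CP1} {v : Fin m → Fin 2 → ℂ}
    (h : ∀ i, ∃ hi, c i = Projectivization.mk ℂ (v i) hi) :
    ∃ hv, segre c = Projectivization.mk ℂ (tensorVec v) hv := by
  choose hi e using h
  choose s hs es using fun i => CProj.rep_mk (v i) (hi i)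
  refine ⟨tensorVec_ne_zero v hi, (Projectivization.mk_eq_mk_iff' ℂ _ _ _ _).2 ⟨∏ i, s i, ?_⟩⟩
  funext a
  simp only [tensorVec, Pi.smul_apply, smul_eq_mul, ← Finset.prod_mul_distrib]
  refine Finset.prod_congr rfl fun i _ => ?_
  rw [e, es]
  rfl

theorem CP1.inf_rep : CP1.inf.rep 0 ≠ 0 ∧ CP1.inf.rep 1 = 0 := by
  obtain ⟨u, hu, h0, h1⟩ := CP1.pt_rep 1 0 (pair_ne_zero one_ne_zero)
  refine ⟨?_, ?_⟩
  · rw [CP1.inf, h0]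
    simpa using hu
  · rw [CP1.inf, h1, mul_zero]

theorem CP1.zero_rep : CP1.zero.rep 0 = 0 ∧ CP1.zero.rep 1 ≠ 0 := by
  obtain ⟨u, hu, h0, h1⟩ := CP1.pt_rep 0 1 fun e => one_ne_zero (congrFun e 1)
  refine ⟨?_, ?_⟩
  · rw [CP1.zero, h0, mul_zero]
  · rw [CP1.zero, h1]
    simpa using hu

theorem CP1.one_rep : CP1.one.rep 0 = CP1.one.rep 1 ∧ CP1.one.rep 1 ≠ 0 := by
  obtain ⟨u, hu, h0, h1⟩ := CP1.pt_rep 1 1 (pair_ne_zero one_ne_zero)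
  refine ⟨?_, ?_⟩
  · rw [CP1.one, h0, h1]
  · rw [CP1.one, h1]
    simpa using hu

theorem forall_fin_two_fun {P : (Fin 2 → Fin 2) → Prop} : (∀ e, P e) ↔ ∀ i j, P ![i, j] := by
  refine ⟨fun h i j => h _, fun h e => ?_⟩
  have : e = ![e 0, e 1] := by
    funext i
    fin_cases i <;> rfl
  rw [this]
  exact h _ _

theorem forall_fin_three_fun {P : (Fin 3 → Fin 2) → Prop} :
    (∀ e, P e) ↔ ∀ i j k, P ![i, j, k] := by
  refine ⟨fun h i j k => h _, fun h e => ?_⟩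
  have : e = ![e 0, e 1, e 2] := by
    funext i
    fin_cases i <;> rfl
  rw [this]
  exact h _ _ _

/-! ## The blowup of the product of two projective lines -/

theorem twoParam_ne (c : openCubic) (a : Fin 3) : segre (twoParam c) ≠
    segre ((![fun _ => CP1.inf, fun _ => CP1.zero, fun _ => CP1.one] : Fin 3 → Fin 2 → CP1) a) := by
  intro h
  obtain ⟨a0, a1, a01⟩ := c.2.2 0
  have h0 := congrFun (segre_injective h) 0
  have e : twoParam c 0 = c.1 0 := rfl
  rw [e] at h0
  rw [h0] at a0 a1 a01
  fin_cases a
  · exact a1 CP1.inf_rep.2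
  · exact a0 CP1.zero_rep.1
  · exact a01 CP1.one_rep.1

/-- The inclusion of the space of parameters into the blowup of `CP¹ × CP¹`. -/
def BlowupP1P1.incl (c : openCubic) : BlowupP1P1 :=
  Blowup.lift segre _ (twoParam c) (twoParam_ne c)

theorem BlowupP1P1.denseRange_incl : DenseRange BlowupP1P1.incl :=
  Blowup.denseRange_lift continuous_segre denseRange_twoParam _

theorem segre_inf : ∃ h, segre (fun _ : Fin 2 => CP1.inf) =
    Projectivization.mk ℂ (tensorVec fun _ => ![1, 0]) h := segre_eq_mk fun _ => ⟨_, rfl⟩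

theorem segre_zero : ∃ h, segre (fun _ : Fin 2 => CP1.zero) =
    Projectivization.mk ℂ (tensorVec fun _ => ![0, 1]) h := segre_eq_mk fun _ => ⟨_, rfl⟩

theorem segre_one (m : ℕ) : ∃ h, segre (fun _ : Fin m => CP1.one) =
    Projectivization.mk ℂ (tensorVec fun _ => ![1, 1]) h := segre_eq_mk fun _ => ⟨_, rfl⟩

theorem BlowupP1P1.rep_apply {l : Filter openCubic} [l.NeBot] {y : BlowupP1P1}
    (h : Tendsto BlowupP1P1.incl l (𝓝 y)) :
    (∀ ii, (y.1.2 0).rep ii = (y.1.2 0).rep (ii.1, ![0, 0]) * tensorVec (fun _ => ![1, 0]) ii.2 -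
      (y.1.2 0).rep (ii.2, ![0, 0]) * tensorVec (fun _ => ![1, 0]) ii.1) ∧
    (∀ ii, (y.1.2 1).rep ii = (y.1.2 1).rep (ii.1, ![1, 1]) * tensorVec (fun _ => ![0, 1]) ii.2 -
      (y.1.2 1).rep (ii.2, ![1, 1]) * tensorVec (fun _ => ![0, 1]) ii.1) ∧
    (∀ ii, (y.1.2 2).rep ii = (y.1.2 2).rep (ii.1, ![0, 0]) * tensorVec (fun _ => ![1, 1]) ii.2 -
      (y.1.2 2).rep (ii.2, ![0, 0]) * tensorVec (fun _ => ![1, 1]) ii.1) :=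
  ⟨Blowup.rep_apply h 0 segre_inf (by simp [tensorVec]),
    Blowup.rep_apply h 1 segre_zero (by simp [tensorVec]),
    Blowup.rep_apply h 2 (segre_one 2) (by simp [tensorVec])⟩

theorem BlowupP1P1.base_eq {l : Filter openCubic} [l.NeBot] {z : FiveClosure} {y : BlowupP1P1}
    (hz : Tendsto FiveClosure.incl l (𝓝 z)) (hy : Tendsto BlowupP1P1.incl l (𝓝 y)) :
    y.1.1 = ![z.1 0, z.1 1] := by
  have h := tendsto_pi_nhds.1 (Blowup.tendsto_base hy)
  have hc := (FiveClosure.tendsto_components hz).1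
  funext i
  fin_cases i
  · exact tendsto_nhds_unique (h 0) (hc 0)
  · exact tendsto_nhds_unique (h 1) (hc 1)

/-- The first, third and fifth relations express c₃, c₃ and `paramD` through the exceptional factors
over the three centres. The other three cut the column down to a two-dimensional space near the
corresponding centre. -/
theorem BlowupP1P1.relations {l : Filter openCubic} [l.NeBot] {z : FiveClosure} {y : BlowupP1P1}
    (hz : Tendsto FiveClosure.incl l (𝓝 z)) (hy : Tendsto BlowupP1P1.incl l (𝓝 y)) :
    ((z.1 2).rep 0 * (y.1.2 0).rep (![0, 1], ![0, 0]) =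
      (z.1 2).rep 1 * (y.1.2 0).rep (![1, 0], ![0, 0])) ∧
    ((z.1 1).rep 0 * (y.1.2 0).rep (![1, 1], ![0, 0]) =
      (z.1 1).rep 1 * (y.1.2 0).rep (![1, 0], ![0, 0])) ∧
    ((z.1 2).rep 0 * (y.1.2 1).rep (![0, 1], ![1, 1]) =
      (z.1 2).rep 1 * (y.1.2 1).rep (![1, 0], ![1, 1])) ∧
    ((z.1 1).rep 1 * (y.1.2 1).rep (![0, 0], ![1, 1]) =
      (z.1 1).rep 0 * (y.1.2 1).rep (![0, 1], ![1, 1])) ∧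
    ((z.1 3).rep 0 * (y.1.2 2).rep (![0, 1], ![0, 0]) =
      (z.1 3).rep 1 * (y.1.2 2).rep (![1, 0], ![0, 0])) ∧
    ((z.1 0).rep 1 * (y.1.2 2).rep (![0, 1], ![0, 0]) =
      (z.1 0).rep 0 * ((y.1.2 2).rep (![1, 1], ![0, 0]) -
        (y.1.2 2).rep (![1, 0], ![0, 0]))) := by
  obtain ⟨hc, hd, -⟩ := FiveClosure.tendsto_components hz
  obtain ⟨r, -, x0, y0⟩ := CP1.exists_tendsto_mul (hc 0)
  obtain ⟨s, -, x1, y1⟩ := CP1.exists_tendsto_mul (hc 1)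
  obtain ⟨t, -, x2, y2⟩ := CP1.exists_tendsto_mul (hc 2)
  obtain ⟨p, d0, d1⟩ := paramD_exists_tendsto hd
  obtain ⟨f0, h0⟩ := Blowup.exists_tendsto hy 0 segre_inf _ fun u => ⟨_, rfl⟩
  obtain ⟨f1, h1⟩ := Blowup.exists_tendsto hy 1 segre_zero _ fun u => ⟨_, rfl⟩
  obtain ⟨f2, h2⟩ := Blowup.exists_tendsto hy 2 (segre_one 2) _ fun u => ⟨_, rfl⟩
  refine ⟨?_, ?_, ?_, ?_, ?_, ?_⟩
  · refine eq_of_tendsto (x2.mul (h0 ![0, 1] ![0, 0])) (y2.mul (h0 ![1, 0] ![0, 0])) fun u => ?_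
    simp [tensorVec, twoParam]
    linear_combination (f0 u * t u) * openCubic_relation u
  · refine eq_of_tendsto (x1.mul (h0 ![1, 1] ![0, 0])) (y1.mul (h0 ![1, 0] ![0, 0])) fun u => ?_
    simp [tensorVec, twoParam]
    ring
  · refine eq_of_tendsto (x2.mul (h1 ![0, 1] ![1, 1])) (y2.mul (h1 ![1, 0] ![1, 1])) fun u => ?_
    simp [tensorVec, twoParam]
    linear_combination (f1 u * t u) * openCubic_relation u
  · refine eq_of_tendsto (y1.mul (h1 ![0, 0] ![1, 1])) (x1.mul (h1 ![0, 1] ![1, 1])) fun u => ?_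
    simp [tensorVec, twoParam]
    ring
  · refine eq_of_tendsto (d0.mul (h2 ![0, 1] ![0, 0])) (d1.mul (h2 ![1, 0] ![0, 0])) fun u => ?_
    simp [tensorVec, twoParam]
    ring
  · refine eq_of_tendsto (y0.mul (h2 ![0, 1] ![0, 0]))
      (x0.mul ((h2 ![1, 1] ![0, 0]).sub (h2 ![1, 0] ![0, 0]))) fun u => ?_
    simp [tensorVec, twoParam]
    ring

theorem exists_homeomorph_blowupP1P1 :
    ∃ e : FiveClosure ≃ₜ BlowupP1P1, ∀ c, e (FiveClosure.incl c) = BlowupP1P1.incl c := by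
  -- the columns of the representatives over the three centres
  have col0 : ∀ {l : Filter openCubic} [l.NeBot] {z : FiveClosure} {y : BlowupP1P1},
      Tendsto FiveClosure.incl l (𝓝 z) → Tendsto BlowupP1P1.incl l (𝓝 y) → (z.1 1).rep 1 = 0 →
      ∀ e, (y.1.2 0).rep (e, ![0, 0]) =
        (if e 0 = 1 ∧ e 1 = 0 then 0 else if e 0 = 0 ∧ e 1 = 1 then 1 else 0) *
          (y.1.2 0).rep (![0, 1], ![0, 0]) +
        (if e 0 = 1 ∧ e 1 = 0 then 1 else 0) * (y.1.2 0).rep (![1, 0], ![0, 0]) := by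
    intro l _ z y hz hy h1
    have hx : (z.1 1).rep 0 ≠ 0 := by
      have := (z.1 1).rep_ne
      tauto
    have e1 := CProj.rep_diag (by simp [tensorVec]) (BlowupP1P1.rep_apply hy).1
    have e2 : (y.1.2 0).rep (![1, 1], ![0, 0]) = 0 := by
      simpa [h1, hx] using (BlowupP1P1.relations hz hy).2.1
    rw [forall_fin_two_fun]
    simp only [Fin.forall_fin_two, e1, e2]
    simp
  have col1 : ∀ {l : Filter openCubic} [l.NeBot] {z : FiveClosure} {y : BlowupP1P1},
      Tendsto FiveClosure.incl l (𝓝 z) → Tendsto BlowupP1P1.incl l (𝓝 y) → (z.1 1).rep 0 = 0 →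
      ∀ e, (y.1.2 1).rep (e, ![1, 1]) =
        (if e 0 = 1 ∧ e 1 = 0 then 0 else if e 0 = 0 ∧ e 1 = 1 then 1 else 0) *
          (y.1.2 1).rep (![0, 1], ![1, 1]) +
        (if e 0 = 1 ∧ e 1 = 0 then 1 else 0) * (y.1.2 1).rep (![1, 0], ![1, 1]) := by
    intro l _ z y hz hy h1
    have hx : (z.1 1).rep 1 ≠ 0 := by
      have := (z.1 1).rep_ne
      tauto
    have e1 := CProj.rep_diag (by simp [tensorVec]) (BlowupP1P1.rep_apply hy).2.1
    have e2 : (y.1.2 1).rep (![0, 0], ![1, 1]) = 0 := by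
      simpa [h1, hx] using (BlowupP1P1.relations hz hy).2.2.2.1
    rw [forall_fin_two_fun]
    simp only [Fin.forall_fin_two, e1, e2]
    simp
  have col2 : ∀ {l : Filter openCubic} [l.NeBot] {z : FiveClosure} {y : BlowupP1P1},
      Tendsto FiveClosure.incl l (𝓝 z) → Tendsto BlowupP1P1.incl l (𝓝 y) →
      (z.1 0).rep 0 = (z.1 0).rep 1 → ∀ e, (y.1.2 2).rep (e, ![0, 0]) =
        (if e 1 = 1 then 1 else 0) * (y.1.2 2).rep (![0, 1], ![0, 0]) +
        (if e 0 = 1 then 1 else 0) * (y.1.2 2).rep (![1, 0], ![0, 0]) := by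
    intro l _ z y hz hy h1
    have hx : (z.1 0).rep 1 ≠ 0 := by
      have := (z.1 0).rep_ne
      rw [h1] at this
      tauto
    have e1 := CProj.rep_diag (by simp [tensorVec]) (BlowupP1P1.rep_apply hy).2.2
    have e2 : (y.1.2 2).rep (![1, 1], ![0, 0]) =
        (y.1.2 2).rep (![0, 1], ![0, 0]) + (y.1.2 2).rep (![1, 0], ![0, 0]) := by
      have := (BlowupP1P1.relations hz hy).2.2.2.2.2
      rw [h1] at this
      linear_combination -mul_left_cancel₀ hx this
    rw [forall_fin_two_fun]
    simp only [Fin.forall_fin_two, e1, e2]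
    simp
  -- A non-zero column forces the two entries spanning it not to vanish simultaneously.
  have ne_of : ∀ {κ : Type} {p : CProj (κ × κ)} {m : κ} {M N : κ → ℂ} {δ ε : ℂ},
      (∃ i, p.rep (i, m) ≠ 0) → (∀ i, p.rep (i, m) = M i * δ + N i * ε) → δ ≠ 0 ∨ ε ≠ 0 := by
    rintro κ p m M N δ ε ⟨i, hi⟩ h
    by_contra! hh
    apply hi
    rw [h, hh.1, hh.2]
    simp
  refine exists_homeomorph_of_denseRange FiveClosure.denseRange_incl BlowupP1P1.denseRange_incl
    ?_ ?_
  · intro l l' _ _ z y y' hz hy hz' hy'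
    obtain ⟨a1, -, a3, -, a5, -⟩ := BlowupP1P1.relations hz hy
    obtain ⟨b1, -, b3, -, b5, -⟩ := BlowupP1P1.relations hz' hy'
    obtain ⟨p0, p1, p2⟩ := BlowupP1P1.rep_apply hy
    obtain ⟨q0, q1, q2⟩ := BlowupP1P1.rep_apply hy'
    have hb := BlowupP1P1.base_eq hz hy
    have hbb : y.1.1 = y'.1.1 := hb.trans (BlowupP1P1.base_eq hz' hy').symm
    refine Subtype.ext (Prod.ext hbb (funext fun i => ?_))
    by_cases hi : segre y.1.1 = segre
        ((![fun _ => CP1.inf, fun _ => CP1.zero, fun _ => CP1.one] : Fin 3 → Fin 2 → CP1) i)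
    · have hy1 := hb.symm.trans (segre_injective hi)
      have h0 : z.1 0 = _ := congrFun hy1 0
      have h1 : z.1 1 = _ := congrFun hy1 1
      fin_cases i
      · have h1 : (z.1 1).rep 1 = 0 := by
          rw [h1]
          exact CP1.inf_rep.2
        exact CProj.eq_of_column_pencil p0 q0 _ _ (col0 hz hy h1) (col0 hz' hy' h1)
          (z.1 2).rep_ne a1 b1
      · have h1 : (z.1 1).rep 0 = 0 := by
          rw [h1]
          exact CP1.zero_rep.1
        exact CProj.eq_of_column_pencil p1 q1 _ _ (col1 hz hy h1) (col1 hz' hy' h1)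
          (z.1 2).rep_ne a3 b3
      · have h0 : (z.1 0).rep 0 = (z.1 0).rep 1 := by
          rw [h0]
          exact CP1.one_rep.1
        exact CProj.eq_of_column_pencil p2 q2 _ _ (col2 hz hy h0) (col2 hz' hy' h0)
          (z.1 3).rep_ne a5 b5
    · exact Blowup.snd_eq_of_ne continuous_segre hy hy' hbb i hi
  · intro l l' _ _ z z' y hz hy hz' hy'
    obtain ⟨a1, -, a3, -, a5, -⟩ := BlowupP1P1.relations hz hy
    obtain ⟨b1, -, b3, -, b5, -⟩ := BlowupP1P1.relations hz' hy'
    obtain ⟨p0, p1, p2⟩ := BlowupP1P1.rep_apply hy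
    have hb := (BlowupP1P1.base_eq hz hy).symm.trans (BlowupP1P1.base_eq hz' hy')
    have h0 : z.1 0 = z'.1 0 := congrFun hb 0
    have h1 : z.1 1 = z'.1 1 := congrFun hb 1
    have a0 := (FiveClosure.relations hz).1
    have b0 := (FiveClosure.relations hz').1
    simp only [← h0, ← h1] at b0
    have n0 := (z.1 0).rep_ne
    have n1 := (z.1 1).rep_ne
    -- If c₂ is neither (0:1) nor (1:0), the cubic equation determines c₃; on these two lines the
    -- exceptional factor over the centre lying there does.
    have h2 : z.1 2 = z'.1 2 := by
      by_cases hx : (z.1 1).rep 0 = 0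
      · exact CP1.eq_of_linear
          (ne_of (CProj.exists_column_ne p1) (col1 hz hy hx))
          (by linear_combination a3) (by linear_combination b3)
      by_cases hy1 : (z.1 1).rep 1 = 0
      · exact CP1.eq_of_linear
          (ne_of (CProj.exists_column_ne p0) (col0 hz hy hy1))
          (by linear_combination a1) (by linear_combination b1)
      · refine CP1.eq_of_linear ?_ a0 b0
        simp only [ne_eq, mul_eq_zero]
        tauto
    have h3 : z.1 3 = z'.1 3 := by
      by_cases hne : (z.1 0).rep 0 ≠ (z.1 0).rep 1 ∨ (z.1 1).rep 0 ≠ (z.1 1).rep 1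
      · exact FiveClosure.fourth_eq hz hz' h0 h1 h2 hne
      · push Not at hne
        exact CP1.eq_of_linear
          (ne_of (CProj.exists_column_ne p2) (col2 hz hy hne.1))
          (by linear_combination a5) (by linear_combination b5)
    exact FiveClosure.ext_of_four hz hz' h0 h1 h2 h3

/-! ## The blowup of the cubic surface -/

theorem continuous_cubicEmb : Continuous cubicEmb := continuous_segre.comp continuous_subtype_val

theorem FTilde.denseRange_incl : DenseRange FTilde.incl :=
  Blowup.denseRange_lift continuous_cubicEmb denseRange_openCubic openCubic_ne_center

theorem FTilde.isEmbedding_incl : IsEmbedding FTilde.incl := by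
  have hc : Continuous FTilde.incl := by
    rw [continuous_iff_continuousAt]
    intro c
    have : Continuous fun c : openCubic => (⟨c.1, c.2.1⟩ : cubicSurface) :=
      continuous_subtype_val.subtype_mk _
    exact Blowup.tendsto_lift continuous_cubicEmb (this.tendsto c) openCubic_ne_center
      (openCubic_ne_center c)
  have hp : Continuous fun y : FTilde => y.1.1.1 :=
    continuous_subtype_val.comp (continuous_fst.comp continuous_subtype_val)
  -- Projecting to the base gives back the subspace inclusion of F.
  exact IsEmbedding.of_comp hc hp IsEmbedding.subtypeVal

/-- Any column would do, the centre having all coordinates 1. The one at 010 is convenient because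
the cubic equation makes the Segre coordinates at 010 and 101 equal, so the entry (101, 010)
vanishes. -/
theorem FTilde.rep_apply {l : Filter openCubic} [l.NeBot] {y : FTilde}
    (h : Tendsto FTilde.incl l (𝓝 y)) (ii : (Fin 3 → Fin 2) × (Fin 3 → Fin 2)) :
    (y.1.2 0).rep ii = (y.1.2 0).rep (ii.1, ![0, 1, 0]) * tensorVec (fun _ => ![1, 1]) ii.2 -
      (y.1.2 0).rep (ii.2, ![0, 1, 0]) * tensorVec (fun _ => ![1, 1]) ii.1 :=
  Blowup.rep_apply h 0 (segre_one 3) (by simp [tensorVec, Fin.prod_univ_three]) ii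

theorem FTilde.base_eq {l : Filter openCubic} [l.NeBot] {z : FiveClosure} {y : FTilde}
    (hz : Tendsto FiveClosure.incl l (𝓝 z)) (hy : Tendsto FTilde.incl l (𝓝 y)) :
    y.1.1.1 = ![z.1 0, z.1 1, z.1 2] := by
  have h := tendsto_pi_nhds.1 (tendsto_subtype_rng.1 (Blowup.tendsto_base hy))
  have hc := (FiveClosure.tendsto_components hz).1
  funext i
  fin_cases i
  · exact tendsto_nhds_unique (h 0) (hc 0)
  · exact tendsto_nhds_unique (h 1) (hc 1)
  · exact tendsto_nhds_unique (h 2) (hc 2)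

theorem FTilde.relations {l : Filter openCubic} [l.NeBot] {z : FiveClosure} {y : FTilde}
    (hz : Tendsto FiveClosure.incl l (𝓝 z)) (hy : Tendsto FTilde.incl l (𝓝 y)) :
    ((z.1 0).rep 1 * (y.1.2 0).rep (![0, 0, 1], ![0, 1, 0]) =
      -((z.1 0).rep 0 * (y.1.2 0).rep (![1, 1, 0], ![0, 1, 0]))) ∧
    ((z.1 2).rep 1 * ((y.1.2 0).rep (![0, 0, 0], ![0, 1, 0]) -
      (y.1.2 0).rep (![1, 0, 0], ![0, 1, 0])) =
      (z.1 2).rep 0 * (y.1.2 0).rep (![0, 0, 1], ![0, 1, 0])) ∧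
    ((z.1 1).rep 1 * (y.1.2 0).rep (![0, 0, 0], ![0, 1, 0]) =
      -((z.1 1).rep 0 * (y.1.2 0).rep (![1, 1, 1], ![0, 1, 0]))) ∧
    ((z.1 2).rep 1 * (y.1.2 0).rep (![0, 0, 0], ![0, 1, 0]) =
      (z.1 2).rep 0 * ((y.1.2 0).rep (![0, 0, 1], ![0, 1, 0]) -
      (y.1.2 0).rep (![0, 1, 1], ![0, 1, 0]))) ∧
    ((z.1 3).rep 0 * (y.1.2 0).rep (![0, 0, 0], ![0, 1, 0]) =
      (z.1 3).rep 1 * ((y.1.2 0).rep (![0, 0, 0], ![0, 1, 0]) -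
      (y.1.2 0).rep (![1, 0, 0], ![0, 1, 0]))) ∧
    (y.1.2 0).rep (![1, 0, 1], ![0, 1, 0]) = 0 := by
  obtain ⟨hc, hd, -⟩ := FiveClosure.tendsto_components hz
  obtain ⟨r, -, x0, y0⟩ := CP1.exists_tendsto_mul (hc 0)
  obtain ⟨s, -, x1, y1⟩ := CP1.exists_tendsto_mul (hc 1)
  obtain ⟨t, -, x2, y2⟩ := CP1.exists_tendsto_mul (hc 2)
  obtain ⟨p, d0, d1⟩ := paramD_exists_tendsto hd
  obtain ⟨f, h⟩ := Blowup.exists_tendsto hy 0 (segre_one 3) _ fun u => ⟨_, rfl⟩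
  refine ⟨?_, ?_, ?_, ?_, ?_, ?_⟩
  · refine eq_of_tendsto (y0.mul (h ![0, 0, 1] ![0, 1, 0]))
      (x0.mul (h ![1, 1, 0] ![0, 1, 0])).neg fun u => ?_
    simp [tensorVec, Fin.prod_univ_three]
    linear_combination -(f u * r u * (u.1 0).rep 0) * openCubic_relation u
  · refine eq_of_tendsto (y2.mul ((h ![0, 0, 0] ![0, 1, 0]).sub (h ![1, 0, 0] ![0, 1, 0])))
      (x2.mul (h ![0, 0, 1] ![0, 1, 0])) fun u => ?_
    simp [tensorVec, Fin.prod_univ_three]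
    linear_combination (f u * t u * (u.1 2).rep 0) * openCubic_relation u
  · refine eq_of_tendsto (y1.mul (h ![0, 0, 0] ![0, 1, 0]))
      (x1.mul (h ![1, 1, 1] ![0, 1, 0])).neg fun u => ?_
    simp [tensorVec, Fin.prod_univ_three]
    linear_combination -(f u * s u * (u.1 1).rep 1) * openCubic_relation u
  · refine eq_of_tendsto (y2.mul (h ![0, 0, 0] ![0, 1, 0]))
      (x2.mul ((h ![0, 0, 1] ![0, 1, 0]).sub (h ![0, 1, 1] ![0, 1, 0]))) fun u => ?_
    simp [tensorVec, Fin.prod_univ_three]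
    ring
  · refine eq_of_tendsto (d0.mul (h ![0, 0, 0] ![0, 1, 0]))
      (d1.mul ((h ![0, 0, 0] ![0, 1, 0]).sub (h ![1, 0, 0] ![0, 1, 0]))) fun u => ?_
    simp [tensorVec, Fin.prod_univ_three]
    ring
  · refine eq_of_tendsto (h ![1, 0, 1] ![0, 1, 0]) tendsto_const_nhds fun u => ?_
    simp [tensorVec, Fin.prod_univ_three]
    right
    linear_combination -openCubic_relation u

/-- Over the centre, the exceptional factor lies on a line. -/
theorem FTilde.column {l : Filter openCubic} [l.NeBot] {z : FiveClosure} {y : FTilde}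
    (hz : Tendsto FiveClosure.incl l (𝓝 z)) (hy : Tendsto FTilde.incl l (𝓝 y))
    (h0 : (z.1 0).rep 0 = (z.1 0).rep 1) (h1 : (z.1 1).rep 0 = (z.1 1).rep 1)
    (h2 : (z.1 2).rep 0 = (z.1 2).rep 1) :
    (∀ e : Fin 3 → Fin 2, (y.1.2 0).rep (e, ![0, 1, 0]) =
      ((if e 2 = 1 then 1 else 0) - (if e 0 = 1 then 1 else 0)) *
        (y.1.2 0).rep (![0, 0, 1], ![0, 1, 0]) +
      (1 - (if e 1 = 1 then 1 else 0) - (if e 2 = 1 then 1 else 0)) *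
        (y.1.2 0).rep (![0, 0, 0], ![0, 1, 0])) ∧
    (z.1 3).rep 1 * (y.1.2 0).rep (![0, 0, 1], ![0, 1, 0]) =
      (z.1 3).rep 0 * (y.1.2 0).rep (![0, 0, 0], ![0, 1, 0]) := by
  obtain ⟨a1, a2, a3, a4, a5, a6⟩ := FTilde.relations hz hy
  have n0 : (z.1 0).rep 1 ≠ 0 := by
    have := (z.1 0).rep_ne
    rw [h0] at this
    tauto
  have n1 : (z.1 1).rep 1 ≠ 0 := by
    have := (z.1 1).rep_ne
    rw [h1] at this
    tauto
  have n2 : (z.1 2).rep 1 ≠ 0 := by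
    have := (z.1 2).rep_ne
    rw [h2] at this
    tauto
  rw [h0, ← mul_neg] at a1
  rw [h2] at a2 a4
  rw [h1, ← mul_neg] at a3
  -- Over (1:1) the two coordinates of each parameter are equal and cancel. The resulting linear
  -- relations reflect that, to first order at the centre, Segre coordinates are affine in the index
  -- `e`, with slopes tied by the cubic equation; two free entries remain.
  have c1 := mul_left_cancel₀ n0 a1
  have c2 := mul_left_cancel₀ n2 a2
  have c3 := mul_left_cancel₀ n1 a3
  have c4 := mul_left_cancel₀ n2 a4
  have c5 := CProj.rep_diag (by simp [tensorVec, Fin.prod_univ_three]) (FTilde.rep_apply hy)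
  refine ⟨?_, ?_⟩
  · rw [forall_fin_three_fun]
    simp only [Fin.forall_fin_two, Matrix.cons_val, a6, c5]
    norm_num
    refine ⟨?_, ?_, ?_⟩
    · linear_combination c4
    · linear_combination -c2
    · constructor
      · linear_combination c1
      · linear_combination c3
  · linear_combination -a5 - (z.1 3).rep 1 * c2

/-- Off the centre the base point determines both the exceptional factor and `paramD`. Over the
centre, `paramD` is a coordinate on the exceptional line. -/
theorem exists_homeomorph_fTilde :
    ∃ e : FiveClosure ≃ₜ FTilde, ∀ c, e (FiveClosure.incl c) = FTilde.incl c := by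
  refine exists_homeomorph_of_denseRange FiveClosure.denseRange_incl FTilde.denseRange_incl
    ?_ ?_
  · intro l l' _ _ z y y' hz hy hz' hy'
    have hb := FTilde.base_eq hz hy
    have hbb : y.1.1 = y'.1.1 := Subtype.ext (hb.trans (FTilde.base_eq hz' hy').symm)
    refine Subtype.ext (Prod.ext hbb (funext fun i => ?_))
    fin_cases i
    by_cases hi : cubicEmb y.1.1 = cubicEmb cubicCenter
    · have hy1 := hb.symm.trans (segre_injective hi)
      have e : ∀ x : CP1, x = CP1.one → x.rep 0 = x.rep 1 := by
        rintro _ rfl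
        exact CP1.one_rep.1
      have h0 := e (z.1 0) (congrFun hy1 0)
      have h1 := e (z.1 1) (congrFun hy1 1)
      have h2 := e (z.1 2) (congrFun hy1 2)
      obtain ⟨a1, a2⟩ := FTilde.column hz hy h0 h1 h2
      obtain ⟨b1, b2⟩ := FTilde.column hz' hy' h0 h1 h2
      exact CProj.eq_of_column_pencil (FTilde.rep_apply hy) (FTilde.rep_apply hy') _ _ a1 b1
        (z.1 3).rep_ne.symm a2 b2
    · exact Blowup.snd_eq_of_ne continuous_cubicEmb hy hy' hbb 0 hi
  · intro l l' _ _ z z' y hz hy hz' hy'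
    have hb := (FTilde.base_eq hz hy).symm.trans (FTilde.base_eq hz' hy')
    have h0 : z.1 0 = z'.1 0 := congrFun hb 0
    have h1 : z.1 1 = z'.1 1 := congrFun hb 1
    have h2 : z.1 2 = z'.1 2 := congrFun hb 2
    have h3 : z.1 3 = z'.1 3 := by
      by_cases hne : (z.1 0).rep 0 ≠ (z.1 0).rep 1 ∨ (z.1 1).rep 0 ≠ (z.1 1).rep 1
      · exact FiveClosure.fourth_eq hz hz' h0 h1 h2 hne
      · push Not at hne
        obtain ⟨e0, e1⟩ := hne
        have n0 := (z.1 0).rep_ne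
        have n1 := (z.1 1).rep_ne
        have e2 : (z.1 2).rep 0 = (z.1 2).rep 1 := by
          have := (FiveClosure.relations hz).1
          rw [e0, e1] at this
          rw [e0] at n0
          rw [e1] at n1
          exact mul_left_cancel₀ (mul_ne_zero (by tauto) (by tauto)) this
        obtain ⟨a1, a2⟩ := FTilde.column hz hy e0 e1 e2
        obtain ⟨b1, b2⟩ := FTilde.column hz' hy' (h0 ▸ e0) (h1 ▸ e1) (h2 ▸ e2)
        refine CP1.eq_of_linear (α := (y.1.2 0).rep (![0, 0, 0], ![0, 1, 0]))
          (β := (y.1.2 0).rep (![0, 0, 1], ![0, 1, 0])) ?_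
          (by linear_combination -a2) (by linear_combination -b2)
        obtain ⟨i, hi⟩ := CProj.exists_column_ne (FTilde.rep_apply hy)
        by_contra! hh
        apply hi
        rw [a1, hh.1, hh.2]
        simp
    exact FiveClosure.ext_of_four hz hz' h0 h1 h2 h3

/-! ## Cross-ratios of the rows of a matrix -/

/-- The minor of a matrix on an ordered pair of rows. -/
def rowMinor (A : Matrix (Fin 5) (Fin 2) ℂ) (x y : Fin 5) : ℂ := A x 0 * A y 1 - A x 1 * A y 0

/-- The matrices with non-zero minors. -/
abbrev GenericMatrix : Type := {A : Matrix (Fin 5) (Fin 2) ℂ // ∀ I, plucker A I ≠ 0}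

theorem GenericMatrix.rowMinor_ne (A : GenericMatrix) (q : Fin 4 ↪ Fin 5) {i j : Fin 4}
    (h : i ≠ j) : rowMinor A.1 (q i) (q j) ≠ 0 :=
  minor_ne_zero A.2 fun e => h (q.injective e)

/-- The cross-ratio of four rows. -/
def crossRatio (A : GenericMatrix) (q : Fin 4 ↪ Fin 5) : CP1 :=
  Projectivization.mk ℂ ![rowMinor A.1 (q 0) (q 1) * rowMinor A.1 (q 2) (q 3),
    rowMinor A.1 (q 0) (q 2) * rowMinor A.1 (q 1) (q 3)]
    (pair_ne_zero (mul_ne_zero (A.rowMinor_ne q (by decide)) (A.rowMinor_ne q (by decide))))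

theorem crossRatio_mul {A B : GenericMatrix} {g : Matrix (Fin 2) (Fin 2) ℂ} (h : B.1 = A.1 * g)
    (q : Fin 4 ↪ Fin 5) : crossRatio B q = crossRatio A q := by
  have e : ∀ x y, rowMinor B.1 x y = rowMinor A.1 x y * g.det := by
    intro x y
    simp only [rowMinor, h, Matrix.mul_apply, Fin.sum_univ_two, Matrix.det_fin_two]
    ring
  rw [crossRatio, crossRatio, Projectivization.mk_eq_mk_iff']
  refine ⟨g.det ^ 2, ?_⟩
  simp only [e]
  funext i
  fin_cases i <;> simp <;> ring

/-- An invertible matrix acts continuously on the projective line. -/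
theorem exists_continuous_map (M : Matrix (Fin 2) (Fin 2) ℂ) (hM : M.det ≠ 0) :
    ∃ h : CP1 → CP1, Continuous h ∧ ∀ v hv w hw, M.mulVec v = w →
      h (Projectivization.mk ℂ v hv) = Projectivization.mk ℂ w hw := by
  have hinj : Function.Injective M.toLin' :=
    Matrix.mulVec_injective_of_isUnit ((Matrix.isUnit_iff_isUnit_det M).2 hM.isUnit)
  refine ⟨Projectivization.map M.toLin' hinj, ?_, ?_⟩
  · refine (isOpenQuotientMap_mk'.continuous_comp_iff (Y := CP1)
      (g := Projectivization.map M.toLin' hinj)).1 ?_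
    have hne : ∀ v : {v : Fin 2 → ℂ // v ≠ 0}, M.toLin' v.1 ≠ 0 := fun v h0 =>
      v.2 (hinj (h0.trans (map_zero _).symm))
    have hc : Continuous fun v : {v : Fin 2 → ℂ // v ≠ 0} => M.toLin' v.1 :=
      (LinearMap.continuous_of_finiteDimensional _).comp continuous_subtype_val
    exact isOpenQuotientMap_mk'.continuous.comp (hc.subtype_mk hne)
  · rintro v hv w hw rfl
    exact Projectivization.map_mk _ hinj v hv

/-- Reordering the rows changes the cross-ratio by a fixed continuous map. -/
theorem crossRatio_perm (π : Equiv.Perm (Fin 4)) : ∃ h : CP1 → CP1, Continuous h ∧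
    ∀ A q, crossRatio A (π.toEmbedding.trans q) = h (crossRatio A q) := by
  -- It suffices to treat the adjacent transpositions, which generate the symmetric group.
  have hπ : π ∈ Submonoid.closure
      (Set.range fun i : Fin 3 => Equiv.swap i.castSucc i.succ) := by
    rw [Equiv.Perm.mclosure_swap_castSucc_succ]
    trivial
  induction hπ using Submonoid.closure_induction with
  | one => exact ⟨id, continuous_id, fun A q => rfl⟩
  | mul π ρ _ _ hπ hρ =>
    obtain ⟨h, hc, hh⟩ := hπ
    obtain ⟨k, kc, hk⟩ := hρ
    -- Reindexing is a right action, so the maps compose in the opposite order.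
    refine ⟨k ∘ h, kc.comp hc, fun A q => ?_⟩
    rw [Function.comp_apply, ← hh, ← hk]
    rfl
  | mem π hπ =>
    obtain ⟨i, rfl⟩ := hπ
    -- The middle transposition exchanges the two products of minors. By the Plücker relation, each
    -- outer one sends (a : b) to (-a : b - a).
    obtain ⟨h, hc, hh⟩ := exists_continuous_map !![0, 1; 1, 0] (by simp)
    obtain ⟨k, kc, hk⟩ := exists_continuous_map !![-1, 0; -1, 1] (by simp)
    fin_cases i
    · refine ⟨k, kc, fun A q => (hk _ _ _ _ ?_).symm⟩
      have e0 : Equiv.swap (0 : Fin 4) 1 0 = 1 := by decide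
      have e1 : Equiv.swap (0 : Fin 4) 1 1 = 0 := by decide
      have e2 : Equiv.swap (0 : Fin 4) 1 2 = 2 := by decide
      have e3 : Equiv.swap (0 : Fin 4) 1 3 = 3 := by decide
      funext j
      fin_cases j <;> simp [e0, e1, e2, e3, rowMinor] <;> ring
    · refine ⟨h, hc, fun A q => (hh _ _ _ _ ?_).symm⟩
      have e0 : Equiv.swap (1 : Fin 4) 2 0 = 0 := by decide
      have e1 : Equiv.swap (1 : Fin 4) 2 1 = 2 := by decide
      have e2 : Equiv.swap (1 : Fin 4) 2 2 = 1 := by decide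
      have e3 : Equiv.swap (1 : Fin 4) 2 3 = 3 := by decide
      funext j
      fin_cases j <;> simp [e0, e1, e2, e3]
    · refine ⟨k, kc, fun A q => (hk _ _ _ _ ?_).symm⟩
      have e0 : Equiv.swap (2 : Fin 4) 3 0 = 0 := by decide
      have e1 : Equiv.swap (2 : Fin 4) 3 1 = 1 := by decide
      have e2 : Equiv.swap (2 : Fin 4) 3 2 = 3 := by decide
      have e3 : Equiv.swap (2 : Fin 4) 3 3 = 2 := by decide
      funext j
      fin_cases j <;> simp [e0, e1, e2, e3, rowMinor] <;> ring

theorem exists_perm_of_range_eq {q q' : Fin 4 ↪ Fin 5} (h : Set.range q' = Set.range q) :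
    ∃ π : Equiv.Perm (Fin 4), q' = π.toEmbedding.trans q := by
  let π : Equiv.Perm (Fin 4) := (Equiv.ofInjective q' q'.injective).trans
    ((Equiv.setCongr h).trans (Equiv.ofInjective q q.injective).symm)
  refine ⟨π, ?_⟩
  ext1 i
  have : Equiv.ofInjective q q.injective (π i) =
      Equiv.setCongr h (Equiv.ofInjective q' q'.injective i) := Equiv.apply_symm_apply _ _
  exact (congrArg Subtype.val this).symm

/-! ## Extension of the transition maps -/

theorem Pair.order_injective (I : Pair) :
    Function.Injective ![I.row 0, I.row 1, I.co 0, I.co 1, I.co 2] := by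
  have hr : I.row 0 ≠ I.row 1 := fun h => by simpa using I.row_inj.1 h
  have h0 := I.row_ne_co 0
  have h1 := I.row_ne_co 1
  intro i j h
  fin_cases i <;> fin_cases j <;> simp_all [I.co_inj, eq_comm]

/-- The ordering `(k, l, p, q, r)` of the five indices in the chart `M_I`. -/
def Pair.order (I : Pair) : Equiv.Perm (Fin 5) :=
  Equiv.ofBijective _ (Finite.injective_iff_bijective.1 I.order_injective)

/-- The quadruples whose cross-ratios are the five parameters. -/
def quadruple (m : Fin 5) : Fin 4 ↪ Fin 5 :=
  ⟨(![![1, 2, 3, 0], ![1, 2, 4, 0], ![1, 3, 4, 0], ![2, 3, 4, 0], ![2, 3, 4, 1]] :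
    Fin 5 → Fin 4 → Fin 5) m, by revert m; decide⟩

/-- Labels each parameter by the row it omits, a label that can be compared between charts. -/
theorem range_quadruple (m : Fin 5) : Set.range (quadruple m) = {m.rev}ᶜ := by
  have : ∀ m x : Fin 5, (∃ i, quadruple m i = x) ↔ x ≠ m.rev := by decide
  ext x
  exact this m x

theorem range_quadruple_order (I : Pair) (m : Fin 5) :
    Set.range ((quadruple m).trans I.order.toEmbedding) = {I.order m.rev}ᶜ := by
  have : ((quadruple m).trans I.order.toEmbedding : Fin 4 → Fin 5) = I.order ∘ quadruple m := rfl
  rw [this, Set.range_comp, range_quadruple, Set.image_compl_eq I.order.bijective,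
    Set.image_singleton]

/-- The normalized matrix of a point of the main stratum. -/
def genericChartMatrix (I : Pair) (L : MainStratum) : GenericMatrix :=
  ⟨chartMatrix I L.1, chartMatrix_plucker_ne_zero I L⟩

/-- The parameters of a point of the main stratum in a chart as a point of the cubic surface. -/
def openParam (I : Pair) (L : MainStratum) : openCubic := ⟨chartParam I L, chartParam_mem I L⟩

/-- With identity rows k, l, the minors pairing one of them with a third row are the chart
coordinates up to sign. This makes the five parameters cross-ratios of rows, hence independent of
the chosen basis of the plane. -/
theorem fiveParam_openParam (I : Pair) (L : MainStratum) (m : Fin 5) :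
    fiveParam (openParam I L) m =
      crossRatio (genericChartMatrix I L) ((quadruple m).trans I.order.toEmbedding) := by
  obtain ⟨h00, h01, h10, h11⟩ := chartMatrix_rows I L
  have hz := chartCoord_ne_zero I L
  have r1 : ∀ m, rowMinor (chartMatrix I L.1) (I.row 1) (I.co m) = -chartCoord I L.1 m 0 := by
    intro m
    rw [rowMinor, h10, h11, chartCoord]
    ring
  have r0 : ∀ m, rowMinor (chartMatrix I L.1) (I.co m) (I.row 0) = -chartCoord I L.1 m 1 := by
    intro m
    rw [rowMinor, h00, h01, chartCoord]
    ring
  have r1' : ∀ m, rowMinor (chartMatrix I L.1) (I.co m) (I.row 1) = chartCoord I L.1 m 0 := by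
    intro m
    rw [rowMinor, h10, h11, chartCoord]
    ring
  have rc : ∀ m n, rowMinor (chartMatrix I L.1) (I.co m) (I.co n) =
      chartCoord I L.1 m 0 * chartCoord I L.1 n 1 - chartCoord I L.1 m 1 * chartCoord I L.1 n 0 :=
    fun m n => rfl
  obtain ⟨u, hu, x0, y0⟩ := CP1.pt_rep _ _ (pair_ne_zero (b := chartCoord I L.1 1 0 *
    chartCoord I L.1 0 1) (mul_ne_zero (hz 0 0) (hz 1 1)))
  obtain ⟨v, hv, x1, y1⟩ := CP1.pt_rep _ _ (pair_ne_zero (b := chartCoord I L.1 2 0 *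
    chartCoord I L.1 0 1) (mul_ne_zero (hz 0 0) (hz 2 1)))
  have e0 : (openParam I L).1 0 = CP1.pt (chartCoord I L.1 0 0 * chartCoord I L.1 1 1)
    (chartCoord I L.1 1 0 * chartCoord I L.1 0 1)
    (pair_ne_zero (mul_ne_zero (hz 0 0) (hz 1 1))) := rfl
  have e1 : (openParam I L).1 1 = CP1.pt (chartCoord I L.1 0 0 * chartCoord I L.1 2 1)
    (chartCoord I L.1 2 0 * chartCoord I L.1 0 1)
    (pair_ne_zero (mul_ne_zero (hz 0 0) (hz 2 1))) := rfl
  fin_cases m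
  · refine (Projectivization.mk_eq_mk_iff' ℂ _ _ _ _).2 ⟨1, ?_⟩
    change (1 : ℂ) • ![rowMinor (chartMatrix I L.1) (I.row 1) (I.co 0) *
      rowMinor (chartMatrix I L.1) (I.co 1) (I.row 0),
      rowMinor (chartMatrix I L.1) (I.row 1) (I.co 1) *
      rowMinor (chartMatrix I L.1) (I.co 0) (I.row 0)] = _
    simp only [r0, r1, one_smul, neg_mul_neg]
  · refine (Projectivization.mk_eq_mk_iff' ℂ _ _ _ _).2 ⟨1, ?_⟩
    change (1 : ℂ) • ![rowMinor (chartMatrix I L.1) (I.row 1) (I.co 0) *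
      rowMinor (chartMatrix I L.1) (I.co 2) (I.row 0),
      rowMinor (chartMatrix I L.1) (I.row 1) (I.co 2) *
      rowMinor (chartMatrix I L.1) (I.co 0) (I.row 0)] = _
    simp only [r0, r1, one_smul, neg_mul_neg]
  · refine (Projectivization.mk_eq_mk_iff' ℂ _ _ _ _).2 ⟨1, ?_⟩
    change (1 : ℂ) • ![rowMinor (chartMatrix I L.1) (I.row 1) (I.co 1) *
      rowMinor (chartMatrix I L.1) (I.co 2) (I.row 0),
      rowMinor (chartMatrix I L.1) (I.row 1) (I.co 2) *
      rowMinor (chartMatrix I L.1) (I.co 1) (I.row 0)] = _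
    simp only [r0, r1, one_smul, neg_mul_neg]
  -- `u` and `v` come from the chosen representatives of c₁ and c₂; the coordinate z₁ is the common
  -- factor of the two entries of `paramD`.
  · refine (Projectivization.mk_eq_mk_iff' ℂ _ _ _ _).2 ⟨-(u * v * chartCoord I L.1 0 0), ?_⟩
    change _ • ![rowMinor (chartMatrix I L.1) (I.co 0) (I.co 1) *
      rowMinor (chartMatrix I L.1) (I.co 2) (I.row 0),
      rowMinor (chartMatrix I L.1) (I.co 0) (I.co 2) *
      rowMinor (chartMatrix I L.1) (I.co 1) (I.row 0)] = _
    rw [e0, e1, x0, y0, x1, y1]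
    simp only [r0, rc]
    funext i
    fin_cases i <;> simp <;> ring
  · refine (Projectivization.mk_eq_mk_iff' ℂ _ _ _ _).2 ⟨u * v * chartCoord I L.1 0 1, ?_⟩
    change _ • ![rowMinor (chartMatrix I L.1) (I.co 0) (I.co 1) *
      rowMinor (chartMatrix I L.1) (I.co 2) (I.row 1),
      rowMinor (chartMatrix I L.1) (I.co 0) (I.co 2) *
      rowMinor (chartMatrix I L.1) (I.co 1) (I.row 1)] = _
    rw [e0, e1, x0, y0, x1, y1]
    simp only [r1', rc]
    funext i
    fin_cases i <;> simp <;> ring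

theorem exists_openParam (I J : Pair) (c : openCubic) :
    ∃ L, c = openParam I L ∧ transition I J c = openParam J L := by
  obtain ⟨L, hL⟩ := Quotient.exists_rep (chartEquiv I c)
  refine ⟨L, ?_, ?_⟩
  · have : (chartEquiv I).symm (chartEquiv I c) = openParam I L := by
      rw [← hL]
      rfl
    rwa [Equiv.symm_apply_apply] at this
  · change (chartEquiv J).symm (chartEquiv I c) = _
    rw [← hL]
    rfl

/-- Each cross-ratio of the transformed point is a continuous function of one of the cross-ratios
of the given point. -/
theorem fiveParam_transition (I J : Pair) (m : Fin 5) : ∃ (n : Fin 5) (h : CP1 → CP1),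
    Continuous h ∧ ∀ c, fiveParam (transition I J c) m = h (fiveParam c n) := by
  -- The parameter in chart `I` omitting the same row as the `m`-th parameter in chart `J`.
  let n : Fin 5 := (I.order.symm (J.order m.rev)).rev
  have hr : Set.range ((quadruple m).trans J.order.toEmbedding) =
      Set.range ((quadruple n).trans I.order.toEmbedding) := by
    rw [range_quadruple_order, range_quadruple_order, Fin.rev_rev, Equiv.apply_symm_apply]
  obtain ⟨π, hπ⟩ := exists_perm_of_range_eq hr
  obtain ⟨h, hc, hh⟩ := crossRatio_perm π
  refine ⟨n, h, hc, fun c => ?_⟩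
  obtain ⟨L, h1, h2⟩ := exists_openParam I J c
  obtain ⟨g, -, hg⟩ := exists_change (chartMatrix_span I L).1
    ((chartMatrix_span I L).2.trans (chartMatrix_span J L).2.symm)
  rw [h2, h1, fiveParam_openParam, fiveParam_openParam, ← hh, hπ]
  exact crossRatio_mul hg _

/-- Each coordinate of the limit after transition is a continuous function of one coordinate of the
original limit. -/
theorem FiveClosure.limit_transition (I J : Pair) {l l' : Filter openCubic} [l.NeBot] [l'.NeBot]
    {x y y' : FiveClosure} (h1 : Tendsto FiveClosure.incl l (𝓝 x))
    (h2 : Tendsto (fun c => FiveClosure.incl (transition I J c)) l (𝓝 y))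
    (h3 : Tendsto FiveClosure.incl l' (𝓝 x))
    (h4 : Tendsto (fun c => FiveClosure.incl (transition I J c)) l' (𝓝 y')) : y = y' := by
  refine Subtype.ext (funext fun m => ?_)
  obtain ⟨n, h, hc, hh⟩ := fiveParam_transition I J m
  have key : ∀ {l : Filter openCubic} [l.NeBot] {y : FiveClosure},
      Tendsto FiveClosure.incl l (𝓝 x) →
      Tendsto (fun c => FiveClosure.incl (transition I J c)) l (𝓝 y) → y.1 m = h (x.1 n) := by
    intro l _ y k1 k2
    have k1' := tendsto_pi_nhds.1 (tendsto_subtype_rng.1 k1) n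
    have k2' := tendsto_pi_nhds.1 (tendsto_subtype_rng.1 k2) m
    refine tendsto_nhds_unique k2' (((hc.tendsto _).comp k1').congr fun c => ?_)
    exact (hh c).symm
  rw [key h1 h2, key h3 h4]

theorem FiveClosure.exists_homeomorph_transition (I J : Pair) : ∃ f : FiveClosure ≃ₜ FiveClosure,
    ∀ c, f (FiveClosure.incl c) = FiveClosure.incl (transition I J c) := by
  have hd : DenseRange fun c => FiveClosure.incl (transition I J c) := by
    have : Set.range (fun c => FiveClosure.incl (transition I J c)) =
        Set.range FiveClosure.incl := (transition I J).surjective.range_comp FiveClosure.incl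
    rw [DenseRange, this]
    exact FiveClosure.denseRange_incl
  refine exists_homeomorph_of_denseRange FiveClosure.denseRange_incl hd
    (fun l l' _ _ x y y' h1 h2 h3 h4 => FiveClosure.limit_transition I J h1 h2 h3 h4) ?_
  intro l l' _ _ x x' y h1 h2 h3 h4
  have e : ∀ c, transition J I (transition I J c) = c := by
    intro c
    simp [transition]
  have key : ∀ {l : Filter openCubic} {x : FiveClosure}, Tendsto FiveClosure.incl l (𝓝 x) →
      Tendsto (fun c => FiveClosure.incl (transition J I c)) (map (transition I J) l) (𝓝 x) := by
    intro l x h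
    rw [tendsto_map'_iff]
    refine h.congr fun c => ?_
    rw [Function.comp_apply, e]
  -- The converse determination is the same statement for the inverse transition, applied to the
  -- pushed-forward filters.
  exact FiveClosure.limit_transition J I (l := map (transition I J) l)
    (l' := map (transition I J) l') (tendsto_map'_iff.2 h2) (key h1) (tendsto_map'_iff.2 h4)
    (key h3)

theorem FTilde.exists_homeomorph_transition (I J : Pair) : ∃ f : FTilde ≃ₜ FTilde,
    ∀ c : openCubic, f (FTilde.incl c) = FTilde.incl (transition I J c) := by
  obtain ⟨e, he⟩ := exists_homeomorph_fTilde
  obtain ⟨f, hf⟩ := FiveClosure.exists_homeomorph_transition I J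
  refine ⟨(e.symm.trans f).trans e, fun c => ?_⟩
  rw [← he c, ← he (transition I J c)]
  change e (f (e.symm (e _))) = _
  rw [Homeomorph.symm_apply_apply, hf]

/-! ## Virtual spaces of parameters -/

/-- The points xₙ and yₙ do not depend on the chart: replacing cₙ by f_{I,J}(cₙ) leaves the point of
F unchanged, and continuity of `f` moves the limit. -/
theorem mapsTo_virtualSpace {X : Type} [TopologicalSpace X] {inc : openCubic → X} {I J : Pair}
    {f : X → X} (hf : Continuous f) (h : ∀ c, f (inc c) = inc (transition I J c)) (σ : Set Pair) :
    Set.MapsTo f (virtualSpace inc I σ) (virtualSpace inc J σ) := by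
  rintro c ⟨x, cn, y, hx, hy, hc, w⟩
  refine ⟨x, fun n => transition I J (cn n), y, hx, fun n => ?_, ?_, w⟩
  · rw [hy n]
    simp [transition]
  · simp only [← h]
    exact (hf.tendsto c).comp hc

theorem image_virtualSpace {X : Type} [TopologicalSpace X] {inc : openCubic → X} {I J : Pair}
    (f : X ≃ₜ X) (h : ∀ c, f (inc c) = inc (transition I J c)) (σ : Set Pair) :
    f '' virtualSpace inc I σ = virtualSpace inc J σ := by
  apply subset_antisymm (mapsTo_virtualSpace f.continuous h σ).image_subset
  intro y hy
  have h' : ∀ c, f.symm (inc c) = inc (transition J I c) := by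
    intro c
    rw [Homeomorph.symm_apply_eq, h]
    simp [transition]
  exact ⟨f.symm y, mapsTo_virtualSpace f.symm.continuous h' σ hy, f.apply_symm_apply y⟩

theorem mainTheorem5 :
    IsUniversalSpace FTilde FTilde.incl ∧
    (∀ I J : Pair, ∃ f : FTilde ≃ₜ FTilde,
      (∀ c : openCubic, f (FTilde.incl c) = FTilde.incl (transition I J c)) ∧
      ∀ σ : Set Pair, Admissible σ →
        f '' virtualSpace FTilde.incl I σ = virtualSpace FTilde.incl J σ) ∧
    Nonempty (FTilde ≃ₜ BlowupP1P1) ∧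
    Nonempty (FTilde ≃ₜ BlowupP2) := by
  obtain ⟨e, -⟩ := exists_homeomorph_fTilde
  obtain ⟨e1, -⟩ := exists_homeomorph_blowupP1P1
  obtain ⟨e2, -⟩ := exists_homeomorph_blowupP2
  refine ⟨⟨inferInstance, inferInstance, FTilde.isEmbedding_incl, FTilde.denseRange_incl,
    fun σ _ I J => ?_⟩, fun I J => ?_, ⟨e.symm.trans e1⟩, ⟨e.symm.trans e2⟩⟩
  · obtain ⟨f, hf⟩ := FTilde.exists_homeomorph_transition I J
    exact ⟨(f.image _).trans (Homeomorph.setCongr (image_virtualSpace f hf σ))⟩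
  · obtain ⟨f, hf⟩ := FTilde.exists_homeomorph_transition I J
    exact ⟨f, hf, fun σ _ => image_virtualSpace f hf σ⟩

end
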